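/- Let $k$ be a field of characteristic zero and let $\mathrm{Tame}(k^3)$ be the subgroup of the polynomial automorphism group of $k^3$ generated by the affine automorphisms and the automorphisms $(x_1+P(x_2,x_3),x_2,x_3)$, $P\in k[x_2,x_3]$. *The space.* Let $\nabla$ be the projectivisation of $\mathbb{R}_{>0}^3$, with the Euclidean metric pulled back by $[\alpha]\mapsto(\log\alpha_1,\log\alpha_2,\log\alpha_3)$, where $\alpha_1\alpha_2\alpha_3=1$, and let $\nabla^+=\{[\alpha]\in\nabla:\alpha_1\ge\alpha_2\ge\alpha_3\}$. Let $\nu_{\mathrm{id},\alpha}$ be the valuation on $k[x_1,x_2,x_3]$ whose value at $P$ is the minimum of $-\sum_i\alpha_im_i$ over the monomials $x_1^{m_1}x_2^{m_2}x_3^{m_3}$ appearing in $P$. For $f\in\mathrm{Tame}(k^3)$ let $\nu_{f,\alpha}(P)=\nu_{\mathrm{id},\alpha}(P\circ f)$, and let $\nu_{f,[\alpha]}$ be its class up to positive scalars. Let $\mathbf X$ be the set of all $\nu_{f,[\alpha]}$, and let $\mathbf E_f=\{\nu_{f,[\alpha]}:[\alpha]\in\nabla\}$ (apartments) and $\mathbf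 E_f^+=\{\nu_{f,[\alpha]}:[\alpha]\in\nabla^+\}$ (chambers). Each chamber carries the Euclidean metric of $\nabla^+$, and $\mathbf X$ carries the quotient metric: the infimum of the lengths of finite chains of consecutive points lying in common chambers. *The cells.* The admissible lines are the subsets of $\nabla^+$ given by $\alpha_i=p\alpha_j+q\alpha_l$ with $\{i,j,l\}=\{1,2,3\}$ and $p,q\in\mathbb{N}$ (including $0$). The vertices of $\nabla^+$ are the intersection points of distinct admissible lines, its open edges are the connected components of the complement of the vertices in the admissible lines, and its open $2$-cells are the connected components of the complement of the admissible lines. The open cells of $\mathbf X$ are the copies of the cells of $\nabla^+$ in all the chambers. *The links.* The link of a vertex $\nu$ of $\mathbf X$ is the metric graph whose vertices correspond to the edges of $\mathbf X$ containing $\nu$ in their closure and whose edges correspond to the corners at $\nu$ of the $2$-cells of $\mathbf X$; the length of an edge is the angle in $\mathbf X$ at the corresponding corner. If $\nu\in\mathbf E_f$, then the link $\Gamma_f$ of $\nu$ in $\mathbf E_f$ is the subgraph formed by the edges and corners contained in $\mathbf E_f$. **Proposition.** There is $\varepsilon_0>0$ such that for every integer $m\ge2$ and every vertex $\nu$ of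 $\mathbf X$ of weight $[m,1,1]$ (that is, $\nu=\nu_{h,[m,1,1]}$ for some $h\in\mathrm{Tame}(k^3)$), each simple cycle $\gamma$ of length $<2\pi+\varepsilon_0$ in the link of $\nu$ * equals $\Gamma_f$ for some $f\in\mathrm{Tame}(k^3)$ with $\nu_{f,[m,1,1]}=\nu$, or * is the closure of $(\Gamma_f\cup\Gamma_g)\setminus(\Gamma_f\cap\Gamma_g)$ for some $f,g\in\mathrm{Tame}(k^3)$ with $\nu_{f,[m,1,1]}=\nu_{g,[m,1,1]}=\nu$. -/

import Mathlib

namespace TameX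

open Filter Topology

noncomputable section

/-! ### The weight space -/

/-- The open positive octant of `ℝ³`; coordinates are indexed by `0, 1, 2` instead of `1, 2, 3`. -/
abbrev PosTriple : Type := {α : Fin 3 → ℝ // ∀ i, 0 < α i}

/-- Proportionality of positive triples. -/
instance weightSetoid : Setoid PosTriple where
  r α β := ∃ c : ℝ, 0 < c ∧ ∀ i, β.1 i = c * α.1 i
  iseqv :=
    { refl := fun _ => ⟨1, one_pos, fun _ => (one_mul _).symm⟩
      symm := by
        rintro α β ⟨c, hc, h⟩
        refine ⟨c⁻¹, inv_pos.2 hc, fun i => ?_⟩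
        rw [h i, inv_mul_cancel_left₀ hc.ne']
      trans := by
        rintro α β γ ⟨c, hc, h⟩ ⟨d, hd, h'⟩
        exact ⟨d * c, mul_pos hd hc, fun i => by rw [h' i, h i, mul_assoc]⟩ }

/-- The weight space `∇`: the projectivisation of the positive octant. -/
def WeightSpace : Type := Quotient weightSetoid

/-- The class `[α]` of a positive triple. -/
def WeightSpace.mk (α : PosTriple) : WeightSpace := Quotient.mk weightSetoid α

/-- `(log β₁, log β₂, log β₃)` for the multiple `β` of `α` with `β₁ β₂ β₃ = 1`. -/
def logTriple (α : PosTriple) : EuclideanSpace ℝ (Fin 3) :=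
  WithLp.toLp 2 fun i => Real.log (α.1 i) - (∑ j, Real.log (α.1 j)) / 3

theorem logTriple_eq_iff (α β : PosTriple) : logTriple α = logTriple β ↔ α ≈ β := by
  constructor
  · intro h
    have h1 : ∀ i, Real.log (α.1 i) - (∑ j, Real.log (α.1 j)) / 3
        = Real.log (β.1 i) - (∑ j, Real.log (β.1 j)) / 3 := fun i => congrArg (fun v => v i) h
    refine ⟨Real.exp ((∑ j, Real.log (β.1 j)) / 3 - (∑ j, Real.log (α.1 j)) / 3),
      Real.exp_pos _, fun i => ?_⟩
    have h2 := h1 i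
    conv_rhs => rw [← Real.exp_log (α.2 i)]
    rw [← Real.exp_add, ← Real.exp_log (β.2 i)]
    congr 1
    linarith
  · rintro ⟨c, hc, h⟩
    have h1 : ∀ i, Real.log (β.1 i) = Real.log c + Real.log (α.1 i) := fun i => by
      rw [h i, Real.log_mul hc.ne' (α.2 i).ne']
    ext i
    simp only [logTriple, h1, Fin.sum_univ_three]
    ring

/-- The embedding of `∇` in the Euclidean plane `t₁ + t₂ + t₃ = 0` of `ℝ³`. -/
def WeightSpace.log : WeightSpace → EuclideanSpace ℝ (Fin 3) :=
  Quotient.lift logTriple fun α β h => (logTriple_eq_iff α β).2 h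

theorem WeightSpace.log_injective : Function.Injective WeightSpace.log := by
  intro a b
  induction a using Quotient.inductionOn
  induction b using Quotient.inductionOn
  intro h
  exact Quotient.sound ((logTriple_eq_iff _ _).1 h)

/-- The Euclidean metric (and its topology) on `∇`. -/
instance : MetricSpace WeightSpace :=
  MetricSpace.induced WeightSpace.log WeightSpace.log_injective inferInstance

/-- The Weyl chamber `∇⁺` of all `[α]` with `α₁ ≥ α₂ ≥ α₃`. -/
def nablaPlus : Set WeightSpace :=
  {a | ∃ α : PosTriple, WeightSpace.mk α = a ∧ α.1 1 ≤ α.1 0 ∧ α.1 2 ≤ α.1 1}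

/-- The admissible lines in `∇⁺`: subsets given by `α_i = p α_j + q α_l`, where `p, q` are
natural numbers and `i, j, l` are the three indices in any order. -/
def admissibleLines : Set (Set WeightSpace) :=
  {L | ∃ (σ : Equiv.Perm (Fin 3)) (p q : ℕ),
    L = {a | a ∈ nablaPlus ∧ ∃ α : PosTriple, WeightSpace.mk α = a ∧
      α.1 (σ 0) = p * α.1 (σ 1) + q * α.1 (σ 2)}}

/-- The vertices of `∇⁺`: the intersection points of distinct admissible lines. -/
def nablaVertices : Set WeightSpace :=
  {a | ∃ L ∈ admissibleLines, ∃ L' ∈ admissibleLines, L ≠ L' ∧ a ∈ L ∧ a ∈ L'}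

/-- The open edges of `∇⁺`: the connected components of the complement of the vertices in the
admissible lines. -/
def IsNablaEdge (E : Set WeightSpace) : Prop :=
  ∃ L ∈ admissibleLines, ∃ a ∈ L \ nablaVertices, E = connectedComponentIn (L \ nablaVertices) a

/-- The open `2`-cells of `∇⁺`: the connected components of the complement of the admissible
lines in `∇⁺`. -/
def IsNablaFace (C : Set WeightSpace) : Prop :=
  ∃ a ∈ nablaPlus \ ⋃₀ admissibleLines, C = connectedComponentIn (nablaPlus \ ⋃₀ admissibleLines) a

/-! ### Tame automorphisms and monomial valuations -/

variable (k : Type*) [Field k]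

/-- The polynomial ring `k[x₁, x₂, x₃]`. -/
abbrev Poly : Type _ := MvPolynomial (Fin 3) k

/-- The tame automorphism group of `k³`. A polynomial automorphism `f = (f₁, f₂, f₃)` is given by
the algebra automorphism `P ↦ P ∘ f` of `k[x₁, x₂, x₃]`, which sends `x_i` to `f_i`. The group is
generated by the affine automorphisms (all components of degree at most `1`) and the automorphisms
`(x₁ + P(x₂, x₃), x₂, x₃)`. (Passing to `P ↦ P ∘ f` reverses the order of composition, which does
not affect the subgroup generated by a set.) -/
def Tame : Subgroup (Poly k ≃ₐ[k] Poly k) :=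
  Subgroup.closure
    ({f | ∀ i, (f (MvPolynomial.X i)).totalDegree ≤ 1} ∪
      {f | ∃ P ∈ MvPolynomial.supported k ({1, 2} : Set (Fin 3)),
        f (MvPolynomial.X 0) = MvPolynomial.X 0 + P ∧
        f (MvPolynomial.X 1) = MvPolynomial.X 1 ∧ f (MvPolynomial.X 2) = MvPolynomial.X 2})

variable {k}

/-- The valuation `ν_{id,α}`: the minimum of `-∑ α_i m_i` over the monomials
`x₁^{m₁} x₂^{m₂} x₃^{m₃}` of `P`, and `+∞` at `P = 0`. -/
def nuId (α : PosTriple) (P : Poly k) : WithTop ℝ :=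
  P.support.inf fun m => ((-∑ i, α.1 i * (m i : ℝ) : ℝ) : WithTop ℝ)

/-- The monomial valuation `ν_{f,α}(P) = ν_{id,α}(P ∘ f)`. -/
def nu (f : Tame k) (α : PosTriple) : Poly k → WithTop ℝ := fun P => nuId α (f.1 P)

variable (k)

/-- Proportionality of functions `k[x₁, x₂, x₃] → ℝ ∪ {+∞}`, by a positive real factor. -/
instance valSetoid : Setoid (Poly k → WithTop ℝ) where
  r ν μ := ∃ c : ℝ, 0 < c ∧ ∀ P, μ P = (ν P).map (c * ·)
  iseqv :=
    { refl := fun ν => ⟨1, one_pos, fun P => by cases ν P <;> simp⟩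
      symm := by
        rintro ν μ ⟨c, hc, h⟩
        refine ⟨c⁻¹, inv_pos.2 hc, fun P => ?_⟩
        rw [h P, WithTop.map_map]
        have : (c⁻¹ * ·) ∘ (c * ·) = (id : ℝ → ℝ) :=
          funext fun x => inv_mul_cancel_left₀ hc.ne' x
        rw [this, WithTop.map_id, id]
      trans := by
        rintro ν μ ξ ⟨c, hc, h⟩ ⟨d, hd, h'⟩
        refine ⟨d * c, mul_pos hd hc, fun P => ?_⟩
        rw [h' P, h P, WithTop.map_map]
        congr 1
        exact funext fun x => (mul_assoc d c x).symm }

variable {k}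

theorem nu_smul (f : Tame k) (α β : PosTriple) (h : α ≈ β) : nu f α ≈ nu f β := by
  obtain ⟨c, hc, h⟩ := h
  refine ⟨c, hc, fun P => ?_⟩
  have hm : Monotone (WithTop.map (c * ·) : WithTop ℝ → WithTop ℝ) :=
    WithTop.monotone_map_iff.2 fun x y hxy => mul_le_mul_of_nonneg_left hxy hc.le
  simp only [nu, nuId]
  rw [Finset.apply_inf_eq_inf_comp (WithTop.map (c * ·)) (fun x y => hm.map_inf x y) rfl]
  refine Finset.inf_congr rfl fun m _ => ?_
  simp only [Function.comp, WithTop.map_coe, h]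
  congr 1
  rw [mul_neg, Finset.mul_sum]
  simp only [mul_assoc]

/-- The projective class `ν_{f,[α]}`, depending only on the class `[α]`. -/
def nuClass (f : Tame k) : WeightSpace → Quotient (valSetoid k) :=
  Quotient.map (nu f) fun α β h => nu_smul f α β h

variable (k)

/-- The space `𝐗` of projective classes of monomial valuations. -/
def X : Type _ := {x : Quotient (valSetoid k) // ∃ f a, x = nuClass f a}

variable {k}

/-- `ν_{f,[α]}` as a point of `𝐗`. -/
def pt (f : Tame k) (a : WeightSpace) : X k := ⟨nuClass f a, f, a, rfl⟩

/-- The apartment `𝐄_f`. -/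
def apartment (f : Tame k) : Set (X k) := Set.range (pt f)

/-! ### The metric of `𝐗` -/

/-- `ChainOfLength x y l`: there is a chain from `x` to `y` of length `l`, that is, a finite sequence
of pairs of points, each pair in a single chamber, such that the second point of each pair and the
first point of the next pair are equal in `𝐗`; the length is the sum of the Euclidean distances. -/
inductive ChainOfLength : X k → X k → ℝ → Prop
  | single (f : Tame k) (a b : WeightSpace) (ha : a ∈ nablaPlus) (hb : b ∈ nablaPlus) :
      ChainOfLength (pt f a) (pt f b) (dist a b)
  | cons (f : Tame k) (a b : WeightSpace) (ha : a ∈ nablaPlus) (hb : b ∈ nablaPlus)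
      (y : X k) (l : ℝ) (h : ChainOfLength (pt f b) y l) :
      ChainOfLength (pt f a) y (dist a b + l)

/-- The quotient metric `d_𝐗`: the infimum of the lengths of chains (any two points of `𝐗` are
joined by a chain). -/
def distX (x y : X k) : ℝ := sInf {l | ChainOfLength x y l}

/-- The comparison angle at `p` of the triple `(x, p, y)`. -/
def comparisonAngle (p x y : X k) : ℝ :=
  Real.arccos ((distX p x ^ 2 + distX p y ^ 2 - distX x y ^ 2) / (2 * distX p x * distX p y))

/-- The filter of the points of `e` that tend to `p` in `𝐗`. -/
def towards (p : X k) (e : Set (X k)) : Filter (X k) := comap (distX p) (𝓝 0) ⊓ 𝓟 e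

/-- The Alexandrov angle at `p` between two paths `e`, `e'` issuing from `p`: the upper limit of
the comparison angles of `(x, p, y)` for `x ∈ e` and `y ∈ e'` tending to `p`. -/
def angleX (p : X k) (e e' : Set (X k)) : ℝ :=
  limsup (fun z : X k × X k => comparisonAngle p z.1 z.2) (towards p e ×ˢ towards p e')

/-! ### The link of a vertex of `𝐗`

Every open cell of `𝐗` is the copy `pt f '' σ`, in some chamber, of an open cell `σ` of `∇⁺`;
the corresponding closed cell is `pt f '' closure σ`. -/

/-- The vertices of the link of `ν`: the open edges of `𝐗` that contain `ν` in their closure. -/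
def IsLinkVertex (ν : X k) (e : Set (X k)) : Prop :=
  ∃ (f : Tame k) (E : Set WeightSpace), IsNablaEdge E ∧ e = pt f '' E ∧ ν ∈ pt f '' closure E

/-- The edges of the link of `ν`: the corners at `ν` of `2`-cells of `𝐗`. A closed `2`-cell has at
most one corner at `ν`, so a corner is recorded by its open `2`-cell. -/
def IsLinkEdge (ν : X k) (c : Set (X k)) : Prop :=
  ∃ (f : Tame k) (C : Set WeightSpace), IsNablaFace C ∧ c = pt f '' C ∧ ν ∈ pt f '' closure C

/-- Incidence in the link of `ν`: `e` is one of the two sides of the corner of `c` at `ν`. -/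
def LinkInc (ν : X k) (c e : Set (X k)) : Prop :=
  ∃ (f : Tame k) (C E : Set WeightSpace), IsNablaFace C ∧ IsNablaEdge E ∧ E ⊆ closure C ∧
    c = pt f '' C ∧ e = pt f '' E ∧ ν ∈ pt f '' closure E

/-- A set of vertices together with a set of edges of a link. -/
@[ext]
structure SubLink (k : Type*) [Field k] where
  /-- the vertices -/
  verts : Set (Set (X k))
  /-- the edges -/
  edges : Set (Set (X k))

/-- The link `Γ_f` of `ν` in the apartment `𝐄_f`. -/
def apartmentLink (ν : X k) (f : Tame k) : SubLink k where
  verts := {e | IsLinkVertex ν e ∧ e ⊆ apartment f}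
  edges := {c | IsLinkEdge ν c ∧ c ⊆ apartment f}

/-- The closure, in the link of `ν`, of `(A ∪ B) ∖ (A ∩ B)`: the edges and the vertices that lie in
exactly one of `A`, `B`, together with the end-vertices of these edges. -/
def closureSymmDiff (ν : X k) (A B : SubLink k) : SubLink k where
  verts := {e | e ∈ (A.verts ∪ B.verts) \ (A.verts ∩ B.verts) ∨
    ∃ c ∈ (A.edges ∪ B.edges) \ (A.edges ∩ B.edges), LinkInc ν c e}
  edges := (A.edges ∪ B.edges) \ (A.edges ∩ B.edges)

/-- A (simple) cycle in the link of `ν`: cyclically ordered, pairwise distinct vertices and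
pairwise distinct edges, the `i`-th edge joining the `i`-th vertex to the next one. There are no
loops, so the number `n + 2` of edges is at least `2`. -/
structure LinkCycle (ν : X k) where
  /-- the number of edges, minus two -/
  n : ℕ
  /-- the vertices, in cyclic order -/
  vert : Fin (n + 2) → Set (X k)
  /-- the edges, in cyclic order -/
  edge : Fin (n + 2) → Set (X k)
  vert_injective : Function.Injective vert
  edge_injective : Function.Injective edge
  inc_left : ∀ i, LinkInc ν (edge i) (vert i)
  inc_right : ∀ i, LinkInc ν (edge i) (vert (i + 1))

/-- The length of a cycle: each edge of the link has the length of the angle in `𝐗` at the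
corresponding corner, between the two sides of the corner. -/
def LinkCycle.length {ν : X k} (γ : LinkCycle ν) : ℝ :=
  ∑ i, angleX ν (γ.vert i) (γ.vert (i + 1))

/-- A cycle as a set of vertices and edges. -/
def LinkCycle.toSubLink {ν : X k} (γ : LinkCycle ν) : SubLink k where
  verts := Set.range γ.vert
  edges := Set.range γ.edge

/-- The weight `[m, 1, 1]`. -/
def weightM11 (m : ℕ) (hm : 2 ≤ m) : WeightSpace :=
  WeightSpace.mk ⟨![(m : ℝ), 1, 1], by
    have : (0 : ℝ) < m := by exact_mod_cast (by omega : 0 < m)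
    intro i
    fin_cases i <;> simp [this]⟩

end

end TameX

/-!
Near `[m, 1, 1]` the Weyl chamber is a half-plane cut into a fan by the rays `0, …, m + 2`. The two
faces adjacent to a ray of level `s ≥ 1` determine each other in the link, so the link branches only
downwards, and a cycle is a concatenation of mountains, which climb in one chamber from level `0` to
a peak `s` and then descend in another one. By a Bruhat-type decomposition, two chambers that meet
at level `0` in the link are the two halves of an apartment. Hence a cycle with one mountain is the
link of an apartment, and a cycle with two mountains is the closure of the symmetric difference of
two of them.

A mountain with peak `s` has length twice the angle between the rays `0` and `s`. This angle is at
least `π / 3`, so four mountains are too long. For a cycle of three mountains with peaks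
`s₁, s₂, s₃`, the product of the three changes of chart is trivial; comparing the terms
`x₁ + P(x₂, x₃)` gives a relation between binary forms of degree `m` with zeros of high order at
three distinct points, and a Mason–Stothers argument, which needs characteristic zero, yields
`s₁ + s₂ + s₃ ≥ m + 2`. So one peak has level at least `m / 6 + 1`, its angle is at least
`arccos (2 / 5)`, and `ε₀ = 2 (arccos (2 / 5) - π / 3)` works.
-/

namespace TameX

open Filter Topology

/-! ### Cells of the Weyl chamber as sign classes of linear forms -/

section

namespace WeightSpace

/-- The affine coordinates of the weight space: the representative of `a` with last
coordinate `1`. -/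
noncomputable def coord (a : WeightSpace) (i : Fin 3) : ℝ := Real.exp (a.log i - a.log 2)

theorem coord_pos (a : WeightSpace) (i : Fin 3) : 0 < a.coord i := Real.exp_pos _

@[simp]
theorem coord_two (a : WeightSpace) : a.coord 2 = 1 := by simp [coord]

theorem coord_mk (α : PosTriple) (i : Fin 3) : (mk α).coord i = α.1 i / α.1 2 := by
  change Real.exp (logTriple α i - logTriple α 2) = _
  simp only [logTriple, sub_sub_sub_cancel_right]
  rw [Real.exp_sub, Real.exp_log (α.2 i), Real.exp_log (α.2 2)]

@[simp]
theorem mk_coord (a : WeightSpace) : mk ⟨a.coord, a.coord_pos⟩ = a := by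
  induction a using Quotient.inductionOn with
  | h α =>
    refine Quotient.sound ⟨α.1 2, α.2 2, fun i => ?_⟩
    exact (mul_div_cancel₀ _ (α.2 2).ne').symm.trans (congrArg _ (coord_mk α i).symm)

@[ext]
theorem ext {a b : WeightSpace} (h₀ : a.coord 0 = b.coord 0) (h₁ : a.coord 1 = b.coord 1) :
    a = b := by
  have h : a.coord = b.coord := by
    funext i
    fin_cases i <;> simp [h₀, h₁]
  rw [← mk_coord a, ← mk_coord b]
  congr 2

theorem isometry_log : Isometry log := Isometry.of_dist_eq fun _ _ => rfl

theorem continuous_coord (i : Fin 3) : Continuous fun a : WeightSpace => a.coord i := by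
  have h (j : Fin 3) : Continuous fun a : WeightSpace => a.log j :=
    (EuclideanSpace.proj (𝕜 := ℝ) j).continuous.comp isometry_log.continuous
  exact Real.continuous_exp.comp ((h i).sub (h 2))

theorem continuous_mk_comp {ι : Type*} [TopologicalSpace ι] (x : ι → Fin 3 → ℝ)
    (hx : ∀ s i, 0 < x s i) (hc : ∀ i, Continuous fun s => x s i) :
    Continuous fun s => mk ⟨x s, hx s⟩ := by
  rw [isometry_log.isEmbedding.continuous_iff]
  change Continuous fun s => logTriple ⟨x s, hx s⟩
  have hl (i : Fin 3) : Continuous fun s => Real.log (x s i) :=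
    (hc i).log fun s => (hx s i).ne'
  refine (PiLp.continuous_toLp 2 _).comp (continuous_pi fun i => ?_)
  exact (hl i).sub ((continuous_finsetSum _ fun j _ => hl j).div_const 3)

/-- The point `[x, y, 1]` of the weight space. It is meaningful for positive `x` and `y`; the
logarithms only serve to make it a total function. -/
noncomputable def ofCoord (x y : ℝ) : WeightSpace :=
  mk ⟨![Real.exp (Real.log x), Real.exp (Real.log y), 1], fun i => by
    fin_cases i <;> simp [Real.exp_pos]⟩

theorem coord_ofCoord_zero {x : ℝ} (hx : 0 < x) (y : ℝ) : (ofCoord x y).coord 0 = x := by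
  simp [ofCoord, coord_mk, Real.exp_log hx]

theorem coord_ofCoord_one (x : ℝ) {y : ℝ} (hy : 0 < y) : (ofCoord x y).coord 1 = y := by
  simp [ofCoord, coord_mk, Real.exp_log hy]

/-- The segment from `a` to `b` in the affine coordinates. -/
noncomputable def seg (a b : WeightSpace) (t : unitInterval) : WeightSpace :=
  mk ⟨fun i => (1 - t) * a.coord i + t * b.coord i, fun i =>
    convex_Ioi (0 : ℝ) (a.coord_pos i) (b.coord_pos i) (sub_nonneg.2 t.2.2) t.2.1
      (sub_add_cancel 1 _)⟩

theorem coord_seg (a b : WeightSpace) (t : unitInterval) (i : Fin 3) :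
    (seg a b t).coord i = (1 - t) * a.coord i + t * b.coord i := by
  simp [seg, coord_mk]

theorem continuous_seg (a b : WeightSpace) : Continuous (seg a b) :=
  continuous_mk_comp _ _ fun i => by fun_prop

end WeightSpace

open WeightSpace

theorem mem_nablaPlus_iff {a : WeightSpace} :
    a ∈ nablaPlus ↔ a.coord 1 ≤ a.coord 0 ∧ 1 ≤ a.coord 1 := by
  constructor
  · rintro ⟨α, rfl, h₁, h₂⟩
    rw [coord_mk, coord_mk, one_le_div (α.2 2)]
    exact ⟨div_le_div_of_nonneg_right h₁ (α.2 2).le, h₂⟩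
  · rintro ⟨h₁, h₂⟩
    exact ⟨⟨a.coord, a.coord_pos⟩, mk_coord a, h₁, by simpa using h₂⟩

theorem isClosed_nablaPlus : IsClosed nablaPlus := by
  simp only [Set.ext fun a => mem_nablaPlus_iff (a := a)]
  exact (isClosed_le (continuous_coord 1) (continuous_coord 0)).inter
    (isClosed_le continuous_const (continuous_coord 1))

theorem seg_mem_nablaPlus {a b : WeightSpace} (ha : a ∈ nablaPlus) (hb : b ∈ nablaPlus)
    (t : unitInterval) : seg a b t ∈ nablaPlus := by
  rw [mem_nablaPlus_iff] at *
  simp only [coord_seg]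
  have h0 := t.2.1
  have h1 := sub_nonneg.2 t.2.2
  constructor <;> nlinarith

/-- The weight `α₁ n₁ + α₂ n₂ + α₃ n₃` of the monomial with exponent `n`. -/
def wt (α : Fin 3 → ℝ) (n : Fin 3 → ℕ) : ℝ := ∑ i, α i * n i

theorem wt_single (α : Fin 3 → ℝ) (i : Fin 3) : wt α (Pi.single i 1) = α i := by
  simp [wt, Pi.single_apply]

theorem wt_strictMono {α : Fin 3 → ℝ} (hα : ∀ i, 0 < α i) : StrictMono (wt α) := by
  intro n n' h
  obtain ⟨hle, i, hi⟩ := Pi.lt_def.1 h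
  refine Finset.sum_lt_sum (fun j _ => ?_) ⟨i, Finset.mem_univ i, ?_⟩
  · exact mul_le_mul_of_nonneg_left (Nat.cast_le.2 (hle j)) (hα j).le
  · exact mul_lt_mul_of_pos_left (Nat.cast_lt.2 hi) (hα i)

/-- The linear form comparing the weight of the variable `x_i` with that of the monomial with
exponent `n`. The forms with `n i = 0` cut out the admissible lines; the others have constant
sign. -/
noncomputable def weightForm (i : Fin 3) (n : Fin 3 → ℕ) (a : WeightSpace) : ℝ :=
  a.coord i - wt a.coord n

theorem continuous_weightForm (i : Fin 3) (n : Fin 3 → ℕ) : Continuous (weightForm i n) :=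
  (continuous_coord i).sub
    (continuous_finsetSum _ fun j _ => (continuous_coord j).mul_const _)

theorem weightForm_seg (i : Fin 3) (n : Fin 3 → ℕ) (a b : WeightSpace) (t : unitInterval) :
    weightForm i n (seg a b t) = (1 - t) * weightForm i n a + t * weightForm i n b := by
  simp only [weightForm, wt, coord_seg, Fin.sum_univ_three]
  ring

theorem sign_weightForm_eq_of_ne_zero {i : Fin 3} {n : Fin 3 → ℕ} (h : n i ≠ 0)
    (a b : WeightSpace) : SignType.sign (weightForm i n a) = SignType.sign (weightForm i n b) := by
  have hle : Pi.single i 1 ≤ n := by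
    intro j
    obtain rfl | hj := eq_or_ne j i
    · simpa using Nat.one_le_iff_ne_zero.2 h
    · simp [hj]
  obtain rfl | hlt := hle.eq_or_lt
  · simp [weightForm, wt_single]
  · have hneg (c : WeightSpace) : weightForm i n c < 0 := by
      rw [weightForm, sub_neg, ← wt_single c.coord i]
      exact wt_strictMono c.coord_pos hlt
    rw [sign_neg (hneg a), sign_neg (hneg b)]

/-- The zero set of a weight form in the Weyl chamber. -/
def zeroLine (i : Fin 3) (n : Fin 3 → ℕ) : Set WeightSpace :=
  {a | a ∈ nablaPlus ∧ weightForm i n a = 0}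

theorem zeroLine_eq (σ : Equiv.Perm (Fin 3)) {n : Fin 3 → ℕ} (hn : n (σ 0) = 0) :
    zeroLine (σ 0) n = {a | a ∈ nablaPlus ∧ ∃ α : PosTriple, mk α = a ∧
      α.1 (σ 0) = n (σ 1) * α.1 (σ 1) + n (σ 2) * α.1 (σ 2)} := by
  have hform (a : WeightSpace) : weightForm (σ 0) n a
      = a.coord (σ 0) - (n (σ 1) * a.coord (σ 1) + n (σ 2) * a.coord (σ 2)) := by
    rw [weightForm, wt, ← Equiv.sum_comp σ, Fin.sum_univ_three, hn]
    push_cast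
    ring
  ext a
  simp only [zeroLine, hform, Set.mem_ofPred_eq]
  refine and_congr_right fun _ => ⟨fun h => ⟨_, mk_coord a, sub_eq_zero.1 h⟩, ?_⟩
  rintro ⟨α, rfl, h⟩
  simp only [coord_mk, h]
  ring

theorem mem_admissibleLines_iff {L : Set WeightSpace} :
    L ∈ admissibleLines ↔ ∃ i n, n i = 0 ∧ L = zeroLine i n := by
  constructor
  · rintro ⟨σ, p, q, rfl⟩
    refine ⟨σ 0, ![0, p, q] ∘ σ.symm, by simp, ?_⟩
    rw [zeroLine_eq σ (by simp)]
    simp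
  · rintro ⟨i, n, hn, rfl⟩
    have h0 : Equiv.swap 0 i 0 = i := Equiv.swap_apply_left 0 i
    exact ⟨Equiv.swap 0 i, _, _, by simpa only [h0] using zeroLine_eq (Equiv.swap 0 i) (h0 ▸ hn)⟩

theorem zeroLine_mem_admissibleLines {i : Fin 3} {n : Fin 3 → ℕ} (h : n i = 0) :
    zeroLine i n ∈ admissibleLines :=
  mem_admissibleLines_iff.2 ⟨i, n, h, rfl⟩

/-- The sign class of `a`: the points of the Weyl chamber at which all weight forms have the same
sign as at `a`. The open cells of the Weyl chamber are such sign classes. -/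
def cell (a : WeightSpace) : Set WeightSpace :=
  {b | b ∈ nablaPlus ∧ ∀ i n, SignType.sign (weightForm i n b) = SignType.sign (weightForm i n a)}

theorem mem_cell_self {a : WeightSpace} (ha : a ∈ nablaPlus) : a ∈ cell a := ⟨ha, fun _ _ => rfl⟩

theorem cell_eq_of_mem {a b : WeightSpace} (h : b ∈ cell a) : cell b = cell a := by
  simp only [cell, h.2]

theorem weightForm_eq_zero_iff_of_mem_cell {a b : WeightSpace} (h : b ∈ cell a) (i : Fin 3)
    (n : Fin 3 → ℕ) : weightForm i n b = 0 ↔ weightForm i n a = 0 := by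
  rw [← sign_eq_zero_iff, h.2, sign_eq_zero_iff]

theorem isPreconnected_cell (a : WeightSpace) : IsPreconnected (cell a) := by
  refine isPreconnected_of_forall_pair fun b hb c hc =>
    ⟨Set.range (seg b c), ?_, ⟨0, ?_⟩, ⟨1, ?_⟩, isPreconnected_range (continuous_seg b c)⟩
  · rintro _ ⟨t, rfl⟩
    refine ⟨seg_mem_nablaPlus hb.1 hc.1 t, fun i n => ?_⟩
    have hconvex := Set.ordConnected_singleton (a := SignType.sign (weightForm i n a))
      |>.preimage_mono (SignType.sign (α := ℝ)).monotone |>.convex (𝕜 := ℝ)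
    rw [weightForm_seg]
    exact hconvex (hb.2 i n) (hc.2 i n) (sub_nonneg.2 t.2.2) t.2.1 (sub_add_cancel 1 _)
  all_goals ext <;> simp [coord_seg]

theorem sign_eq_of_isPreconnected {Y : Type*} [TopologicalSpace Y] {S : Set Y}
    (hS : IsPreconnected S) {F : Y → ℝ} (hF : Continuous F) (h0 : ∀ a ∈ S, F a ≠ 0) {a b : Y}
    (ha : a ∈ S) (hb : b ∈ S) : SignType.sign (F a) = SignType.sign (F b) :=
  hS.constant (f := fun x => SignType.sign (F x))
    (fun x hx => ((continuousAt_sign_of_ne_zero (h0 x hx)).comp hF.continuousAt).continuousWithinAt)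
    ha hb

theorem connectedComponentIn_eq_cell {S : Set WeightSpace} (hS : S ⊆ nablaPlus) {a : WeightSpace}
    (ha : a ∈ S) (hcell : cell a ⊆ S)
    (hzero : ∀ i n, n i = 0 → ∀ b ∈ S, (weightForm i n b = 0 ↔ weightForm i n a = 0)) :
    connectedComponentIn S a = cell a := by
  have hsub := connectedComponentIn_subset S a
  refine Set.Subset.antisymm (fun b hb => ⟨hS (hsub hb), fun i n => ?_⟩)
    ((isPreconnected_cell a).subset_connectedComponentIn (mem_cell_self (hS ha)) hcell)
  by_cases hn : n i = 0
  · by_cases h0 : weightForm i n a = 0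
    · rw [h0, (hzero i n hn b (hsub hb)).2 h0]
    · exact sign_eq_of_isPreconnected isPreconnected_connectedComponentIn
        (continuous_weightForm i n) (fun c hc => h0 ∘ (hzero i n hn c (hsub hc)).1) hb
        (mem_connectedComponentIn ha)
  · exact sign_weightForm_eq_of_ne_zero hn b a

theorem IsNablaFace.exists_eq_cell {C : Set WeightSpace} (h : IsNablaFace C) :
    ∃ a ∈ nablaPlus, (∀ i n, n i = 0 → weightForm i n a ≠ 0) ∧ C = cell a := by
  obtain ⟨a, ha, rfl⟩ := h
  have hne : ∀ b ∈ nablaPlus \ ⋃₀ admissibleLines, ∀ i n, n i = 0 → weightForm i n b ≠ 0 :=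
    fun b hb i n hn h => hb.2 ⟨_, zeroLine_mem_admissibleLines hn, hb.1, h⟩
  refine ⟨a, ha.1, hne a ha, connectedComponentIn_eq_cell Set.sdiff_subset ha ?_ ?_⟩
  · rintro b hb
    refine ⟨hb.1, ?_⟩
    rintro ⟨L, hL, hbL⟩
    obtain ⟨i, n, hn, rfl⟩ := mem_admissibleLines_iff.1 hL
    exact hne a ha i n hn ((weightForm_eq_zero_iff_of_mem_cell hb i n).1 hbL.2)
  · exact fun i n hn b hb => iff_of_false (hne b hb i n hn) (hne a ha i n hn)

theorem notMem_nablaVertices_of_mem_cell {a b : WeightSpace} (ha : a ∈ nablaPlus)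
    (hav : a ∉ nablaVertices) (hb : b ∈ cell a) : b ∉ nablaVertices := by
  have hmem : ∀ L ∈ admissibleLines, b ∈ L → a ∈ L := by
    intro L hL hbL
    obtain ⟨i, n, -, rfl⟩ := mem_admissibleLines_iff.1 hL
    exact ⟨ha, (weightForm_eq_zero_iff_of_mem_cell hb i n).1 hbL.2⟩
  rintro ⟨L, hL, L', hL', hne, hbL, hbL'⟩
  exact hav ⟨L, hL, L', hL', hne, hmem L hL hbL, hmem L' hL' hbL'⟩

theorem IsNablaEdge.exists_eq_cell {E : Set WeightSpace} (h : IsNablaEdge E) :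
    ∃ a ∈ nablaPlus, a ∉ nablaVertices ∧ (∃ i n, n i = 0 ∧ weightForm i n a = 0) ∧
      E = cell a := by
  obtain ⟨L, hL, a, ⟨haL, hav⟩, rfl⟩ := h
  obtain ⟨i₀, n₀, hn₀, rfl⟩ := mem_admissibleLines_iff.1 hL
  have mem_iff : ∀ b ∈ zeroLine i₀ n₀ \ nablaVertices, ∀ i n, n i = 0 →
      (weightForm i n b = 0 ↔ zeroLine i n = zeroLine i₀ n₀) := by
    refine fun b hb i n hn => ⟨fun h => ?_, fun h => (h.symm.subset hb.1).2⟩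
    by_contra hne
    exact hb.2 ⟨_, zeroLine_mem_admissibleLines hn, _, hL, hne, ⟨hb.1.1, h⟩, hb.1⟩
  refine ⟨a, haL.1, hav, ⟨i₀, n₀, hn₀, haL.2⟩,
    connectedComponentIn_eq_cell (fun b hb => hb.1.1) ⟨haL, hav⟩ (fun b hb => ?_) ?_⟩
  · exact ⟨⟨hb.1, (weightForm_eq_zero_iff_of_mem_cell hb i₀ n₀).2 haL.2⟩,
      notMem_nablaVertices_of_mem_cell haL.1 hav hb⟩
  · exact fun i n hn b hb => (mem_iff b hb i n hn).trans (mem_iff a ⟨haL, hav⟩ i n hn).symm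

/-- The points at which every weight form that is nonnegative on `S` is nonnegative. -/
def admissibleHull (S : Set WeightSpace) : Set WeightSpace :=
  {b | ∀ i n, (∀ a ∈ S, 0 ≤ weightForm i n a) → 0 ≤ weightForm i n b}

theorem closure_cell_subset_nablaPlus (a : WeightSpace) : closure (cell a) ⊆ nablaPlus :=
  closure_minimal (fun _ h => h.1) isClosed_nablaPlus

theorem closure_cell_subset_admissibleHull (a : WeightSpace) :
    closure (cell a) ⊆ admissibleHull {a} := by
  intro b hb i n h
  refine closure_minimal (fun c hc => ?_)
    (isClosed_le continuous_const (continuous_weightForm i n)) hb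
  rw [Set.mem_ofPred_eq, ← sign_nonneg_iff, hc.2, sign_nonneg_iff]
  exact h a rfl

theorem weightForm_nonpos_of_mem_closure_cell {a b : WeightSpace} (hb : b ∈ closure (cell a))
    {i : Fin 3} {n : Fin 3 → ℕ} (h : weightForm i n a ≤ 0) : weightForm i n b ≤ 0 := by
  refine closure_minimal (fun c hc => ?_)
    (isClosed_le (continuous_weightForm i n) continuous_const) hb
  rw [Set.mem_ofPred_eq, ← sign_nonpos_iff, hc.2, sign_nonpos_iff]
  exact h

/-- The points of the Weyl chamber at which every weight form that does not vanish at `w` has the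
same sign as at `w`; it is the union of the open cells having `w` in their closure. -/
def openStar (w : WeightSpace) : Set WeightSpace :=
  {a | a ∈ nablaPlus ∧ ∀ i n, weightForm i n w ≠ 0 →
    SignType.sign (weightForm i n a) = SignType.sign (weightForm i n w)}

theorem mem_openStar_of_mem_closure_cell {w a : WeightSpace} (ha : a ∈ nablaPlus)
    (hw : w ∈ closure (cell a)) : a ∈ openStar w := by
  refine ⟨ha, fun i n hne => ?_⟩
  rcases hne.lt_or_gt with h | h
  · have hneg : weightForm i n a < 0 := by
      by_contra! hge
      exact (closure_cell_subset_admissibleHull a hw i n (by simpa using hge)).not_gt h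
    rw [sign_neg h, sign_neg hneg]
  · have hpos : 0 < weightForm i n a := by
      by_contra! hle
      exact (weightForm_nonpos_of_mem_closure_cell hw hle).not_gt h
    rw [sign_pos h, sign_pos hpos]

theorem mem_admissibleHull_of_mem_openStar {w a : WeightSpace} (ha : a ∈ openStar w) :
    w ∈ admissibleHull {a} := by
  intro i n h
  by_cases h0 : weightForm i n w = 0
  · exact h0.ge
  · rw [← sign_nonneg_iff, ← ha.2 i n h0, sign_nonneg_iff]
    exact h a rfl

end

/-! ### The fan of cells around `[m, 1, 1]` -/

section

open WeightSpace

theorem weightForm_zero_apply (n : Fin 3 → ℕ) (a : WeightSpace) :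
    weightForm 0 n a = a.coord 0 - (a.coord 0 * n 0 + a.coord 1 * n 1 + n 2) := by
  simp [weightForm, wt, Fin.sum_univ_three]

theorem weightForm_one_apply (n : Fin 3 → ℕ) (a : WeightSpace) :
    weightForm 1 n a = a.coord 1 - (a.coord 0 * n 0 + a.coord 1 * n 1 + n 2) := by
  simp [weightForm, wt, Fin.sum_univ_three]

theorem weightForm_two_apply (n : Fin 3 → ℕ) (a : WeightSpace) :
    weightForm 2 n a = 1 - (a.coord 0 * n 0 + a.coord 1 * n 1 + n 2) := by
  simp [weightForm, wt, Fin.sum_univ_three]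

/-- The wall `α₂ = α₃` of the Weyl chamber passes through `[m, 1, 1]`; this is the affine height
above it. -/
noncomputable def height (a : WeightSpace) : ℝ := a.coord 1 - 1

/-- The forms `α₁ = j α₂ + (m - j) α₃`, written relative to `[m, 1, 1]`. For `0 ≤ j ≤ m` their
zero sets are the admissible lines through `[m, 1, 1]` other than the wall. -/
noncomputable def fanForm (m j : ℕ) (a : WeightSpace) : ℝ := (a.coord 0 - m) - j * height a

theorem height_nonneg {a : WeightSpace} (ha : a ∈ nablaPlus) : 0 ≤ height a :=
  sub_nonneg.2 (mem_nablaPlus_iff.1 ha).2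

theorem weightForm_eq_height (a : WeightSpace) : weightForm 1 ![0, 0, 1] a = height a := by
  simp [weightForm_one_apply, height]

theorem weightForm_eq_fanForm {m j : ℕ} (hj : j ≤ m) (a : WeightSpace) :
    weightForm 0 ![0, j, m - j] a = fanForm m j a := by
  simp only [weightForm_zero_apply, fanForm, height, Matrix.cons_val, Nat.cast_sub hj]
  push_cast
  ring

variable {m : ℕ} (hm : 2 ≤ m)

@[simp]
theorem coord_weightM11_zero : (weightM11 m hm).coord 0 = m := by simp [weightM11, coord_mk]

@[simp]
theorem coord_weightM11_one : (weightM11 m hm).coord 1 = 1 := by simp [weightM11, coord_mk]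

theorem weightM11_mem_nablaPlus : weightM11 m hm ∈ nablaPlus := by
  rw [mem_nablaPlus_iff, coord_weightM11_zero, coord_weightM11_one]
  exact ⟨by exact_mod_cast (by omega : 1 ≤ m), le_rfl⟩

theorem eq_weightM11 {a : WeightSpace} (h₀ : a.coord 0 = m) (h₁ : height a = 0) :
    a = weightM11 m hm :=
  WeightSpace.ext (by simpa using h₀) (by simpa using sub_eq_zero.1 h₁)

theorem weightM11_mem_nablaVertices : weightM11 m hm ∈ nablaVertices := by
  refine ⟨zeroLine 1 ![0, 0, 1], zeroLine_mem_admissibleLines rfl, zeroLine 0 ![0, 0, m],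
    zeroLine_mem_admissibleLines rfl, fun h => ?_, ⟨weightM11_mem_nablaPlus hm, ?_⟩,
    ⟨weightM11_mem_nablaPlus hm, ?_⟩⟩
  · have hx : (ofCoord (m + 1) 1).coord 0 = m + 1 := coord_ofCoord_zero (by positivity) _
    have hy : (ofCoord (m + 1) 1).coord 1 = 1 := coord_ofCoord_one _ one_pos
    have hmem : ofCoord (m + 1) 1 ∈ zeroLine 0 ![0, 0, m] :=
      h ▸ ⟨mem_nablaPlus_iff.2 (by simp [hx, hy]), by simp [weightForm_one_apply, hy]⟩
    simpa [weightForm_zero_apply, hx] using hmem.2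
  · simp [weightForm_one_apply]
  · simp [weightForm_zero_apply]

include hm in
theorem weightForm_eq_of_eq_zero {i : Fin 3} {n : Fin 3 → ℕ}
    (h : weightForm i n (weightM11 m hm) = 0) :
    n = Pi.single i 1 ∨ (∃ j ≤ m, weightForm i n = fanForm m j) ∨
      weightForm i n = height ∨ weightForm i n = -height := by
  have hdeg : m * n 0 + n 1 + n 2 = ![m, 1, 1] i := by
    rify
    fin_cases i <;> simp [weightForm, wt, Fin.sum_univ_three] at h ⊢ <;> linarith
  have hle : n 0 ≤ 1 := by
    by_contra! h2
    have := Nat.mul_le_mul_left m h2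
    fin_cases i <;> simp at hdeg <;> omega
  have hsingle (h' : ∀ j, n j = (Pi.single i 1 : Fin 3 → ℕ) j) : n = Pi.single i 1 := funext h'
  have h0 : n 0 = 0 ∨ n 0 = 1 := by omega
  fin_cases i <;> simp only [Fin.zero_eta, Fin.mk_one, Fin.reduceFinMk, Matrix.cons_val] at *
  · obtain h0 | h0 := h0 <;> rw [h0] at hdeg
    · refine .inr (.inl ⟨n 1, by omega, funext fun a => ?_⟩)
      have : (n 1 + n 2 : ℝ) = m := by exact_mod_cast (by omega : n 1 + n 2 = m)
      rw [weightForm_zero_apply, fanForm, height, ← this, h0]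
      push_cast
      ring
    · refine .inl (hsingle fun j => ?_)
      fin_cases j <;> simp <;> omega
  all_goals
    replace h0 : n 0 = 0 := h0.resolve_right fun h0 => by rw [h0] at hdeg; omega
    rw [h0] at hdeg
    obtain ⟨h1, h2⟩ | ⟨h1, h2⟩ : (n 1 = 1 ∧ n 2 = 0) ∨ (n 1 = 0 ∧ n 2 = 1) := by omega
  · exact .inl (hsingle fun j => by fin_cases j <;> simp [h0, h1, h2])
  · exact .inr (.inr (.inl (funext fun a => by simp [weightForm_one_apply, height, h0, h1, h2])))
  · exact .inr (.inr (.inr (funext fun a => by simp [weightForm_two_apply, height, h0, h1, h2])))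
  · exact .inl (hsingle fun j => by fin_cases j <;> simp [h0, h1, h2])

section openStar

variable {a : WeightSpace} (hxy : (m - 1) * a.coord 1 < a.coord 0) (hx : a.coord 0 < m + 1)
  (hy : 1 ≤ a.coord 1) (hy' : a.coord 1 < 2)

include hm hxy hy in
theorem coord_one_lt_coord_zero_of_bounds : a.coord 1 < a.coord 0 := by
  have : (2 : ℝ) ≤ m := by exact_mod_cast hm
  nlinarith

include hxy hy in
theorem weightForm_pos_of_bounds {i : Fin 3} {n : Fin 3 → ℕ} (hi : n i = 0)
    (h : 0 < weightForm i n (weightM11 m hm)) : 0 < weightForm i n a := by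
  have hdeg : m * n 0 + n 1 + n 2 < ![m, 1, 1] i := by
    rify
    fin_cases i <;> simp [weightForm, wt, Fin.sum_univ_three] at h ⊢ <;> linarith
  fin_cases i <;> simp only [Fin.zero_eta, Fin.mk_one, Fin.reduceFinMk, Matrix.cons_val] at *
  · have : (n 1 + n 2 : ℝ) ≤ m - 1 := by
      rw [le_sub_iff_add_le]
      exact_mod_cast (by rw [hi] at hdeg; omega : n 1 + n 2 + 1 ≤ m)
    have : (n 1 + n 2) * a.coord 1 ≤ (m - 1) * a.coord 1 :=
      mul_le_mul_of_nonneg_right this (by linarith)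
    have : (n 2 : ℝ) ≤ n 2 * a.coord 1 := le_mul_of_one_le_right (Nat.cast_nonneg _) hy
    rw [weightForm_zero_apply, hi]
    push_cast
    linarith
  all_goals
    have h0 : n 0 = 0 := by
      by_contra h0
      have := Nat.le_mul_of_pos_right m (Nat.pos_of_ne_zero h0)
      omega
    have h1 : n 1 = 0 := by omega
    have h2 : n 2 = 0 := by omega
  · simpa [weightForm_one_apply, h0, h1, h2] using a.coord_pos 1
  · simp [weightForm_two_apply, h0, h1, h2]

include hxy hx hy hy' in
theorem weightForm_neg_of_bounds {i : Fin 3} {n : Fin 3 → ℕ} (hi : n i = 0)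
    (h : weightForm i n (weightM11 m hm) < 0) : weightForm i n a < 0 := by
  have hdeg : ![m, 1, 1] i + 1 ≤ m * n 0 + n 1 + n 2 := by
    rw [Nat.add_one_le_iff]
    rify
    fin_cases i <;> simp [weightForm, wt, Fin.sum_univ_three] at h ⊢ <;> linarith
  have hyx := coord_one_lt_coord_zero_of_bounds hm hxy hy
  have h1 : (n 1 : ℝ) ≤ a.coord 1 * n 1 := le_mul_of_one_le_left (Nat.cast_nonneg _) hy
  fin_cases i <;> simp only [Fin.zero_eta, Fin.mk_one, Fin.reduceFinMk, Matrix.cons_val] at *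
  · have : (m + 1 : ℝ) ≤ n 1 + n 2 := by
      exact_mod_cast (by rw [hi] at hdeg; omega : m + 1 ≤ n 1 + n 2)
    rw [weightForm_zero_apply, hi]
    push_cast
    linarith
  all_goals obtain h0 | h0 := Nat.eq_zero_or_pos (n 0)
  · have : (2 : ℝ) ≤ n 2 := by exact_mod_cast (by rw [h0] at hdeg; omega : 2 ≤ n 2)
    rw [weightForm_one_apply, h0, hi]
    push_cast
    linarith
  · have := le_mul_of_one_le_right (a.coord_pos 0).le (Nat.one_le_cast.2 h0)
    rw [weightForm_one_apply]
    linarith [(Nat.cast_nonneg (n 2) : (0 : ℝ) ≤ n 2), (Nat.cast_nonneg (n 1) : (0 : ℝ) ≤ n 1)]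
  · have : (2 : ℝ) ≤ n 1 := by exact_mod_cast (by rw [h0] at hdeg; omega : 2 ≤ n 1)
    rw [weightForm_two_apply, h0, hi]
    push_cast
    linarith
  · have := le_mul_of_one_le_right (a.coord_pos 0).le (Nat.one_le_cast.2 h0)
    rw [weightForm_two_apply]
    linarith [(Nat.cast_nonneg (n 2) : (0 : ℝ) ≤ n 2), (Nat.cast_nonneg (n 1) : (0 : ℝ) ≤ n 1)]

include hxy hx hy hy' in
theorem mem_openStar_of_bounds : a ∈ openStar (weightM11 m hm) := by
  refine ⟨mem_nablaPlus_iff.2 ⟨(coord_one_lt_coord_zero_of_bounds hm hxy hy).le, hy⟩,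
    fun i n hne => ?_⟩
  by_cases hi : n i = 0
  · rcases hne.lt_or_gt with h | h
    · rw [sign_neg h, sign_neg (weightForm_neg_of_bounds hm hxy hx hy hy' hi h)]
    · rw [sign_pos h, sign_pos (weightForm_pos_of_bounds hm hxy hy hi h)]
  · exact sign_weightForm_eq_of_ne_zero hi _ _

end openStar

theorem mem_admissibleHull_of_subset_openStar {S : Set WeightSpace} {b : WeightSpace}
    (hS : S.Nonempty) (hSw : S ⊆ openStar (weightM11 m hm)) (hb : b ∈ openStar (weightM11 m hm))
    (hfan : ∀ j ≤ m, (∀ a ∈ S, 0 ≤ fanForm m j a) → 0 ≤ fanForm m j b)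
    (hheight : (∀ a ∈ S, height a = 0) → height b = 0) : b ∈ admissibleHull S := by
  intro i n h
  by_cases h0 : weightForm i n (weightM11 m hm) = 0
  · obtain rfl | ⟨j, hj, hf⟩ | hf | hf := weightForm_eq_of_eq_zero hm h0
    · simp [weightForm, wt_single]
    · rw [hf] at h ⊢
      exact hfan j hj h
    · rw [hf]
      exact height_nonneg hb.1
    · rw [hf, Pi.neg_apply, neg_nonneg]
      refine (hheight fun a ha => (height_nonneg (hSw ha).1).antisymm' ?_).le
      simpa [hf] using h a ha
  · obtain ⟨a, ha⟩ := hS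
    rw [← sign_nonneg_iff, hb.2 i n h0, ← (hSw ha).2 i n h0, sign_nonneg_iff]
    exact h a ha

theorem mem_cell_of_mem_openStar {a b : WeightSpace} (ha : a ∈ openStar (weightM11 m hm))
    (hb : b ∈ openStar (weightM11 m hm))
    (hfan : ∀ j ≤ m, SignType.sign (fanForm m j b) = SignType.sign (fanForm m j a))
    (hheight : height b = 0 ↔ height a = 0) : b ∈ cell a := by
  have hsign : SignType.sign (height b) = SignType.sign (height a) := by
    obtain h | h := (height_nonneg ha.1).eq_or_lt
    · rw [← h, hheight.2 h.symm]
    · rw [sign_pos h, sign_pos ((height_nonneg hb.1).lt_of_ne fun h' => h.ne' (hheight.1 h'.symm))]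
  refine ⟨hb.1, fun i n => ?_⟩
  by_cases h0 : weightForm i n (weightM11 m hm) = 0
  · obtain rfl | ⟨j, hj, hf⟩ | hf | hf := weightForm_eq_of_eq_zero hm h0
    · simp [weightForm, wt_single]
    · rw [hf, hfan j hj]
    · rw [hf, hsign]
    · rw [hf, Pi.neg_apply, Pi.neg_apply, Left.sign_neg, Left.sign_neg, hsign]
  · rw [hb.2 i n h0, ha.2 i n h0]

theorem sign_fanForm_of_mem_cell {a b : WeightSpace} (h : b ∈ cell a) {j : ℕ} (hj : j ≤ m) :
    SignType.sign (fanForm m j b) = SignType.sign (fanForm m j a) := by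
  rw [← weightForm_eq_fanForm hj, h.2, weightForm_eq_fanForm hj]

theorem height_eq_zero_iff_of_mem_cell {a b : WeightSpace} (h : b ∈ cell a) :
    height b = 0 ↔ height a = 0 := by
  rw [← weightForm_eq_height, weightForm_eq_zero_iff_of_mem_cell h, weightForm_eq_height]

/-- The rays of the fan at `[m, 1, 1]`, parametrised by `-1 ≤ r ≤ m + 1`: the ray has direction
`(r, 1)` in the affine coordinates, except that the two extreme rays lie in the wall. With this
choice the sign of `fanForm m j` along the ray is the sign of `r - j`. -/
noncomputable def fanDir (m : ℕ) (r : ℝ) : ℝ × ℝ := (r, if r = -1 ∨ r = m + 1 then 0 else 1)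

/-- The point at time `t` on the ray `fanDir m r` issuing from `[m, 1, 1]`. -/
noncomputable def fanRay (m : ℕ) (r t : ℝ) : WeightSpace :=
  ofCoord (m + t * (fanDir m r).1) (1 + t * (fanDir m r).2)

section fanRay

variable {r t : ℝ} (hr : r ∈ Set.Icc (-1 : ℝ) (m + 1)) (ht : 0 < t) (ht' : t * (m + 2) ≤ 1)

theorem fanDir_snd_mem : (fanDir m r).2 ∈ Set.Icc (0 : ℝ) 1 := by
  unfold fanDir
  split_ifs <;> simp

include ht in
theorem coord_fanRay_one : (fanRay m r t).coord 1 = 1 + t * (fanDir m r).2 :=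
  coord_ofCoord_one _ (by have := mul_nonneg ht.le (fanDir_snd_mem (m := m) (r := r)).1; linarith)

include hm hr ht ht' in
theorem coord_fanRay_zero : (fanRay m r t).coord 0 = m + t * r := by
  have : (2 : ℝ) ≤ m := by exact_mod_cast hm
  have : -t ≤ t * r := by nlinarith [hr.1]
  exact coord_ofCoord_zero (by simp only [fanDir]; nlinarith) _

include ht in
theorem height_fanRay : height (fanRay m r t) = t * (fanDir m r).2 := by
  rw [height, coord_fanRay_one ht, add_sub_cancel_left]

include hr ht ht' in
theorem fanRay_mem_openStar : fanRay m r t ∈ openStar (weightM11 m hm) := by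
  have : (2 : ℝ) ≤ m := by exact_mod_cast hm
  have hd := fanDir_snd_mem (m := m) (r := r)
  have hmt : 0 < m * t := by positivity
  have h0 : 0 ≤ t * (fanDir m r).2 := mul_nonneg ht.le hd.1
  have h1 : t * (fanDir m r).2 ≤ t := mul_le_of_le_one_right ht.le hd.2
  have hlo : -t ≤ t * r := by nlinarith [hr.1]
  have hhi : t * r ≤ t * (m + 1) := mul_le_mul_of_nonneg_left hr.2 ht.le
  apply mem_openStar_of_bounds hm <;>
    simp only [coord_fanRay_zero hm hr ht ht', coord_fanRay_one ht] <;> nlinarith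

include hm hr ht ht' in
theorem sign_fanForm_fanRay {j : ℕ} (hj : j ≤ m) :
    SignType.sign (fanForm m j (fanRay m r t)) = SignType.sign (r - j) := by
  have hj' : (j : ℝ) ≤ m := by exact_mod_cast hj
  have : (0 : ℝ) ≤ j := j.cast_nonneg
  rw [fanForm, height_fanRay ht, coord_fanRay_zero hm hr ht ht',
    show m + t * r - m - j * (t * (fanDir m r).2) = t * (r - j * (fanDir m r).2) by ring, sign_mul,
    sign_pos ht, one_mul, fanDir]
  split_ifs with h
  · obtain rfl | rfl := h
    · rw [sign_neg, sign_neg] <;> linarith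
    · rw [sign_pos, sign_pos] <;> linarith
  · rw [mul_one]

include ht in
theorem height_fanRay_eq_zero_iff : height (fanRay m r t) = 0 ↔ r = -1 ∨ r = m + 1 := by
  rw [height_fanRay ht, mul_eq_zero, or_iff_right ht.ne', fanDir]
  split_ifs with h <;> simp [h]

include hm hr ht ht' in
theorem fanRay_mem_cell {t' : ℝ} (h : 0 < t') (h' : t' * (m + 2) ≤ 1) :
    fanRay m r t' ∈ cell (fanRay m r t) :=
  mem_cell_of_mem_openStar hm (fanRay_mem_openStar hm hr ht ht') (fanRay_mem_openStar hm hr h h')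
    (fun j hj => by rw [sign_fanForm_fanRay hm hr ht ht' hj, sign_fanForm_fanRay hm hr h h' hj])
    (by rw [height_fanRay_eq_zero_iff ht, height_fanRay_eq_zero_iff h])

end fanRay

/-- The parameter of the `s`-th edge of the fan at `[m, 1, 1]`, for `0 ≤ s ≤ m + 2`. -/
noncomputable def edgeParam (s : ℕ) : ℝ := s - 1

/-- A point on the `s`-th edge of the fan at `[m, 1, 1]`, for `0 ≤ s ≤ m + 2`. -/
noncomputable def edgePt (m s : ℕ) : WeightSpace := fanRay m (edgeParam s) (1 / (m + 2))

/-- A point in the face of the fan at `[m, 1, 1]` between the edges `s` and `s + 1`, for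
`0 ≤ s ≤ m + 1`. -/
noncomputable def facePt (m s : ℕ) : WeightSpace := fanRay m (s - 1 / 2) (1 / (m + 2))

theorem edgeParam_mem_Icc {s : ℕ} (hs : s ≤ m + 2) :
    edgeParam s ∈ Set.Icc (-1 : ℝ) (m + 1) := by
  have : (s : ℝ) ≤ m + 2 := by exact_mod_cast hs
  constructor <;> unfold edgeParam <;> linarith [(s.cast_nonneg : (0 : ℝ) ≤ s)]

theorem faceParam_mem_Icc {s : ℕ} (hs : s ≤ m + 1) :
    (s - 1 / 2 : ℝ) ∈ Set.Icc (-1 : ℝ) (m + 1) := by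
  have : (s : ℝ) ≤ m + 1 := by exact_mod_cast hs
  constructor <;> linarith [(s.cast_nonneg : (0 : ℝ) ≤ s)]

theorem baseTime_pos : (0 : ℝ) < 1 / (m + 2) := by positivity

theorem baseTime_mul_le : (1 / (m + 2) : ℝ) * (m + 2) ≤ 1 := by
  rw [one_div_mul_cancel (by positivity)]

theorem height_edgePt_eq_zero_iff {s : ℕ} : height (edgePt m s) = 0 ↔ s = 0 ∨ s = m + 2 := by
  rw [edgePt, height_fanRay_eq_zero_iff baseTime_pos, edgeParam, sub_eq_neg_self, Nat.cast_eq_zero,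
    sub_eq_iff_eq_add, add_assoc, one_add_one_eq_two]
  norm_cast

theorem height_facePt_ne_zero {s : ℕ} : height (facePt m s) ≠ 0 := by
  rw [facePt, Ne, height_fanRay_eq_zero_iff baseTime_pos]
  rintro (h | h)
  · linarith [(s.cast_nonneg : (0 : ℝ) ≤ s)]
  · have : ((2 * s : ℕ) : ℝ) = (2 * m + 3 : ℕ) := by
      push_cast
      linarith
    have := Nat.cast_injective this
    omega

theorem edgePt_mem_openStar {s : ℕ} (hs : s ≤ m + 2) :
    edgePt m s ∈ openStar (weightM11 m hm) :=
  fanRay_mem_openStar hm (edgeParam_mem_Icc hs) baseTime_pos baseTime_mul_le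

theorem facePt_mem_openStar {s : ℕ} (hs : s ≤ m + 1) :
    facePt m s ∈ openStar (weightM11 m hm) :=
  fanRay_mem_openStar hm (faceParam_mem_Icc hs) baseTime_pos baseTime_mul_le

include hm

theorem edgePt_mem_nablaPlus {s : ℕ} (hs : s ≤ m + 2) : edgePt m s ∈ nablaPlus :=
  (edgePt_mem_openStar hm hs).1

theorem facePt_mem_nablaPlus {s : ℕ} (hs : s ≤ m + 1) : facePt m s ∈ nablaPlus :=
  (facePt_mem_openStar hm hs).1

theorem sign_fanForm_edgePt {s j : ℕ} (hs : s ≤ m + 2) (hj : j ≤ m) :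
    SignType.sign (fanForm m j (edgePt m s)) = SignType.sign (s - 1 - j : ℝ) :=
  sign_fanForm_fanRay hm (edgeParam_mem_Icc hs) baseTime_pos baseTime_mul_le hj

theorem sign_fanForm_facePt {s j : ℕ} (hs : s ≤ m + 1) (hj : j ≤ m) :
    SignType.sign (fanForm m j (facePt m s)) = if j < s then 1 else -1 := by
  rw [facePt, sign_fanForm_fanRay hm (faceParam_mem_Icc hs) baseTime_pos baseTime_mul_le hj]
  split_ifs with h
  · have : (j + 1 : ℝ) ≤ s := by exact_mod_cast h
    exact sign_pos (by linarith)
  · have : (s : ℝ) ≤ j := by exact_mod_cast not_lt.1 h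
    exact sign_neg (by linarith)

theorem fanForm_edgePt_nonneg_iff {s j : ℕ} (hs : s ≤ m + 2) (hj : j ≤ m) :
    0 ≤ fanForm m j (edgePt m s) ↔ j < s := by
  rw [← sign_nonneg_iff, sign_fanForm_edgePt hm hs hj, sign_nonneg_iff, ← Nat.add_one_le_iff,
    ← Nat.cast_le (α := ℝ), Nat.cast_add_one]
  constructor <;> intro <;> linarith

theorem fanForm_edgePt_nonpos_iff {s j : ℕ} (hs : s ≤ m + 2) (hj : j ≤ m) :
    fanForm m j (edgePt m s) ≤ 0 ↔ s ≤ j + 1 := by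
  rw [← sign_nonpos_iff, sign_fanForm_edgePt hm hs hj, sign_nonpos_iff,
    ← Nat.cast_le (α := ℝ), Nat.cast_add_one]
  constructor <;> intro <;> linarith

theorem fanForm_facePt_nonneg_iff {s j : ℕ} (hs : s ≤ m + 1) (hj : j ≤ m) :
    0 ≤ fanForm m j (facePt m s) ↔ j < s := by
  rw [← sign_nonneg_iff, sign_fanForm_facePt hm hs hj]
  split_ifs with h <;> simp [h]

theorem edgePt_mem_cell_edgePt_iff {s t : ℕ} (hs : s ≤ m + 2) (ht : t ≤ m + 2) :
    edgePt m s ∈ cell (edgePt m t) ↔ s = t := by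
  refine ⟨fun h => ?_, fun h => h ▸ mem_cell_self (edgePt_mem_nablaPlus hm hs)⟩
  have hfan (j : ℕ) (hj : j ≤ m) : j < s ↔ j < t := by
    rw [← fanForm_edgePt_nonneg_iff hm hs hj, ← fanForm_edgePt_nonneg_iff hm ht hj,
      ← sign_nonneg_iff, sign_fanForm_of_mem_cell h hj, sign_nonneg_iff]
  have hheight := height_eq_zero_iff_of_mem_cell h
  rw [height_edgePt_eq_zero_iff, height_edgePt_eq_zero_iff] at hheight
  by_contra hne
  have := hfan s
  have := hfan t
  omega

theorem facePt_mem_cell_facePt_iff {s t : ℕ} (hs : s ≤ m + 1) (ht : t ≤ m + 1) :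
    facePt m s ∈ cell (facePt m t) ↔ s = t := by
  refine ⟨fun h => ?_, fun h => h ▸ mem_cell_self (facePt_mem_nablaPlus hm hs)⟩
  have hfan (j : ℕ) (hj : j ≤ m) : j < s ↔ j < t := by
    rw [← fanForm_facePt_nonneg_iff hm hs hj, ← fanForm_facePt_nonneg_iff hm ht hj,
      ← sign_nonneg_iff, sign_fanForm_of_mem_cell h hj, sign_nonneg_iff]
  by_contra hne
  have := hfan s
  have := hfan t
  omega

theorem facePt_mem_admissibleHull_edgePt {s : ℕ} (h1 : 1 ≤ s) (hs : s ≤ m + 1) :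
    facePt m s ∈ admissibleHull {edgePt m s} := by
  refine mem_admissibleHull_of_subset_openStar hm ⟨_, rfl⟩
    (Set.singleton_subset_iff.2 (edgePt_mem_openStar hm (by omega))) (facePt_mem_openStar hm hs)
    (fun j hj h => ?_) fun h => ?_
  · exact (fanForm_facePt_nonneg_iff hm hs hj).2
      ((fanForm_edgePt_nonneg_iff hm (by omega) hj).1 (h _ rfl))
  · have := height_edgePt_eq_zero_iff.1 (h _ rfl)
    omega

theorem edgePt_mem_admissibleHull_facePt {s t : ℕ} (hs : s ≤ m + 1) (ht : t ∈ Set.Icc s (s + 1)) :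
    edgePt m t ∈ admissibleHull {facePt m s} := by
  have hts := ht.2
  refine mem_admissibleHull_of_subset_openStar hm ⟨_, rfl⟩
    (Set.singleton_subset_iff.2 (facePt_mem_openStar hm hs)) (edgePt_mem_openStar hm (by omega))
    (fun j hj h => ?_) fun h => absurd (h _ rfl) height_facePt_ne_zero
  exact (fanForm_edgePt_nonneg_iff hm (by omega) hj).2
    (((fanForm_facePt_nonneg_iff hm hs hj).1 (h _ rfl)).trans_le ht.1)

theorem facePt_zero_mem_admissibleHull :
    facePt m 0 ∈ admissibleHull {edgePt m 0, edgePt m (m + 1)} := by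
  refine mem_admissibleHull_of_subset_openStar hm ⟨_, .inl rfl⟩
    (Set.pair_subset (edgePt_mem_openStar hm (by omega)) (edgePt_mem_openStar hm (by omega)))
    (facePt_mem_openStar hm (by omega)) (fun j hj h => ?_) fun h => ?_
  · exact absurd ((fanForm_edgePt_nonneg_iff hm (by omega) hj).1 (h _ (.inl rfl))) (by omega)
  · have := height_edgePt_eq_zero_iff.1 (h _ (.inr rfl))
    omega

theorem eq_or_eq_succ_of_cell_edgePt_subset {s t : ℕ} (ht : t ≤ m + 2) (hs : s ≤ m + 1)
    (h : cell (edgePt m t) ⊆ closure (cell (facePt m s))) : t = s ∨ t = s + 1 := by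
  have hmem := h (mem_cell_self (edgePt_mem_nablaPlus hm ht))
  have hlo (j : ℕ) (hj : j ≤ m) (hjs : j < s) : j < t := by
    rw [← fanForm_edgePt_nonneg_iff hm ht hj, ← weightForm_eq_fanForm hj]
    refine closure_cell_subset_admissibleHull _ hmem 0 _ ?_
    simpa [weightForm_eq_fanForm hj, fanForm_facePt_nonneg_iff hm hs hj]
  have hhi (hsm : s ≤ m) : t ≤ s + 1 := by
    rw [← fanForm_edgePt_nonpos_iff hm ht hsm, ← weightForm_eq_fanForm hsm]
    refine weightForm_nonpos_of_mem_closure_cell hmem ?_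
    rw [weightForm_eq_fanForm hsm, ← sign_nonpos_iff, sign_fanForm_facePt hm hs hsm]
    simp
  have := hlo (s - 1)
  omega

theorem IsNablaFace.exists_eq_cell_facePt {C : Set WeightSpace} (hC : IsNablaFace C)
    (hw : weightM11 m hm ∈ closure C) : ∃ s ≤ m + 1, C = cell (facePt m s) := by
  obtain ⟨a, ha, hne, rfl⟩ := hC.exists_eq_cell
  have hstar := mem_openStar_of_mem_closure_cell ha hw
  have hpos : 0 < height a :=
    (height_nonneg ha).lt_of_ne' (weightForm_eq_height a ▸ hne 1 ![0, 0, 1] rfl)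
  set ρ : ℝ := (a.coord 0 - m) / height a
  have hs : min ⌈ρ⌉₊ (m + 1) ≤ m + 1 := min_le_right _ _
  refine ⟨min ⌈ρ⌉₊ (m + 1), hs, (cell_eq_of_mem (mem_cell_of_mem_openStar hm hstar
    (facePt_mem_openStar hm hs) (fun j hj => ?_)
    (iff_of_false height_facePt_ne_zero hpos.ne'))).symm⟩
  have hlt : j < min ⌈ρ⌉₊ (m + 1) ↔ 0 < fanForm m j a := by
    rw [lt_min_iff, Nat.lt_ceil, lt_div_iff₀ hpos, fanForm, sub_pos]
    exact and_iff_left (by omega)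
  rw [sign_fanForm_facePt hm hs hj]
  split_ifs with h
  · exact (sign_pos (hlt.1 h)).symm
  · refine (sign_neg ((not_lt.1 (h ∘ hlt.2)).lt_of_ne ?_)).symm
    exact weightForm_eq_fanForm hj a ▸ hne 0 ![0, j, m - j] rfl

theorem exists_mem_cell_edgePt_of_height_eq_zero {a : WeightSpace}
    (ha : a ∈ openStar (weightM11 m hm)) (hne : a ≠ weightM11 m hm) (h : height a = 0) :
    ∃ s ≤ m + 2, edgePt m s ∈ cell a := by
  have hfan (j : ℕ) : fanForm m j a = a.coord 0 - m := by rw [fanForm, h, mul_zero, sub_zero]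
  rcases lt_trichotomy (a.coord 0) m with hx | hx | hx
  · refine ⟨0, by omega, mem_cell_of_mem_openStar hm ha (edgePt_mem_openStar hm (by omega))
      (fun j hj => ?_) (by simp [height_edgePt_eq_zero_iff, h])⟩
    rw [sign_fanForm_edgePt hm (by omega) hj, hfan, sign_neg (sub_neg.2 hx), sign_neg]
    push_cast
    linarith [(j.cast_nonneg : (0 : ℝ) ≤ j)]
  · exact absurd (eq_weightM11 hm hx h) hne
  · refine ⟨m + 2, le_rfl, mem_cell_of_mem_openStar hm ha (edgePt_mem_openStar hm le_rfl)
      (fun j hj => ?_) (by simp [height_edgePt_eq_zero_iff, h])⟩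
    have : (j : ℝ) ≤ m := by exact_mod_cast hj
    rw [sign_fanForm_edgePt hm le_rfl hj, hfan, sign_pos (sub_pos.2 hx), sign_pos]
    push_cast
    linarith

theorem edgePt_mem_cell_of_fanForm_eq_zero {a : WeightSpace} (ha : a ∈ openStar (weightM11 m hm))
    (hpos : 0 < height a) {i : ℕ} (hi : i ≤ m) (h : fanForm m i a = 0) :
    edgePt m (i + 1) ∈ cell a := by
  refine mem_cell_of_mem_openStar hm ha (edgePt_mem_openStar hm (by omega)) (fun j hj => ?_)
    (iff_of_false (by rw [height_edgePt_eq_zero_iff]; omega) hpos.ne')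
  have hfan : fanForm m j a = (i - j) * height a := by
    rw [fanForm] at h ⊢
    linarith
  rw [sign_fanForm_edgePt hm (by omega) hj, hfan, sign_mul, sign_pos hpos, mul_one,
    Nat.cast_add_one, add_sub_cancel_right]

theorem IsNablaEdge.exists_eq_cell_edgePt {E : Set WeightSpace} (hE : IsNablaEdge E)
    (hw : weightM11 m hm ∈ closure E) : ∃ s ≤ m + 2, E = cell (edgePt m s) := by
  obtain ⟨a, ha, hav, ⟨i, n, hn, h0⟩, rfl⟩ := hE.exists_eq_cell
  have hstar := mem_openStar_of_mem_closure_cell ha hw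
  have hne : a ≠ weightM11 m hm := fun h => hav (h ▸ weightM11_mem_nablaVertices hm)
  suffices ∃ s ≤ m + 2, edgePt m s ∈ cell a from
    let ⟨s, hs, h⟩ := this; ⟨s, hs, (cell_eq_of_mem h).symm⟩
  obtain hh | hpos := (height_nonneg ha).eq_or_lt'
  · exact exists_mem_cell_edgePt_of_height_eq_zero hm hstar hne hh
  have hw0 : weightForm i n (weightM11 m hm) = 0 := by
    by_contra hw0
    rw [← sign_eq_zero_iff, hstar.2 i n hw0, sign_eq_zero_iff] at h0
    exact hw0 h0
  obtain rfl | ⟨j, hj, hf⟩ | hf | hf := weightForm_eq_of_eq_zero hm hw0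
  · simp at hn
  · exact ⟨j + 1, by omega, edgePt_mem_cell_of_fanForm_eq_zero hm hstar hpos hj (hf ▸ h0)⟩
  · exact absurd (hf ▸ h0) hpos.ne'
  · rw [hf] at h0
    exact absurd (neg_eq_zero.1 h0) hpos.ne'

end

/-! ### Weight filtrations and the stabilizers of the points of `𝐗` -/

section

open MvPolynomial WeightSpace

theorem wt_add (α : Fin 3 → ℝ) (n n' : Fin 3 → ℕ) : wt α (n + n') = wt α n + wt α n' := by
  simp only [wt, ← Finset.sum_add_distrib, Pi.add_apply, Nat.cast_add, mul_add]

theorem wt_smul (c : ℝ) (α : Fin 3 → ℝ) (n : Fin 3 → ℕ) : wt (c • α) n = c * wt α n := by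
  simp only [wt, Pi.smul_apply, smul_eq_mul, Finset.mul_sum, mul_assoc]

theorem mul_le_wt {α : Fin 3 → ℝ} (hα : ∀ i, 0 < α i) (n : Fin 3 → ℕ) (i : Fin 3) :
    α i * n i ≤ wt α n :=
  Finset.single_le_sum (f := fun i => α i * (n i : ℝ))
    (fun j _ => mul_nonneg (hα j).le (n j).cast_nonneg) (Finset.mem_univ i)

theorem finite_setOf_wt_le {α : Fin 3 → ℝ} (hα : ∀ i, 0 < α i) (t : ℝ) :
    {n : Fin 3 →₀ ℕ | wt α n ≤ t}.Finite := by
  refine (Set.finite_Iic (Finsupp.equivFunOnFinite.symm fun i => ⌊t / α i⌋₊)).subset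
    fun n hn i => ?_
  refine Nat.le_floor (α := ℝ) ?_
  rw [le_div_iff₀' (hα i)]
  exact (mul_le_wt hα n i).trans hn

variable (k : Type*) [Field k]

/-- The polynomials all of whose monomials have weight at most `t`: the filtration of the
polynomial ring by the sublevel sets of `-ν_{id,α}`. -/
noncomputable def weightLE (α : Fin 3 → ℝ) (t : ℝ) : Submodule k (Poly k) :=
  restrictSupport k {n | wt α n ≤ t}

variable {k} {α : Fin 3 → ℝ} {s t : ℝ}

theorem mem_weightLE {P : Poly k} : P ∈ weightLE k α t ↔ ∀ n ∈ P.support, wt α n ≤ t := Iff.rfl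

theorem mem_weightLE_iff_le_nuId (α : PosTriple) (t : ℝ) (P : Poly k) :
    P ∈ weightLE k α.1 t ↔ ((-t : ℝ) : WithTop ℝ) ≤ nuId α P := by
  simp only [mem_weightLE, nuId, Finset.le_inf_iff, WithTop.coe_le_coe, neg_le_neg_iff, wt]

theorem weightLE_mono (h : s ≤ t) : weightLE k α s ≤ weightLE k α t :=
  fun _ hP _ hn => (hP hn).trans h

theorem weightLE_smul {c : ℝ} (hc : 0 < c) (t : ℝ) :
    weightLE k (c • α) (c * t) = weightLE k α t := by
  ext P
  simp only [mem_weightLE, wt_smul, mul_le_mul_iff_right₀ hc]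

theorem mul_mem_weightLE {P Q : Poly k} (hP : P ∈ weightLE k α s) (hQ : Q ∈ weightLE k α t) :
    P * Q ∈ weightLE k α (s + t) := by
  classical
  intro n hn
  obtain ⟨a, ha, b, hb, rfl⟩ := Finset.mem_add.1 (support_mul P Q hn)
  rw [Set.mem_ofPred_eq, Finsupp.coe_add, wt_add]
  exact add_le_add (hP ha) (hQ hb)

theorem monomial_mem_weightLE {n : Fin 3 →₀ ℕ} (h : wt α n ≤ t) (c : k) :
    monomial n c ∈ weightLE k α t :=
  (monomial_mem_restrictSupport _).2 (.inl h)

theorem C_mem_weightLE (α : Fin 3 → ℝ) (c : k) : C c ∈ weightLE k α 0 :=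
  monomial_mem_weightLE (by simp [wt]) c

theorem X_mem_weightLE_iff (i : Fin 3) :
    (MvPolynomial.X i : Poly k) ∈ weightLE k α t ↔ α i ≤ t := by
  simp [mem_weightLE, support_X, Finsupp.single_eq_pi_single, wt_single]

theorem pow_mem_weightLE {P : Poly k} (hP : P ∈ weightLE k α s) (n : ℕ) :
    P ^ n ∈ weightLE k α (s * n) := by
  induction n with
  | zero => simpa using C_mem_weightLE α (1 : k)
  | succ n ih =>
    rw [pow_succ, Nat.cast_succ, mul_add, mul_one]
    exact mul_mem_weightLE ih hP

theorem algEquiv_monomial (u : Poly k ≃ₐ[k] Poly k) (n : Fin 3 →₀ ℕ) (c : k) :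
    u (monomial n c) = C c * ∏ i, u (MvPolynomial.X i) ^ n i := by
  rw [monomial_eq, map_mul, Finsupp.prod_fintype _ _ fun i => pow_zero _, map_prod]
  simp only [map_pow]
  exact congrArg (· * _) (u.commutes c)

theorem map_mem_weightLE {u : Poly k ≃ₐ[k] Poly k}
    (hu : ∀ i, u (MvPolynomial.X i) ∈ weightLE k α (α i)) {P : Poly k}
    (hP : P ∈ weightLE k α t) : u P ∈ weightLE k α t := by
  rw [P.as_sum, map_sum]
  refine Submodule.sum_mem _ fun n hn => weightLE_mono (hP hn) ?_
  rw [algEquiv_monomial, Fin.prod_univ_three]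
  have := mul_mem_weightLE (C_mem_weightLE α (coeff n P)) <| mul_mem_weightLE
    (mul_mem_weightLE (pow_mem_weightLE (hu 0) (n 0)) (pow_mem_weightLE (hu 1) (n 1)))
    (pow_mem_weightLE (hu 2) (n 2))
  rwa [zero_add, ← Fin.sum_univ_three (f := fun i => α i * (n i : ℝ))] at this

theorem finiteDimensional_weightLE (hα : ∀ i, 0 < α i) (t : ℝ) :
    FiniteDimensional k (weightLE k α t) := by
  have := (finite_setOf_wt_le hα t).to_subtype
  exact Module.Finite.of_basis (basisRestrictSupport k {n : Fin 3 →₀ ℕ | wt α n ≤ t})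

/-- An injective endomorphism of a finite-dimensional space is surjective, so `u⁻¹` preserves the
filtration as well. -/
theorem map_mem_weightLE_iff (hα : ∀ i, 0 < α i) {u : Poly k ≃ₐ[k] Poly k}
    (hu : ∀ i, u (MvPolynomial.X i) ∈ weightLE k α (α i)) {P : Poly k} :
    u P ∈ weightLE k α t ↔ P ∈ weightLE k α t := by
  refine ⟨fun h => ?_, map_mem_weightLE hu⟩
  have := finiteDimensional_weightLE (k := k) hα t
  let φ : weightLE k α t →ₗ[k] weightLE k α t :=
    u.toLinearMap.restrict fun P hP => map_mem_weightLE hu hP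
  have hφ : Function.Injective φ := fun P Q hPQ =>
    Subtype.ext (u.injective (congrArg Subtype.val hPQ))
  obtain ⟨Q, hQ⟩ := LinearMap.injective_iff_surjective.1 hφ ⟨u P, h⟩
  have hPQ : Q.1 = P := u.injective (congrArg Subtype.val hQ)
  exact hPQ ▸ Q.2

theorem weightLE_lt_weightLE {β : Fin 3 → ℝ} (hβ : ∀ i, 0 < β i) {i : Fin 3}
    (heq : ∀ j, i < j → α j = β j) (hlt : α i < β i) (hle : ∀ j < i, β i ≤ β j) :
    weightLE k β (α i) < weightLE k α (α i) := by
  refine lt_of_le_of_ne (fun P hP n hn => ?_) fun h => ?_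
  · have hn' : wt β n ≤ α i := hP hn
    have n_eq_zero (j : Fin 3) (hj : j ≤ i) : n j = 0 := by
      by_contra h0
      have hβj : β i ≤ β j := hj.eq_or_lt.elim (fun h => h ▸ le_rfl) (hle j)
      have : β j * 1 ≤ β j * n j :=
        mul_le_mul_of_nonneg_left (mod_cast Nat.one_le_iff_ne_zero.2 h0) (hβ j).le
      linarith [mul_le_wt hβ n j]
    have hwt : wt α n = wt β n := Finset.sum_congr rfl fun j _ => by
      rcases lt_or_ge i j with hj | hj
      · rw [heq j hj]
      · simp [n_eq_zero j hj]
    exact hwt.trans_le hn'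
  · have hX := (X_mem_weightLE_iff (k := k) (α := α) i).2 le_rfl
    rw [← h, X_mem_weightLE_iff] at hX
    exact hlt.not_ge hX

theorem eq_of_finrank_weightLE_eq {β : Fin 3 → ℝ} (hα : ∀ i, 0 < α i) (hβ : ∀ i, 0 < β i)
    (hα' : Antitone α) (hβ' : Antitone β)
    (h : ∀ t, Module.finrank k (weightLE k α t) = Module.finrank k (weightLE k β t)) : α = β := by
  have eq_at : ∀ i : Fin 3, (∀ j, i < j → α j = β j) → α i = β i := by
    intro i hi
    rcases lt_trichotomy (α i) (β i) with hlt | heq | hlt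
    · have := finiteDimensional_weightLE (k := k) hα (α i)
      exact absurd (h (α i)) (Submodule.finrank_lt_finrank_of_lt
        (weightLE_lt_weightLE hβ hi hlt fun j hj => hβ' hj.le)).ne'
    · exact heq
    · have := finiteDimensional_weightLE (k := k) hβ (β i)
      exact absurd (h (β i)) (Submodule.finrank_lt_finrank_of_lt
        (weightLE_lt_weightLE hα (fun j hj => (hi j hj).symm) hlt fun j hj => hα' hj.le)).ne
  funext i
  induction i using WellFoundedGT.induction with
  | ind i ih => exact eq_at i ih

theorem antitone_coord {a : WeightSpace} (ha : a ∈ nablaPlus) : Antitone a.coord := by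
  rw [mem_nablaPlus_iff] at ha
  refine Fin.antitone_iff_succ_le.2 fun i => ?_
  fin_cases i
  · exact ha.1
  · simpa using ha.2

theorem pt_eq_pt_iff_exists (f g : Tame k) (a b : WeightSpace) :
    pt f a = pt g b ↔ ∃ c : ℝ, 0 < c ∧ ∀ P, nuId ⟨b.coord, b.coord_pos⟩ (g.1 P) =
      (nuId ⟨a.coord, a.coord_pos⟩ (f.1 P)).map (c * ·) := by
  conv_lhs => rw [← mk_coord a, ← mk_coord b]
  exact Subtype.ext_iff.trans (Quotient.eq (r := valSetoid k))

theorem neg_coe_le_map_iff {c : ℝ} (hc : 0 < c) (t : ℝ) (x : WithTop ℝ) :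
    ((-(c * t) : ℝ) : WithTop ℝ) ≤ x.map (c * ·) ↔ ((-t : ℝ) : WithTop ℝ) ≤ x := by
  cases x with
  | top => simp
  | coe x =>
    rw [WithTop.map_coe, WithTop.coe_le_coe, WithTop.coe_le_coe, ← mul_neg,
      mul_le_mul_iff_right₀ hc]

theorem exists_mem_weightLE_iff_of_pt_eq_pt {f g : Tame k} {a b : WeightSpace}
    (h : pt f a = pt g b) : ∃ c : ℝ, 0 < c ∧ ∀ P t,
      f.1 P ∈ weightLE k a.coord t ↔ g.1 P ∈ weightLE k b.coord (c * t) := by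
  obtain ⟨c, hc, h⟩ := (pt_eq_pt_iff_exists f g a b).1 h
  refine ⟨c, hc, fun P t => ?_⟩
  rw [mem_weightLE_iff_le_nuId ⟨a.coord, a.coord_pos⟩,
    mem_weightLE_iff_le_nuId ⟨b.coord, b.coord_pos⟩, h, neg_coe_le_map_iff hc]

theorem finrank_weightLE_eq_of_forall_mem_iff {β : Fin 3 → ℝ} {f g : Poly k ≃ₐ[k] Poly k}
    (h : ∀ P, f P ∈ weightLE k α s ↔ g P ∈ weightLE k β t) :
    Module.finrank k (weightLE k α s) = Module.finrank k (weightLE k β t) := by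
  have hmap : (weightLE k α s).map ((f.symm.trans g).toLinearEquiv : Poly k →ₗ[k] Poly k) =
      weightLE k β t := by
    ext Q
    constructor
    · rintro ⟨P, hP, rfl⟩
      exact (h (f.symm P)).1 (by simpa using hP)
    · exact fun hQ => ⟨f (g.symm Q), (h _).2 (by simpa using hQ), by simp⟩
  rw [← hmap]
  exact ((f.symm.trans g).toLinearEquiv.submoduleMap (weightLE k α s)).finrank_eq

/-- The dimensions of the filtration do not depend on `f`, and they determine the weight up to
permutation. -/
theorem eq_and_mem_weightLE_iff_of_pt_eq_pt {f g : Tame k} {a b : WeightSpace}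
    (ha : a ∈ nablaPlus) (hb : b ∈ nablaPlus) (h : pt f a = pt g b) :
    a = b ∧ ∀ P t, f.1 P ∈ weightLE k a.coord t ↔ g.1 P ∈ weightLE k a.coord t := by
  obtain ⟨c, hc, h⟩ := exists_mem_weightLE_iff_of_pt_eq_pt h
  have hcoord : c • a.coord = b.coord := by
    refine eq_of_finrank_weightLE_eq (k := k) (fun i => mul_pos hc (a.coord_pos i)) b.coord_pos
      ((antitone_coord ha).const_smul hc.le) (antitone_coord hb) fun t => ?_
    obtain ⟨s, rfl⟩ : ∃ s, t = c * s := ⟨c⁻¹ * t, (mul_inv_cancel_left₀ hc.ne' t).symm⟩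
    rw [weightLE_smul hc]
    exact finrank_weightLE_eq_of_forall_mem_iff (f := f.1) (g := g.1) fun P => h P s
  obtain rfl : c = 1 := by simpa using congrFun hcoord 2
  obtain rfl : a = b := by
    ext
    · simpa using congrFun hcoord 0
    · simpa using congrFun hcoord 1
  exact ⟨rfl, fun P t => by simpa using h P t⟩

theorem eq_of_pt_eq_pt {f g : Tame k} {a b : WeightSpace} (ha : a ∈ nablaPlus)
    (hb : b ∈ nablaPlus) (h : pt f a = pt g b) : a = b :=
  (eq_and_mem_weightLE_iff_of_pt_eq_pt ha hb h).1

/-- The stabilizer condition: `u` preserves the weight filtration at `a`. -/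
def Fixes (u : Tame k) (a : WeightSpace) : Prop :=
  ∀ i, u.1 (MvPolynomial.X i) ∈ weightLE k a.coord (a.coord i)

theorem Fixes.mul {u v : Tame k} {a : WeightSpace} (hu : Fixes u a) (hv : Fixes v a) :
    Fixes (u * v) a := fun i => map_mem_weightLE hu (hv i)

theorem pt_eq_pt_of_forall_mem_iff {f g : Tame k} {a : WeightSpace}
    (h : ∀ P t, f.1 P ∈ weightLE k a.coord t ↔ g.1 P ∈ weightLE k a.coord t) :
    pt f a = pt g a := by
  refine (pt_eq_pt_iff_exists f g a a).2 ⟨1, one_pos, fun P => ?_⟩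
  have hid : ((1 : ℝ) * ·) = (id : ℝ → ℝ) := funext one_mul
  rw [hid, WithTop.map_id, id]
  refine WithTop.eq_of_forall_coe_le_iff fun t => ?_
  simpa only [mem_weightLE_iff_le_nuId ⟨a.coord, a.coord_pos⟩, neg_neg] using (h P (-t)).symm

theorem pt_eq_pt_iff {f g : Tame k} {a : WeightSpace} (ha : a ∈ nablaPlus) :
    pt f a = pt g a ↔ Fixes (g * f⁻¹) a := by
  constructor
  · intro h i
    refine ((eq_and_mem_weightLE_iff_of_pt_eq_pt ha ha h).2 (f.1⁻¹ (MvPolynomial.X i)) _).1 ?_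
    rw [← AlgEquiv.mul_apply, mul_inv_cancel, AlgEquiv.one_apply]
    exact (X_mem_weightLE_iff i).2 le_rfl
  · refine fun h => pt_eq_pt_of_forall_mem_iff fun P t => ?_
    simpa using (map_mem_weightLE_iff (t := t) (P := f.1 P) a.coord_pos h).symm

theorem Fixes.of_mem_admissibleHull {u : Tame k} {S : Set WeightSpace} {b : WeightSpace}
    (hu : ∀ a ∈ S, Fixes u a) (hb : b ∈ admissibleHull S) : Fixes u b :=
  fun i n hn => sub_nonneg.1 (hb i n fun a ha => sub_nonneg.2 (hu a ha i hn))

theorem pt_eq_pt_of_mem_admissibleHull {f g : Tame k} {a b : WeightSpace} (ha : a ∈ nablaPlus)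
    (hb : b ∈ nablaPlus) (hab : b ∈ admissibleHull {a}) (h : pt f a = pt g a) :
    pt f b = pt g b := by
  refine (pt_eq_pt_iff hb).2 (Fixes.of_mem_admissibleHull ?_ hab)
  rintro _ rfl
  exact (pt_eq_pt_iff ha).1 h

theorem image_cell_eq_iff {f g : Tame k} {a b : WeightSpace} (ha : a ∈ nablaPlus) :
    pt f '' cell a = pt g '' cell b ↔ a ∈ cell b ∧ pt f a = pt g a := by
  constructor
  · intro h
    obtain ⟨c, hc, hca⟩ := h.subset ⟨a, mem_cell_self ha, rfl⟩
    obtain rfl := eq_of_pt_eq_pt hc.1 ha hca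
    exact ⟨hc, hca.symm⟩
  · rintro ⟨hab, h⟩
    rw [← cell_eq_of_mem hab]
    exact Set.image_congr fun c hc => pt_eq_pt_of_mem_admissibleHull ha hc.1
      (closure_cell_subset_admissibleHull a (subset_closure hc)) h

end

/-! ### Distances and angles in `𝐗` -/

section

open WeightSpace InnerProductGeometry

section

variable {k : Type*} [Field k]

theorem ChainOfLength.dist_le {x y : X k} {l : ℝ} (h : ChainOfLength x y l) :
    ∀ {f g : Tame k} {a b : WeightSpace}, a ∈ nablaPlus → b ∈ nablaPlus →
      x = pt f a → y = pt g b → dist a b ≤ l := by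
  induction h with
  | single f a b ha hb =>
    intro f' g' a' b' ha' hb' hx hy
    rw [eq_of_pt_eq_pt ha ha' hx, eq_of_pt_eq_pt hb hb' hy]
  | cons f a b ha hb y l _ ih =>
    intro f' g' a' b' ha' hb' hx hy
    rw [← eq_of_pt_eq_pt ha ha' hx]
    exact (dist_triangle a b b').trans (by gcongr; exact ih hb hb' rfl hy)

theorem distX_pt (f : Tame k) {a b : WeightSpace} (ha : a ∈ nablaPlus) (hb : b ∈ nablaPlus) :
    distX (pt f a) (pt f b) = dist a b := by
  have hmem : dist a b ∈ {l | ChainOfLength (pt f a) (pt f b) l} := .single f a b ha hb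
  have hlow : ∀ l ∈ {l | ChainOfLength (pt f a) (pt f b) l}, dist a b ≤ l :=
    fun l hl => hl.dist_le ha hb rfl rfl
  exact le_antisymm (csInf_le ⟨_, hlow⟩ hmem) (le_csInf ⟨_, hmem⟩ hlow)

theorem comparisonAngle_pt (f : Tame k) {p a b : WeightSpace} (hp : p ∈ nablaPlus)
    (ha : a ∈ nablaPlus) (hb : b ∈ nablaPlus) :
    comparisonAngle (pt f p) (pt f a) (pt f b) = angle (a.log - p.log) (b.log - p.log) := by
  rw [comparisonAngle, distX_pt f hp ha, distX_pt f hp hb, distX_pt f ha hb, angle,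
    real_inner_eq_norm_mul_self_add_norm_mul_self_sub_norm_sub_mul_self_div_two,
    sub_sub_sub_cancel_right, ← isometry_log.dist_eq, ← isometry_log.dist_eq,
    ← isometry_log.dist_eq, dist_comm p.log, dist_comm p.log, dist_eq_norm, dist_eq_norm,
    dist_eq_norm, div_div, ← sq, ← sq, ← sq]
  congr 2
  ring

end

/-- The orthogonal projection of `(x, y, 0)` to the plane `t₁ + t₂ + t₃ = 0`. -/
noncomputable def logVec (x y : ℝ) : EuclideanSpace ℝ (Fin 3) :=
  x • !₂[2 / 3, -1 / 3, -1 / 3] + y • !₂[-1 / 3, 2 / 3, -1 / 3]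

theorem inner_logVec (x y x' y' : ℝ) : inner ℝ (logVec x y) (logVec x' y') =
    (2 * x * x' - x * y' - y * x' + 2 * y * y') / 3 := by
  simp [logVec, PiLp.inner_apply, Fin.sum_univ_three]
  ring

theorem norm_logVec (x y : ℝ) :
    ‖logVec x y‖ = √(2 / 3 * (x ^ 2 - x * y + y ^ 2)) := by
  rw [norm_eq_sqrt_real_inner, inner_logVec]
  congr 1
  ring

theorem logVec_ne_zero {x y : ℝ} (h : x ≠ 0 ∨ y ≠ 0) : logVec x y ≠ 0 := by
  have : 0 < x ^ 2 - x * y + y ^ 2 := by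
    rcases h with h | h
    · nlinarith [sq_pos_of_ne_zero h, sq_nonneg (x - 2 * y)]
    · nlinarith [sq_pos_of_ne_zero h, sq_nonneg (y - 2 * x)]
  rw [← norm_pos_iff, norm_logVec]
  positivity

theorem logVec_smul (c x y : ℝ) : logVec (c * x) (c * y) = c • logVec x y := by
  simp only [logVec, smul_add, mul_smul]

theorem angle_logVec (x : ℝ) : angle (logVec (-1) 0) (logVec x 1) =
    Real.arccos ((1 - 2 * x) / (2 * √(x ^ 2 - x + 1))) := by
  have hnorm : ‖logVec (-1) 0‖ * ‖logVec x 1‖ = 2 * √(x ^ 2 - x + 1) / 3 := by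
    rw [norm_logVec, norm_logVec, ← Real.sqrt_mul (by norm_num)]
    rw [show 2 / 3 * ((-1 : ℝ) ^ 2 - -1 * 0 + 0 ^ 2) * (2 / 3 * (x ^ 2 - x * 1 + 1 ^ 2)) =
      (2 / 3) ^ 2 * (x ^ 2 - x + 1) by ring, Real.sqrt_mul (by positivity),
      Real.sqrt_sq (by norm_num)]
    ring
  rw [angle, hnorm, inner_logVec]
  congr 1
  rw [div_div_div_cancel_right₀ three_ne_zero]
  ring

theorem arccos_le_angle_logVec {c x : ℝ} (h : 1 - 2 * x ≤ c * (2 * √(x ^ 2 - x + 1))) :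
    Real.arccos c ≤ angle (logVec (-1) 0) (logVec x 1) := by
  have hpos : 0 < x ^ 2 - x + 1 := by nlinarith [sq_nonneg (2 * x - 1)]
  rw [angle_logVec]
  exact Real.arccos_le_arccos ((div_le_iff₀ (by positivity)).2 h)

theorem log_eq_logVec (a : WeightSpace) :
    a.log = logVec (Real.log (a.coord 0)) (Real.log (a.coord 1)) := by
  conv_lhs => rw [← mk_coord a]
  change logTriple ⟨a.coord, a.coord_pos⟩ = _
  ext i
  fin_cases i <;> simp [logTriple, logVec, Fin.sum_univ_three] <;> ring

/-- The tangent vector at `[m, 1, 1]` of the ray `fanRay m r`. -/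
noncomputable def fanTangent (m : ℕ) (r : ℝ) : EuclideanSpace ℝ (Fin 3) :=
  logVec (r / m) (fanDir m r).2

variable {m : ℕ} (hm : 2 ≤ m)

section tangent

variable {r r' : ℝ} (hr : r ∈ Set.Icc (-1 : ℝ) (m + 1)) (hr' : r' ∈ Set.Icc (-1 : ℝ) (m + 1))

include hm in
theorem fanTangent_ne_zero (r : ℝ) : fanTangent m r ≠ 0 := by
  have hm0 : (m : ℝ) ≠ 0 := Nat.cast_ne_zero.2 (by omega)
  refine logVec_ne_zero ?_
  rw [fanDir]
  split_ifs with h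
  · refine .inl (div_ne_zero ?_ hm0)
    rcases h with rfl | rfl
    · norm_num
    · positivity
  · exact .inr one_ne_zero

theorem eventually_pos_and_mul_le (m : ℕ) :
    ∀ᶠ t : ℝ in 𝓝[>] 0, 0 < t ∧ t * (m + 2) ≤ 1 := by
  filter_upwards [Ioo_mem_nhdsGT (baseTime_pos (m := m))] with t ht
  exact ⟨ht.1, ((lt_div_iff₀ (by positivity)).1 ht.2).le⟩

include hr in
theorem tendsto_slope_log_fanRay :
    Tendsto (fun t : ℝ => t⁻¹ • ((fanRay m r t).log - (weightM11 m hm).log)) (𝓝[>] 0)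
      (𝓝 (fanTangent m r)) := by
  have hm0 : (m : ℝ) ≠ 0 := Nat.cast_ne_zero.2 (by omega)
  have hderiv : HasDerivAt (fun t => logVec (Real.log (m + t * r))
      (Real.log (1 + t * (fanDir m r).2))) (fanTangent m r) 0 := by
    have h (c d : ℝ) (hc : c ≠ 0) : HasDerivAt (fun t => Real.log (c + t * d)) (d / c) 0 := by
      simpa using (((hasDerivAt_id (0 : ℝ)).mul_const d).const_add c).log (by simpa using hc)
    have h₁ := h 1 (fanDir m r).2 one_ne_zero
    rw [div_one] at h₁
    exact ((h m r hm0).smul_const _).add (h₁.smul_const _)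
  refine ((hasDerivAt_iff_tendsto_slope.1 hderiv).mono_left
    (nhdsWithin_mono 0 fun t (ht : 0 < t) => ht.ne')).congr' ?_
  filter_upwards [eventually_pos_and_mul_le m] with t ht
  rw [slope_def_module, sub_zero, log_eq_logVec, log_eq_logVec, coord_weightM11_zero,
    coord_weightM11_one, coord_fanRay_zero hm hr ht.1 ht.2, coord_fanRay_one ht.1]
  simp

include hr in
theorem tendsto_fanRay : Tendsto (fanRay m r) (𝓝[>] 0) (𝓝 (weightM11 m hm)) := by
  rw [isometry_log.isEmbedding.tendsto_nhds_iff]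
  have ht : Tendsto (fun t : ℝ => t) (𝓝[>] 0) (𝓝 0) := tendsto_id.mono_left nhdsWithin_le_nhds
  have h := (ht.smul (tendsto_slope_log_fanRay hm hr)).add_const (weightM11 m hm).log
  rw [zero_smul, zero_add] at h
  refine h.congr' ?_
  filter_upwards [self_mem_nhdsWithin] with t (ht : 0 < t)
  rw [smul_inv_smul₀ ht.ne', sub_add_cancel, Function.comp_apply]

variable {k : Type*} [Field k]

include hr in
theorem tendsto_pt_fanRay (f : Tame k) :
    Tendsto (fun t => pt f (fanRay m r t)) (𝓝[>] 0)
      (towards (pt f (weightM11 m hm)) (pt f '' cell (fanRay m r (1 / (m + 2))))) := by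
  refine tendsto_inf.2 ⟨tendsto_comap_iff.2 ?_, tendsto_principal.2 ?_⟩
  · have h := (tendsto_const_nhds (x := weightM11 m hm)).dist (tendsto_fanRay hm hr)
    rw [dist_self] at h
    refine h.congr' ?_
    filter_upwards [eventually_pos_and_mul_le m] with t ht
    exact (distX_pt f (weightM11_mem_nablaPlus hm)
      (fanRay_mem_openStar hm hr ht.1 ht.2).1).symm
  · filter_upwards [eventually_pos_and_mul_le m] with t ht
    exact ⟨_, fanRay_mem_cell hm hr baseTime_pos baseTime_mul_le ht.1 ht.2, rfl⟩

include hr hr' in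
theorem tendsto_comparisonAngle_fanRay (f : Tame k) :
    Tendsto (fun t => comparisonAngle (pt f (weightM11 m hm)) (pt f (fanRay m r t))
      (pt f (fanRay m r' t))) (𝓝[>] 0) (𝓝 (angle (fanTangent m r) (fanTangent m r'))) := by
  refine ((continuousAt_angle (x := (fanTangent m r, fanTangent m r'))
    (fanTangent_ne_zero hm r) (fanTangent_ne_zero hm r')).tendsto.comp
      ((tendsto_slope_log_fanRay hm hr).prodMk_nhds
        (tendsto_slope_log_fanRay hm hr'))).congr' ?_
  filter_upwards [eventually_pos_and_mul_le m] with t ht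
  rw [comparisonAngle_pt f (weightM11_mem_nablaPlus hm) (fanRay_mem_openStar hm hr ht.1 ht.2).1
    (fanRay_mem_openStar hm hr' ht.1 ht.2).1]
  exact angle_smul_smul (inv_ne_zero ht.1.ne') _ _

include hr hr' in
theorem angle_fanTangent_le_angleX (f : Tame k) :
    angle (fanTangent m r) (fanTangent m r') ≤ angleX (pt f (weightM11 m hm))
      (pt f '' cell (fanRay m r (1 / (m + 2)))) (pt f '' cell (fanRay m r' (1 / (m + 2)))) := by
  refine le_of_forall_lt fun c hc => ?_
  obtain ⟨c', hcc', hc'⟩ := exists_between hc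
  refine hcc'.trans_le (le_limsup_of_frequently_le ?_ ?_)
  · refine ((tendsto_pt_fanRay hm hr f).prodMk (tendsto_pt_fanRay hm hr' f)).frequently ?_
    exact (((tendsto_comparisonAngle_fanRay hm hr hr' f).eventually
      (lt_mem_nhds hc')).mono fun t ht => ht.le).frequently
  · exact isBoundedUnder_of ⟨Real.pi, fun z => Real.arccos_le_pi _⟩

end tangent

theorem fanTangent_edgeParam_zero (m : ℕ) :
    fanTangent m (edgeParam 0) = (m : ℝ)⁻¹ • logVec (-1) 0 := by
  rw [← logVec_smul]
  simp [fanTangent, fanDir, edgeParam, div_eq_inv_mul]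

theorem fanTangent_edgeParam_succ {j : ℕ} (hj : j ≤ m) :
    fanTangent m (edgeParam (j + 1)) = logVec (j / m) 1 := by
  have hj' : (j : ℝ) ≤ m := Nat.cast_le.2 hj
  have h : ¬((j : ℝ) = -1 ∨ (j : ℝ) = m + 1) := by
    rintro (h | h) <;> linarith [Nat.cast_nonneg (α := ℝ) j]
  simp [fanTangent, fanDir, edgeParam, h]

/-- The angle at `[m, 1, 1]` between the lowest edge of the fan and its edge of level `s`. -/
noncomputable def fanAngle (m s : ℕ) : ℝ :=
  angle (fanTangent m (edgeParam 0)) (fanTangent m (edgeParam s))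

theorem fanAngle_succ_le (m s : ℕ) :
    fanAngle m (s + 1) ≤ fanAngle m s +
      angle (fanTangent m (edgeParam s)) (fanTangent m (edgeParam (s + 1 : ℕ))) :=
  angle_le_angle_add_angle _ _ _

include hm

theorem fanAngle_zero : fanAngle m 0 = 0 :=
  angle_self (fanTangent_ne_zero hm _)

theorem fanAngle_top : fanAngle m (m + 2) = Real.pi := by
  have hm0 : (0 : ℝ) < m := Nat.cast_pos.2 (by omega)
  have htop : fanTangent m (edgeParam (m + 2)) = ((m + 1) / m : ℝ) • -logVec (-1) 0 := by
    rw [smul_neg, ← neg_smul, ← logVec_smul]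
    simp [fanTangent, fanDir, edgeParam]
    ring_nf
    simp
  rw [fanAngle, fanTangent_edgeParam_zero, htop, angle_smul_left_of_pos _ _ (inv_pos.2 hm0),
    angle_smul_right_of_pos _ _ (by positivity)]
  exact angle_self_neg_of_nonzero (logVec_ne_zero (.inl (by norm_num)))

theorem arccos_le_fanAngle_succ {j : ℕ} (hj : j ≤ m) {c : ℝ}
    (h : 1 - 2 * (j / m : ℝ) ≤ c * (2 * √((j / m : ℝ) ^ 2 - j / m + 1))) :
    Real.arccos c ≤ fanAngle m (j + 1) := by
  have hm0 : (0 : ℝ) < m := Nat.cast_pos.2 (by omega)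
  rw [fanAngle, fanTangent_edgeParam_zero, fanTangent_edgeParam_succ hj,
    angle_smul_left_of_pos _ _ (inv_pos.2 hm0)]
  exact arccos_le_angle_logVec h

omit hm in
theorem arccos_half : Real.arccos (1 / 2) = Real.pi / 3 := by
  rw [← Real.cos_pi_div_three, Real.arccos_cos (by positivity) (by linarith [Real.pi_pos])]

theorem pi_div_three_le_fanAngle {s : ℕ} (h1 : 1 ≤ s) (hs : s ≤ m + 2) :
    Real.pi / 3 ≤ fanAngle m s := by
  have hm0 : (0 : ℝ) < m := Nat.cast_pos.2 (by omega)
  obtain rfl | hs := hs.eq_or_lt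
  · rw [fanAngle_top hm]
    linarith [Real.pi_pos]
  · obtain ⟨j, rfl⟩ := Nat.exists_eq_add_of_le' h1
    have hj : (j / m : ℝ) ≤ 1 := (div_le_one hm0).2 (Nat.cast_le.2 (by omega))
    have : (0 : ℝ) ≤ j / m := by positivity
    rw [← arccos_half]
    refine arccos_le_fanAngle_succ hm (by omega) ?_
    rw [← mul_assoc, one_div, inv_mul_cancel₀ two_ne_zero, one_mul]
    exact Real.le_sqrt_of_sq_le (by nlinarith)

theorem arccos_two_fifths_le_fanAngle {s : ℕ} (h1 : m + 6 ≤ 6 * s) (hs : s ≤ m + 2) :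
    Real.arccos (2 / 5) ≤ fanAngle m s := by
  have hm0 : (0 : ℝ) < m := Nat.cast_pos.2 (by omega)
  obtain rfl | hs := hs.eq_or_lt
  · exact (Real.arccos_le_pi _).trans (fanAngle_top hm).ge
  obtain ⟨j, rfl⟩ := Nat.exists_eq_add_of_le' (show 1 ≤ s by omega)
  have hj' : (1 : ℝ) / 6 ≤ j / m := by
    rw [div_le_div_iff₀ (by norm_num) hm0]
    exact_mod_cast (by omega : 1 * m ≤ j * 6)
  refine arccos_le_fanAngle_succ hm (by omega) ?_
  rcases le_or_gt (1 - 2 * (j / m : ℝ)) 0 with h | h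
  · exact h.trans (by positivity)
  · have : (5 : ℝ) / 4 * (1 - 2 * (j / m)) ≤ √((j / m : ℝ) ^ 2 - j / m + 1) :=
      Real.le_sqrt_of_sq_le (by nlinarith)
    linarith

omit hm in
theorem pi_div_three_lt_arccos_two_fifths : Real.pi / 3 < Real.arccos (2 / 5) := by
  rw [← arccos_half]
  exact Real.arccos_lt_arccos (by norm_num) (by norm_num) (by norm_num)

end

/-! ### Stabilizers of the points near `[m, 1, 1]` -/

section

open MvPolynomial WeightSpace

theorem nonneg_weightForm_iff_of_mem_openStar {a w : WeightSpace} (ha : a ∈ openStar w)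
    (i : Fin 3) (n : Fin 3 → ℕ) :
    0 ≤ weightForm i n a ↔
      0 < weightForm i n w ∨ weightForm i n w = 0 ∧ 0 ≤ weightForm i n a := by
  rcases eq_or_ne (weightForm i n w) 0 with h | h
  · simp [h]
  · rw [← sign_nonneg_iff, ha.2 i n h, sign_nonneg_iff, le_iff_lt_or_eq]
    simp [h, h.symm]

section nearWeightM11

variable {m : ℕ} (hm : 2 ≤ m) {a : WeightSpace}

theorem wt_le_coord_zero_iff (ha : a ∈ openStar (weightM11 m hm)) (n : Fin 3 → ℕ) :
    wt a.coord n ≤ a.coord 0 ↔ (n 0 = 1 ∧ n 1 = 0 ∧ n 2 = 0) ∨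
      n 0 = 0 ∧ (n 1 + n 2 < m ∨ n 1 + n 2 = m ∧ 0 ≤ fanForm m (n 1) a) := by
  have hw : weightForm 0 n (weightM11 m hm) = (m : ℝ) - (m * n 0 + n 1 + n 2 : ℕ) := by
    simp [weightForm_zero_apply]
  rw [← sub_nonneg]
  refine (nonneg_weightForm_iff_of_mem_openStar ha 0 n).trans ?_
  rw [hw, sub_pos, sub_eq_zero, Nat.cast_lt, Nat.cast_inj]
  obtain h0 | h0 | h0 : n 0 = 0 ∨ n 0 = 1 ∨ 2 ≤ n 0 := by omega
  · have hfan (h : n 1 + n 2 = m) : weightForm 0 n a = fanForm m (n 1) a := by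
      rw [weightForm_zero_apply, fanForm, height, ← h, h0]
      push_cast
      ring
    simp only [h0, mul_zero, zero_add, eq_comm (a := m), zero_ne_one, false_and, false_or, true_and]
    exact or_congr_right (and_congr_right fun h => by rw [hfan h])
  · have h1 (h : n 1 = 0) (h2 : n 2 = 0) : weightForm 0 n a = 0 := by
      rw [weightForm_zero_apply, h0, h, h2]
      simp
    simp +contextual [h0, add_assoc, h1]
  · have := Nat.mul_le_mul_left m h0
    omega

theorem wt_le_coord_one_iff (ha : a ∈ openStar (weightM11 m hm)) (n : Fin 3 → ℕ) :
    wt a.coord n ≤ a.coord 1 ↔ n 0 = 0 ∧ n 1 + n 2 ≤ 1 := by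
  have hw : weightForm 1 n (weightM11 m hm) = (1 : ℕ) - (m * n 0 + n 1 + n 2 : ℕ) := by
    simp [weightForm_one_apply]
  rw [← sub_nonneg]
  refine (nonneg_weightForm_iff_of_mem_openStar ha 1 n).trans ?_
  rw [hw, sub_pos, sub_eq_zero, Nat.cast_lt, Nat.cast_inj]
  obtain h0 | h0 := Nat.eq_zero_or_pos (n 0)
  · have hform (h : n 1 + n 2 = 1) : 0 ≤ weightForm 1 n a := by
      have hh := mul_nonneg (Nat.cast_nonneg (α := ℝ) (n 2)) (height_nonneg ha.1)
      have hn : (n 1 : ℝ) = 1 - n 2 := eq_sub_of_add_eq (by exact_mod_cast h)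
      rw [weightForm_one_apply, h0, hn]
      rw [height] at hh
      push_cast
      linarith
    rw [h0, mul_zero, zero_add, and_iff_left_of_imp (hform ∘ Eq.symm)]
    omega
  · have := Nat.mul_le_mul hm h0
    omega

theorem wt_le_coord_two_iff (ha : a ∈ openStar (weightM11 m hm)) (n : Fin 3 → ℕ) :
    wt a.coord n ≤ a.coord 2 ↔ n 0 = 0 ∧ n 1 + n 2 ≤ 1 ∧ (n 1 = 0 ∨ height a = 0) := by
  have hle : a.coord 2 ≤ a.coord 1 := antitone_coord ha.1 (by decide)
  suffices n 0 = 0 ∧ n 1 + n 2 ≤ 1 →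
      (wt a.coord n ≤ a.coord 2 ↔ n 1 = 0 ∨ height a = 0) by
    rw [← and_assoc, ← and_congr_right this, ← wt_le_coord_one_iff hm ha, iff_and_self]
    exact fun h => h.trans hle
  rintro ⟨h0, h1⟩
  rw [wt, Fin.sum_univ_three, h0, coord_two, height]
  obtain h1' | ⟨h1', h2⟩ : n 1 = 0 ∨ n 1 = 1 ∧ n 2 = 0 := by omega
  · simpa [h1'] using by omega
  · rw [coord_two] at hle
    simp [h1', h2, sub_eq_zero, hle.ge_iff_eq']

variable {k : Type*} [Field k]

theorem fixes_iff_of_mem_openStar (ha : a ∈ openStar (weightM11 m hm)) {u : Tame k} :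
    Fixes u a ↔
      (∀ n ∈ (u.1 (MvPolynomial.X 0)).support, (n 0 = 1 ∧ n 1 = 0 ∧ n 2 = 0) ∨
        n 0 = 0 ∧ (n 1 + n 2 < m ∨ n 1 + n 2 = m ∧ 0 ≤ fanForm m (n 1) a)) ∧
      (∀ n ∈ (u.1 (MvPolynomial.X 1)).support, n 0 = 0 ∧ n 1 + n 2 ≤ 1) ∧
      ∀ n ∈ (u.1 (MvPolynomial.X 2)).support, n 0 = 0 ∧ n 1 + n 2 ≤ 1 ∧
        (n 1 = 0 ∨ height a = 0) := by
  simp only [Fixes, Fin.forall_fin_succ, IsEmpty.forall_iff, and_true, mem_weightLE,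
    Fin.succ_zero_eq_one, Fin.succ_one_eq_two, wt_le_coord_zero_iff hm ha,
    wt_le_coord_one_iff hm ha, wt_le_coord_two_iff hm ha]

end nearWeightM11

/-! ### Permutations of the coordinates -/

variable {k : Type*} [Field k]

theorem Tame.ext {f g : Tame k} (h : ∀ i, f.1 (MvPolynomial.X i) = g.1 (MvPolynomial.X i)) :
    f = g :=
  Subtype.ext (AlgEquiv.coe_toAlgHom_injective (MvPolynomial.algHom_ext h))

/-- The linear automorphism that permutes the coordinates by `σ`. -/
noncomputable def permTame (k : Type*) [Field k] (σ : Equiv.Perm (Fin 3)) : Tame k :=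
  ⟨renameEquiv k σ, Subgroup.subset_closure (.inl fun i => by simp [totalDegree_X])⟩

@[simp]
theorem permTame_X (σ : Equiv.Perm (Fin 3)) (i : Fin 3) :
    (permTame k σ).1 (MvPolynomial.X i) = MvPolynomial.X (σ i) := by simp [permTame]

theorem permTame_one : permTame k 1 = 1 := Tame.ext fun i => by simp

theorem permTame_mul (σ τ : Equiv.Perm (Fin 3)) :
    permTame k (σ * τ) = permTame k σ * permTame k τ := Tame.ext fun i => by simp

theorem nuId_permTame (σ : Equiv.Perm (Fin 3)) {α β : PosTriple} (h : ∀ i, α.1 i = β.1 (σ i))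
    (P : Poly k) : nuId β ((permTame k σ).1 P) = nuId α P := by
  classical
  have hs : ((permTame k σ).1 P).support = P.support.image (Finsupp.mapDomain σ) :=
    support_rename_of_injective σ.injective
  rw [nuId, hs, Finset.inf_image, nuId]
  refine Finset.inf_congr rfl fun n _ => ?_
  rw [Function.comp, ← Equiv.sum_comp σ]
  simp only [h, Finsupp.mapDomain_apply σ.injective]

theorem pt_permTame_mul (f : Tame k) (σ : Equiv.Perm (Fin 3)) {α β : PosTriple}
    (h : ∀ i, α.1 i = β.1 (σ i)) :
    pt (permTame k σ * f) (WeightSpace.mk β) = pt f (WeightSpace.mk α) :=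
  Subtype.ext (congrArg (Quotient.mk _) (funext fun P => nuId_permTame σ h (f.1 P)))

/-- An apartment is the union of six chambers, which are permuted simply transitively by the
permutations of the coordinates. -/
theorem mem_apartment_iff {f : Tame k} {x : X k} :
    x ∈ apartment f ↔ ∃ σ, ∃ a ∈ nablaPlus, x = pt (permTame k σ * f) a := by
  constructor
  · rintro ⟨b, rfl⟩
    induction b using Quotient.inductionOn with
    | h β =>
      set ρ := Tuple.sort (fun i => -β.1 i)
      have hmono := Tuple.monotone_sort (fun i => -β.1 i)
      refine ⟨ρ⁻¹, WeightSpace.mk ⟨β.1 ∘ ρ, fun i => β.2 _⟩,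
        ⟨_, rfl, neg_le_neg_iff.1 (hmono (by decide : (0 : Fin 3) ≤ 1)),
          neg_le_neg_iff.1 (hmono (by decide : (1 : Fin 3) ≤ 2))⟩, ?_⟩
      exact (pt_permTame_mul f ρ⁻¹ fun i => by simp).symm
  · rintro ⟨σ, a, -, rfl⟩
    rw [← mk_coord a]
    exact ⟨WeightSpace.mk ⟨a.coord ∘ σ, fun i => a.coord_pos _⟩,
      (pt_permTame_mul f σ fun i => rfl).symm⟩

variable (k) in
/-- The transposition of the last two coordinates: the reflection of an apartment through
`[m, 1, 1]` in the wall `α₂ = α₃`. -/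
noncomputable def swapTame : Tame k := permTame k (Equiv.swap 1 2)

theorem swapTame_X_zero : (swapTame k).1 (MvPolynomial.X 0) = MvPolynomial.X 0 := by
  rw [swapTame, permTame_X, Equiv.swap_apply_of_ne_of_ne (by decide) (by decide)]

theorem swapTame_X_one : (swapTame k).1 (MvPolynomial.X 1) = MvPolynomial.X 2 := by
  rw [swapTame, permTame_X, Equiv.swap_apply_left]

theorem swapTame_X_two : (swapTame k).1 (MvPolynomial.X 2) = MvPolynomial.X 1 := by
  rw [swapTame, permTame_X, Equiv.swap_apply_right]

theorem swapTame_mul_self : swapTame k * swapTame k = 1 := by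
  rw [swapTame, ← permTame_mul, Equiv.swap_mul_self, permTame_one]

theorem fixes_swapTame_iff {a : WeightSpace} (ha : a ∈ nablaPlus) :
    Fixes (swapTame k) a ↔ height a = 0 := by
  have hle : a.coord 2 ≤ a.coord 1 := antitone_coord ha (by decide)
  simp only [Fixes, Fin.forall_fin_succ, IsEmpty.forall_iff, and_true, Fin.succ_zero_eq_one,
    Fin.succ_one_eq_two, swapTame_X_zero, swapTame_X_one, swapTame_X_two, X_mem_weightLE_iff,
    le_refl, true_and, hle, height, sub_eq_zero]
  rw [← coord_two a]
  exact ⟨fun h => h.antisymm hle, Eq.le⟩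

variable {m : ℕ} (hm : 2 ≤ m)

theorem eq_one_or_eq_swap_of_fixes_permTame {σ : Equiv.Perm (Fin 3)}
    (h : Fixes (permTame k σ) (weightM11 m hm)) : σ = 1 ∨ σ = Equiv.swap 1 2 := by
  have hne {i : Fin 3} (hi : (weightM11 m hm).coord i = 1) : σ i ≠ 0 := fun h0 => by
    have hmem := h i
    rw [permTame_X, X_mem_weightLE_iff, hi, h0, coord_weightM11_zero, Nat.cast_le_one] at hmem
    omega
  have h1 := hne (coord_weightM11_one hm)
  have h2 := hne (coord_two _)
  clear h hne
  revert σ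
  decide

theorem pt_eq_or_eq_swapTame_of_mem_apartment {f g : Tame k} {a : WeightSpace}
    (ha : a ∈ openStar (weightM11 m hm))
    (hfg : pt f (weightM11 m hm) = pt g (weightM11 m hm)) (h : pt g a ∈ apartment f) :
    pt g a = pt f a ∨ pt g a = pt (swapTame k * f) a := by
  obtain ⟨σ, b, hb, h⟩ := mem_apartment_iff.1 h
  obtain rfl := eq_of_pt_eq_pt ha.1 hb h
  have hw := weightM11_mem_nablaPlus hm
  have hσ := pt_eq_pt_of_mem_admissibleHull ha.1 hw (mem_admissibleHull_of_mem_openStar ha) h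
  rw [← hfg, pt_eq_pt_iff hw, mul_inv_cancel_right] at hσ
  obtain rfl | rfl := eq_one_or_eq_swap_of_fixes_permTame hm hσ
  · exact .inl (by rw [h, permTame_one, one_mul])
  · exact .inr h

end

/-! ### The link of `ν_{h,[m, 1, 1]}` -/

section

variable {k : Type*} [Field k] {m : ℕ}

/-- The vertex of the link of `ν_{f,[m, 1, 1]}` given by the `s`-th edge of the fan in the chamber
of `f`, for `0 ≤ s ≤ m + 2`. -/
def linkVert (m : ℕ) (f : Tame k) (s : ℕ) : Set (X k) := pt f '' cell (edgePt m s)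

/-- The edge of the link of `ν_{f,[m, 1, 1]}` given by the face of the fan in the chamber of `f`
between the edges `s` and `s + 1`, for `0 ≤ s ≤ m + 1`. -/
def linkEdge (m : ℕ) (f : Tame k) (s : ℕ) : Set (X k) := pt f '' cell (facePt m s)

section fan

variable (hm : 2 ≤ m) {f g : Tame k} {s t : ℕ}

include hm

theorem linkVert_eq_linkVert_iff (hs : s ≤ m + 2) (ht : t ≤ m + 2) :
    linkVert m f s = linkVert m g t ↔ s = t ∧ pt f (edgePt m s) = pt g (edgePt m s) := by
  rw [linkVert, linkVert, image_cell_eq_iff (edgePt_mem_nablaPlus hm hs),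
    edgePt_mem_cell_edgePt_iff hm hs ht]

theorem linkEdge_eq_linkEdge_iff (hs : s ≤ m + 1) (ht : t ≤ m + 1) :
    linkEdge m f s = linkEdge m g t ↔ s = t ∧ pt f (facePt m s) = pt g (facePt m s) := by
  rw [linkEdge, linkEdge, image_cell_eq_iff (facePt_mem_nablaPlus hm hs),
    facePt_mem_cell_facePt_iff hm hs ht]

theorem linkVert_eq_iff_fixes (hs : s ≤ m + 2) :
    linkVert m f s = linkVert m g s ↔ Fixes (g * f⁻¹) (edgePt m s) := by
  rw [linkVert_eq_linkVert_iff hm hs hs, pt_eq_pt_iff (edgePt_mem_nablaPlus hm hs),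
    and_iff_right rfl]

theorem linkEdge_eq_iff_fixes (hs : s ≤ m + 1) :
    linkEdge m f s = linkEdge m g s ↔ Fixes (g * f⁻¹) (facePt m s) := by
  rw [linkEdge_eq_linkEdge_iff hm hs hs, pt_eq_pt_iff (facePt_mem_nablaPlus hm hs),
    and_iff_right rfl]

theorem linkVert_eq_of_linkEdge_eq (hs : s ≤ m + 1) (ht : t ∈ Set.Icc s (s + 1))
    (h : linkEdge m f s = linkEdge m g s) : linkVert m f t = linkVert m g t := by
  have hts := ht.2
  rw [linkEdge_eq_iff_fixes hm hs] at h
  exact (linkVert_eq_iff_fixes hm (by omega)).2 <|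
    Fixes.of_mem_admissibleHull (by simpa using h) (edgePt_mem_admissibleHull_facePt hm hs ht)

theorem linkEdge_eq_of_linkVert_eq (h1 : 1 ≤ s) (hs : s ≤ m + 1)
    (h : linkVert m f s = linkVert m g s) : linkEdge m f s = linkEdge m g s := by
  rw [linkVert_eq_iff_fixes hm (by omega)] at h
  exact (linkEdge_eq_iff_fixes hm hs).2 <|
    Fixes.of_mem_admissibleHull (by simpa using h) (facePt_mem_admissibleHull_edgePt hm h1 hs)

theorem linkEdge_zero_eq_of_linkVert_eq (h0 : linkVert m f 0 = linkVert m g 0)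
    (h1 : linkVert m f (m + 1) = linkVert m g (m + 1)) : linkEdge m f 0 = linkEdge m g 0 := by
  rw [linkVert_eq_iff_fixes hm (by omega)] at h0 h1
  exact (linkEdge_eq_iff_fixes hm (by omega)).2 <|
    Fixes.of_mem_admissibleHull (by simp [h0, h1]) (facePt_zero_mem_admissibleHull hm)

theorem linkEdge_eq_of_linkEdge_eq (hst : s ≤ t) (ht : t ≤ m + 1)
    (h : linkEdge m f s = linkEdge m g s) : linkEdge m f t = linkEdge m g t := by
  induction t, hst using Nat.le_induction with
  | base => exact h
  | succ t _ ih =>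
    exact linkEdge_eq_of_linkVert_eq hm (by omega) ht
      (linkVert_eq_of_linkEdge_eq hm (by omega) ⟨t.le_succ, le_rfl⟩ (ih (by omega)))

theorem linkVert_eq_of_linkEdge_zero_eq (hs : s ≤ m + 2) (h : linkEdge m f 0 = linkEdge m g 0) :
    linkVert m f s = linkVert m g s := by
  have hle : s - 1 ≤ m + 1 := by omega
  exact linkVert_eq_of_linkEdge_eq hm hle ⟨by omega, by omega⟩
    (linkEdge_eq_of_linkEdge_eq hm (s - 1).zero_le hle h)

theorem linkVert_eq_of_linkVert_eq (h1 : 1 ≤ s) (hst : s ≤ t) (ht : t ≤ m + 2)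
    (h : linkVert m f s = linkVert m g s) : linkVert m f t = linkVert m g t := by
  obtain rfl | hlt := hst.eq_or_lt
  · exact h
  · exact linkVert_eq_of_linkEdge_eq hm (s := t - 1) (by omega) ⟨by omega, by omega⟩
      (linkEdge_eq_of_linkEdge_eq hm (by omega) (by omega)
        (linkEdge_eq_of_linkVert_eq hm h1 (by omega) h))

theorem linkEdge_ne_linkEdge_swapTame (f : Tame k) (hs : s ≤ m + 1) :
    linkEdge m f s ≠ linkEdge m (swapTame k * f) s := by
  rw [Ne, linkEdge_eq_iff_fixes hm hs, mul_inv_cancel_right,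
    fixes_swapTame_iff (facePt_mem_nablaPlus hm hs)]
  exact height_facePt_ne_zero

theorem linkVert_eq_linkVert_swapTame_iff (f : Tame k) (hs : s ≤ m + 2) :
    linkVert m f s = linkVert m (swapTame k * f) s ↔ s = 0 ∨ s = m + 2 := by
  rw [linkVert_eq_iff_fixes hm hs, mul_inv_cancel_right,
    fixes_swapTame_iff (edgePt_mem_nablaPlus hm hs), height_edgePt_eq_zero_iff]

end fan

section cells

variable {hm : 2 ≤ m} {ν : X k} {h f : Tame k}

theorem eq_weightM11_of_pt_eq {b a : WeightSpace} (ha : a ∈ closure (cell b))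
    (h' : pt f a = pt h (weightM11 m hm)) : a = weightM11 m hm :=
  eq_of_pt_eq_pt (closure_cell_subset_nablaPlus b ha) (weightM11_mem_nablaPlus hm) h'

theorem IsLinkVertex.exists_eq_linkVert (hν : ν = pt h (weightM11 m hm)) {x : Set (X k)}
    (hx : IsLinkVertex ν x) :
    ∃ f, pt f (weightM11 m hm) = ν ∧ ∃ s ≤ m + 2, x = linkVert m f s := by
  obtain ⟨f, E, hE, rfl, a, ha, hfa⟩ := hx
  obtain ⟨b, -, -, -, hEb⟩ := hE.exists_eq_cell
  obtain rfl := eq_weightM11_of_pt_eq (hEb ▸ ha) (hfa.trans hν)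
  obtain ⟨s, hs, rfl⟩ := hE.exists_eq_cell_edgePt hm ha
  exact ⟨f, hfa, s, hs, rfl⟩

theorem IsLinkEdge.exists_eq_linkEdge (hν : ν = pt h (weightM11 m hm)) {c : Set (X k)}
    (hc : IsLinkEdge ν c) :
    ∃ f, pt f (weightM11 m hm) = ν ∧ ∃ s ≤ m + 1, c = linkEdge m f s := by
  obtain ⟨f, C, hC, rfl, a, ha, hfa⟩ := hc
  obtain ⟨b, -, -, hCb⟩ := hC.exists_eq_cell
  obtain rfl := eq_weightM11_of_pt_eq (hCb ▸ ha) (hfa.trans hν)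
  obtain ⟨s, hs, rfl⟩ := hC.exists_eq_cell_facePt hm ha
  exact ⟨f, hfa, s, hs, rfl⟩

theorem LinkInc.isLinkVertex {c x : Set (X k)} (h : LinkInc ν c x) : IsLinkVertex ν x := by
  obtain ⟨f, C, E, -, hE, -, -, rfl, hν⟩ := h
  exact ⟨f, E, hE, rfl, hν⟩

theorem LinkInc.isLinkEdge {c x : Set (X k)} (h : LinkInc ν c x) : IsLinkEdge ν c := by
  obtain ⟨f, C, E, hC, -, hEC, rfl, rfl, hν⟩ := h
  exact ⟨f, C, hC, rfl, Set.image_mono (closure_minimal hEC isClosed_closure) hν⟩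

theorem LinkInc.exists_eq_linkEdge (hν : ν = pt h (weightM11 m hm)) {c x : Set (X k)}
    (hcx : LinkInc ν c x) :
    ∃ f, pt f (weightM11 m hm) = ν ∧ ∃ s ≤ m + 1, c = linkEdge m f s ∧
      (x = linkVert m f s ∨ x = linkVert m f (s + 1)) := by
  obtain ⟨f, C, E, hC, hE, hEC, rfl, rfl, a, ha, hfa⟩ := hcx
  obtain ⟨b, -, -, -, hEb⟩ := hE.exists_eq_cell
  obtain rfl := eq_weightM11_of_pt_eq (hEb ▸ ha) (hfa.trans hν)
  obtain ⟨t, ht, rfl⟩ := hE.exists_eq_cell_edgePt hm ha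
  obtain ⟨s, hs, rfl⟩ := hC.exists_eq_cell_facePt hm (closure_minimal hEC isClosed_closure ha)
  refine ⟨f, hfa, s, hs, rfl, ?_⟩
  exact (eq_or_eq_succ_of_cell_edgePt_subset hm ht hs hEC).imp
    (congrArg (linkVert m f)) (congrArg (linkVert m f))

theorem LinkInc.eq_linkVert (hν : ν = pt h (weightM11 m hm)) {s : ℕ} (hs : s ≤ m + 1)
    {x : Set (X k)} (hcx : LinkInc ν (linkEdge m f s) x) :
    x = linkVert m f s ∨ x = linkVert m f (s + 1) := by
  obtain ⟨g, -, t, ht, hfg, hx⟩ := hcx.exists_eq_linkEdge hν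
  obtain ⟨rfl, -⟩ := (linkEdge_eq_linkEdge_iff hm hs ht).1 hfg
  rwa [linkVert_eq_of_linkEdge_eq hm hs ⟨le_rfl, s.le_succ⟩ hfg,
    linkVert_eq_of_linkEdge_eq hm hs ⟨s.le_succ, le_rfl⟩ hfg]

theorem image_subset_apartment_swapTame (f : Tame k) {S : Set WeightSpace} (hS : S ⊆ nablaPlus) :
    pt (swapTame k * f) '' S ⊆ apartment f := by
  rintro _ ⟨a, ha, rfl⟩
  exact mem_apartment_iff.2 ⟨_, a, hS ha, rfl⟩

theorem mem_apartmentLink_verts_iff (hf : pt f (weightM11 m hm) = ν) {x : Set (X k)} :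
    x ∈ (apartmentLink ν f).verts ↔ IsLinkVertex ν x ∧
      ∃ s ≤ m + 2, x = linkVert m f s ∨ x = linkVert m (swapTame k * f) s := by
  refine and_congr_right fun hx => ⟨fun h => ?_, ?_⟩
  · obtain ⟨g, hg, s, hs, rfl⟩ := hx.exists_eq_linkVert hf.symm
    refine ⟨s, hs, ?_⟩
    have ha := edgePt_mem_openStar hm hs
    rw [linkVert_eq_linkVert_iff hm hs hs, linkVert_eq_linkVert_iff hm hs hs]
    simpa only [true_and] using pt_eq_or_eq_swapTame_of_mem_apartment hm ha (hf.trans hg.symm)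
      (h ⟨_, mem_cell_self ha.1, rfl⟩)
  · rintro ⟨s, -, rfl | rfl⟩
    · exact Set.image_subset_range _ _
    · exact image_subset_apartment_swapTame f fun a ha => ha.1

theorem mem_apartmentLink_edges_iff (hf : pt f (weightM11 m hm) = ν) {c : Set (X k)} :
    c ∈ (apartmentLink ν f).edges ↔ IsLinkEdge ν c ∧
      ∃ s ≤ m + 1, c = linkEdge m f s ∨ c = linkEdge m (swapTame k * f) s := by
  refine and_congr_right fun hc => ⟨fun h => ?_, ?_⟩
  · obtain ⟨g, hg, s, hs, rfl⟩ := hc.exists_eq_linkEdge hf.symm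
    refine ⟨s, hs, ?_⟩
    have ha := facePt_mem_openStar hm hs
    rw [linkEdge_eq_linkEdge_iff hm hs hs, linkEdge_eq_linkEdge_iff hm hs hs]
    simpa only [true_and] using pt_eq_or_eq_swapTame_of_mem_apartment hm ha (hf.trans hg.symm)
      (h ⟨_, mem_cell_self ha.1, rfl⟩)
  · rintro ⟨s, -, rfl | rfl⟩
    · exact Set.image_subset_range _ _
    · exact image_subset_apartment_swapTame f fun a ha => ha.1

theorem pt_weightM11_eq_of_linkEdge_eq {g : Tame k} {s : ℕ} (hs : s ≤ m + 1)
    (h : linkEdge m f s = linkEdge m g s) : pt f (weightM11 m hm) = pt g (weightM11 m hm) :=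
  pt_eq_pt_of_mem_admissibleHull (facePt_mem_nablaPlus hm hs) (weightM11_mem_nablaPlus hm)
    (mem_admissibleHull_of_mem_openStar (facePt_mem_openStar hm hs))
    ((linkEdge_eq_linkEdge_iff hm hs hs).1 h).2

end cells

end

/-! ### Two chambers that share the wall edge lie in an apartment -/

section

open MvPolynomial

variable {k : Type*} [Field k]

/-- The algebra endomorphism `x₂ ↦ x₂ + c x₃`. -/
noncomputable def shearHom (c : k) : Poly k →ₐ[k] Poly k :=
  aeval ![MvPolynomial.X 0, MvPolynomial.X 1 + C c * MvPolynomial.X 2, MvPolynomial.X 2]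

theorem shearHom_X_zero (c : k) : shearHom c (MvPolynomial.X 0) = MvPolynomial.X 0 := by
  simp [shearHom]

theorem shearHom_X_one (c : k) :
    shearHom c (MvPolynomial.X 1) = MvPolynomial.X 1 + C c * MvPolynomial.X 2 := by
  simp [shearHom]

theorem shearHom_X_two (c : k) : shearHom c (MvPolynomial.X 2) = MvPolynomial.X 2 := by
  simp [shearHom]

theorem shearHom_comp_shearHom_of_add_eq_zero {c d : k} (h : c + d = 0) :
    (shearHom c).comp (shearHom d) = AlgHom.id k (Poly k) := by
  refine MvPolynomial.algHom_ext fun i => ?_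
  fin_cases i
  · simp [shearHom_X_zero]
  · simp only [Fin.mk_one, AlgHom.comp_apply, shearHom_X_one, map_add, map_mul, algHom_C,
      algebraMap_eq, shearHom_X_two, AlgHom.id_apply]
    rw [add_assoc, ← add_mul, ← C_add, h, C_0, zero_mul, add_zero]
  · simp [shearHom_X_two]

/-- The linear automorphism `x₂ ↦ x₂ + c x₃`. -/
noncomputable def shear (c : k) : Tame k :=
  ⟨AlgEquiv.ofAlgHom (shearHom c) (shearHom (-c))
      (shearHom_comp_shearHom_of_add_eq_zero (add_neg_cancel c))
      (shearHom_comp_shearHom_of_add_eq_zero (neg_add_cancel c)),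
    Subgroup.subset_closure <| .inl fun i => by
      rw [AlgEquiv.ofAlgHom_apply]
      fin_cases i
      · simp [shearHom_X_zero]
      · rw [Fin.mk_one, shearHom_X_one, C_mul']
        refine (totalDegree_add _ _).trans (max_le (totalDegree_X _).le ?_)
        exact (totalDegree_smul_le _ _).trans (totalDegree_X _).le
      · simp [shearHom_X_two]⟩

theorem shear_X_zero (c : k) : (shear c).1 (MvPolynomial.X 0) = MvPolynomial.X 0 :=
  shearHom_X_zero c

theorem shear_X_one (c : k) :
    (shear c).1 (MvPolynomial.X 1) = MvPolynomial.X 1 + C c * MvPolynomial.X 2 :=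
  shearHom_X_one c

theorem shear_X_two (c : k) : (shear c).1 (MvPolynomial.X 2) = MvPolynomial.X 2 :=
  shearHom_X_two c

theorem inv_shear (c : k) : (shear c)⁻¹ = shear (-c) :=
  Subtype.ext (AlgEquiv.ext fun _ => rfl)

theorem fixes_shear (c : k) {a : WeightSpace} (ha : a ∈ nablaPlus) : Fixes (shear c) a := by
  have hX (i : Fin 3) : (MvPolynomial.X i : Poly k) ∈ weightLE k a.coord (a.coord i) :=
    (X_mem_weightLE_iff i).2 le_rfl
  intro i
  fin_cases i
  · exact (shear_X_zero c).symm ▸ hX 0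
  · rw [Fin.mk_one, shear_X_one, C_mul']
    exact add_mem (hX 1) (Submodule.smul_mem _ c
      (weightLE_mono (antitone_coord ha (by decide : (1 : Fin 3) ≤ 2)) (hX 2)))
  · exact (shear_X_two c).symm ▸ hX 2

variable {m : ℕ} (hm : 2 ≤ m)

theorem eq_single_one_of_add_le_one {n : Fin 3 →₀ ℕ} (h0 : n 0 = 0) (h : n 1 + n 2 ≤ 1)
    (h1 : n 1 ≠ 0) : n = Finsupp.single 1 1 := by
  ext i
  fin_cases i <;> simp <;> omega

include hm

theorem fixes_facePt_zero_iff {b : Tame k} :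
    Fixes b (facePt m 0) ↔ Fixes b (edgePt m 0) ∧
      coeff (Finsupp.single 1 1) (b.1 (MvPolynomial.X 2)) = 0 := by
  have hface (n : Fin 3 →₀ ℕ) : ¬(n 1 + n 2 = m ∧ 0 ≤ fanForm m (n 1) (facePt m 0)) := by
    rintro ⟨h, h'⟩
    exact Nat.not_lt_zero _ ((fanForm_facePt_nonneg_iff hm (by omega) (by omega)).1 h')
  have hedge (n : Fin 3 →₀ ℕ) : ¬(n 1 + n 2 = m ∧ 0 ≤ fanForm m (n 1) (edgePt m 0)) := by
    rintro ⟨h, h'⟩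
    exact Nat.not_lt_zero _ ((fanForm_edgePt_nonneg_iff hm (by omega) (by omega)).1 h')
  have hheight : height (edgePt m 0) = 0 := height_edgePt_eq_zero_iff.2 (.inl rfl)
  rw [fixes_iff_of_mem_openStar hm (facePt_mem_openStar hm (by omega)),
    fixes_iff_of_mem_openStar hm (edgePt_mem_openStar hm (by omega))]
  simp only [hface, hedge, hheight, height_facePt_ne_zero, or_false, or_true, and_true, and_assoc]
  refine and_congr_right fun _ => and_congr_right fun _ => ⟨fun h => ⟨fun n hn => ?_, ?_⟩, ?_⟩
  · exact ⟨(h n hn).1, (h n hn).2.1⟩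
  · by_contra hne
    simpa using (h _ (mem_support_iff.2 hne)).2.2
  · rintro ⟨h, he⟩ n hn
    refine ⟨(h n hn).1, (h n hn).2, ?_⟩
    by_contra h1
    rw [eq_single_one_of_add_le_one (h n hn).1 (h n hn).2 h1] at hn
    exact mem_support_iff.1 hn he

/-- The Bruhat decomposition, for the Borel subgroup of stabilizers of `facePt m 0`. -/
theorem exists_fixes_facePt_zero_bruhat {b : Tame k} (h0 : Fixes b (edgePt m 0))
    (h1 : ¬Fixes b (facePt m 0)) :
    ∃ u : Tame k, Fixes u (facePt m 0) ∧ Fixes (b * (swapTame k * u)⁻¹) (facePt m 0) := by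
  set e : Fin 3 →₀ ℕ := Finsupp.single 1 1
  have hb : coeff e (b.1 (MvPolynomial.X 2)) ≠ 0 :=
    fun h => h1 ((fixes_facePt_zero_iff hm).2 ⟨h0, h⟩)
  set c : k := coeff e (b.1 (MvPolynomial.X 1)) / coeff e (b.1 (MvPolynomial.X 2))
  refine ⟨shear c, fixes_shear c (facePt_mem_nablaPlus hm (by omega)), ?_⟩
  rw [mul_inv_rev, inv_eq_of_mul_eq_one_left swapTame_mul_self, inv_shear]
  have hE := edgePt_mem_nablaPlus hm (m + 2).zero_le
  refine (fixes_facePt_zero_iff hm).2 ⟨h0.mul ((fixes_shear _ hE).mul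
    ((fixes_swapTame_iff hE).2 (height_edgePt_eq_zero_iff.2 (.inl rfl)))), ?_⟩
  have hval : (b * (shear (-c) * swapTame k)).1 (MvPolynomial.X 2) =
      b.1 (MvPolynomial.X 1) + C (-c) * b.1 (MvPolynomial.X 2) := by
    have hC : b.1 (C (-c)) = C (-c) := b.1.commutes (-c)
    rw [← hC, ← map_mul, ← map_add, ← shear_X_one, ← swapTame_X_two]
    rfl
  rw [hval, coeff_add, coeff_C_mul, neg_mul, div_mul_cancel₀ _ hb, add_neg_cancel]

theorem exists_linkEdge_eq_and_linkEdge_eq_swapTame {f g : Tame k}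
    (h0 : linkVert m f 0 = linkVert m g 0) (h1 : linkEdge m f 0 ≠ linkEdge m g 0) :
    ∃ f' : Tame k, linkEdge m f 0 = linkEdge m f' 0 ∧
      linkEdge m g 0 = linkEdge m (swapTame k * f') 0 := by
  have hz : 0 ≤ m + 1 := by omega
  rw [linkVert_eq_iff_fixes hm (by omega)] at h0
  rw [Ne, linkEdge_eq_iff_fixes hm hz] at h1
  obtain ⟨u, hu, hu'⟩ := exists_fixes_facePt_zero_bruhat hm h0 h1
  refine ⟨u * f, ?_, ?_⟩
  · rwa [linkEdge_eq_iff_fixes hm hz, mul_inv_cancel_right]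
  · rw [eq_comm, linkEdge_eq_iff_fixes hm hz]
    convert hu' using 1
    group

end

/-! ### Forms in the last two variables -/

section

open MvPolynomial

section PlaneForm

variable {k : Type*} [Field k]

variable (k) in
/-- The substitution `x₁ ↦ 0`, `x₂ ↦ tT`, `x₃ ↦ T` into `k[t][T]`; powers of the outer variable `T`
record the degree in `x₂, x₃`. -/
noncomputable def planeSubst : Poly k →ₐ[k] Polynomial (Polynomial k) :=
  aeval ![0, Polynomial.C Polynomial.X * Polynomial.X, Polynomial.X]

/-- The homogeneous part of degree `d` of `P(0, x₂, x₃)`, dehomogenized by `x₃ = 1`. -/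
noncomputable def planeForm (d : ℕ) (P : Poly k) : Polynomial k := (planeSubst k P).coeff d

theorem planeSubst_C (c : k) : planeSubst k (C c) = Polynomial.C (Polynomial.C c) :=
  (planeSubst k).commutes c

theorem planeSubst_monomial (n : Fin 3 →₀ ℕ) (c : k) : planeSubst k (monomial n c) =
    if n 0 = 0 then Polynomial.monomial (n 1 + n 2) (Polynomial.monomial (n 1) c) else 0 := by
  rw [planeSubst, aeval_monomial, Finsupp.prod_fintype _ _ fun i => by simp, Fin.prod_univ_three]
  simp only [Matrix.cons_val_zero, Matrix.cons_val_one, Matrix.cons_val]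
  split_ifs with h
  · rw [h, pow_zero, one_mul, mul_pow, ← Polynomial.C_pow, mul_assoc, ← pow_add,
      ← Polynomial.C_mul_X_pow_eq_monomial, ← Polynomial.C_mul_X_pow_eq_monomial, Polynomial.C_mul,
      mul_assoc]
    rfl
  · simp [h]

theorem planeForm_monomial (d : ℕ) (n : Fin 3 →₀ ℕ) (c : k) : planeForm d (monomial n c) =
    if n 0 = 0 ∧ n 1 + n 2 = d then Polynomial.monomial (n 1) c else 0 := by
  rw [planeForm, planeSubst_monomial]
  split_ifs with h0 h h
  · rw [h.2, Polynomial.coeff_monomial_same]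
  · exact Polynomial.coeff_monomial_of_ne _ fun hd => h ⟨h0, hd.symm⟩
  · exact absurd h.1 h0
  · exact Polynomial.coeff_zero _

theorem eq_single_add_single_iff {n : Fin 3 →₀ ℕ} {i j : ℕ} :
    n = Finsupp.single 1 i + Finsupp.single 2 j ↔ n 0 = 0 ∧ n 1 = i ∧ n 2 = j := by
  refine ⟨by rintro rfl; simp, fun ⟨h0, h1, h2⟩ => ?_⟩
  ext l
  fin_cases l <;> simp [h0, h1, h2]

theorem coeff_planeForm (d j : ℕ) (P : Poly k) : (planeForm d P).coeff j =
    if j ≤ d then coeff (Finsupp.single 1 j + Finsupp.single 2 (d - j)) P else 0 := by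
  induction P using MvPolynomial.induction_on' with
  | monomial n c =>
    rw [planeForm_monomial, coeff_monomial]
    simp only [eq_single_add_single_iff]
    split_ifs with h hj hn hn hj
    · rw [hn.2.1, Polynomial.coeff_monomial_same]
    · exact Polynomial.coeff_monomial_of_ne _ (by omega)
    · exact Polynomial.coeff_monomial_of_ne _ (by omega)
    · omega
    · exact Polynomial.coeff_zero _
    · exact Polynomial.coeff_zero _
  | add P Q hP hQ =>
    rw [planeForm, map_add, Polynomial.coeff_add, Polynomial.coeff_add, ← planeForm, ← planeForm,
      hP, hQ]
    split_ifs <;> simp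

theorem natDegree_planeForm_le (d : ℕ) (P : Poly k) : (planeForm d P).natDegree ≤ d :=
  Polynomial.natDegree_le_iff_coeff_eq_zero.2 fun j hj => by rw [coeff_planeForm, if_neg hj.not_ge]

theorem natDegree_planeSubst_le {P : Poly k} {d : ℕ}
    (h : ∀ n ∈ P.support, n 0 = 0 → n 1 + n 2 ≤ d) : (planeSubst k P).natDegree ≤ d := by
  rw [P.as_sum, map_sum]
  refine Polynomial.natDegree_sum_le_of_forall_le _ _ fun n hn => ?_
  rw [planeSubst_monomial]
  split_ifs with h0
  · exact (Polynomial.natDegree_monomial_le _).trans (h n hn h0)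
  · simp

theorem planeForm_pow_mul_pow {P Q : Poly k} (hP : (planeSubst k P).natDegree ≤ 1)
    (hQ : (planeSubst k Q).natDegree ≤ 1) {i j d : ℕ} (hd : i + j ≤ d) :
    planeForm d (P ^ i * Q ^ j) =
      if i + j = d then planeForm 1 P ^ i * planeForm 1 Q ^ j else 0 := by
  have hPi := Polynomial.natDegree_pow_le_of_le i hP
  have hQj := Polynomial.natDegree_pow_le_of_le j hQ
  have hPc := Polynomial.coeff_pow_of_natDegree_le (m := i) hP
  have hQc := Polynomial.coeff_pow_of_natDegree_le (m := j) hQ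
  rw [mul_one] at hPi hQj hPc hQc
  rw [planeForm, map_mul, map_pow, map_pow]
  split_ifs with h
  · rw [← h, Polynomial.coeff_mul_add_eq_of_natDegree_le hPi hQj, hPc, hQc]
    rfl
  · exact Polynomial.coeff_eq_zero_of_natDegree_lt <|
      (Polynomial.natDegree_mul_le_of_le hPi hQj).trans_lt (hd.lt_of_ne h)

variable {u : Poly k ≃ₐ[k] Poly k} {d : ℕ} {P : Poly k} {D : Polynomial k}
  (h1 : (planeSubst k (u (MvPolynomial.X 1))).natDegree ≤ 1)
  (h2 : (planeSubst k (u (MvPolynomial.X 2))).natDegree ≤ 1)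

include h1 h2

theorem dvd_planeForm_map
    (hP : ∀ n ∈ P.support, n 0 = 0 ∧ n 1 + n 2 ≤ d ∧ (n 1 + n 2 = d →
      D ∣ planeForm 1 (u (MvPolynomial.X 1)) ^ n 1 * planeForm 1 (u (MvPolynomial.X 2)) ^ n 2)) :
    D ∣ planeForm d (u P) := by
  rw [P.as_sum, map_sum, planeForm, map_sum, Polynomial.finsetSum_coeff]
  refine Finset.dvd_sum fun n hn => ?_
  obtain ⟨h0, hd, hD⟩ := hP n hn
  rw [algEquiv_monomial, map_mul, planeSubst_C, Polynomial.coeff_C_mul, Fin.prod_univ_three, h0,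
    pow_zero, one_mul, ← planeForm, planeForm_pow_mul_pow h1 h2 hd]
  refine Dvd.dvd.mul_left ?_ _
  split_ifs with h
  · exact hD h
  · exact dvd_zero D

theorem dvd_planeForm_map_sub
    (hP : ∀ n ∈ P.support, (n 0 = 1 ∧ n 1 = 0 ∧ n 2 = 0) ∨ n 0 = 0 ∧ n 1 + n 2 ≤ d ∧
      (n 1 + n 2 = d →
        D ∣ planeForm 1 (u (MvPolynomial.X 1)) ^ n 1 * planeForm 1 (u (MvPolynomial.X 2)) ^ n 2)) :
    D ∣ planeForm d (u P) - Polynomial.C (coeff (Finsupp.single 0 1) P) *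
      planeForm d (u (MvPolynomial.X 0)) := by
  set e : Fin 3 →₀ ℕ := Finsupp.single 0 1 with he
  have hX : u (monomial e (coeff e P)) = C (coeff e P) * u (MvPolynomial.X 0) := by
    rw [algEquiv_monomial, he, Fin.prod_univ_three]
    simp
  have hsub : planeForm d (u P) - Polynomial.C (coeff e P) * planeForm d (u (MvPolynomial.X 0)) =
      planeForm d (u (P - monomial e (coeff e P))) := by
    rw [map_sub, hX, planeForm, planeForm, planeForm, map_sub, map_mul, planeSubst_C,
      Polynomial.coeff_sub, Polynomial.coeff_C_mul]
  rw [hsub]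
  refine dvd_planeForm_map h1 h2 fun n hn => ?_
  rw [mem_support_iff, coeff_sub, coeff_monomial] at hn
  split_ifs at hn with hne
  · rw [← hne, sub_self] at hn
    exact absurd rfl hn
  rw [sub_zero] at hn
  refine (hP n (mem_support_iff.2 hn)).resolve_left fun ⟨h0, h1, h2⟩ => hne ?_
  ext i
  fin_cases i <;> simp [he, h0, h1, h2]

end PlaneForm

/-! ### An inequality of Mason–Stothers type -/

section MasonStothers

open Polynomial

variable {k : Type*} [Field k] [CharZero k]

theorem natDegree_lt_of_iterate_derivative_eq_zero {p : k[X]} {n : ℕ} (hn : 0 < n)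
    (h : derivative^[n] p = 0) : p.natDegree < n := by
  by_contra! hlt
  have hcoeff := congrArg (fun q => q.coeff (p.natDegree - n)) h
  simp only [coeff_iterate_derivative, Nat.sub_add_cancel hlt, Polynomial.coeff_zero, nsmul_eq_mul,
    mul_eq_zero, Nat.cast_eq_zero, Nat.descFactorial_eq_zero_iff_lt, coeff_natDegree,
    leadingCoeff_eq_zero] at hcoeff
  rcases hcoeff with h | rfl
  · omega
  · rw [natDegree_zero] at hlt
    omega

omit [CharZero k] in
theorem eq_zero_of_pow_dvd_of_natDegree_lt {p A : k[X]} {n : ℕ} (hp : 0 < p.natDegree)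
    (hA : A.natDegree < n) (h : p ^ n ∣ A) : A = 0 := by
  refine eq_zero_of_dvd_of_natDegree_lt h (hA.trans_le ?_)
  rw [natDegree_pow]
  exact Nat.le_mul_of_pos_right n hp

/-- Differentiating `a` times kills `A`, and the derivative of `B` then has more zeros than its
degree permits. -/
theorem eq_zero_of_pow_dvd_of_pow_dvd_sub {p q A B : k[X]} {m a b c : ℕ} (hpq : IsCoprime p q)
    (hp : 0 < p.natDegree) (hq : 0 < q.natDegree) (hA : A.natDegree < a) (hB : B.natDegree ≤ m)
    (hb : b ≤ m) (hc : c ≤ m) (h : m + a < b + c) (hpB : p ^ b ∣ B) (hqAB : q ^ c ∣ A - B) :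
    A = 0 := by
  have hpB' : p ^ (b - a) ∣ derivative^[a] B := pow_sub_dvd_iterate_derivative_of_pow_dvd a hpB
  have hqB' : q ^ (c - a) ∣ derivative^[a] B := by
    have := pow_sub_dvd_iterate_derivative_of_pow_dvd a hqAB
    rwa [iterate_derivative_sub, iterate_derivative_eq_zero hA, zero_sub, dvd_neg] at this
  have hdeg : m - a < (p ^ (b - a) * q ^ (c - a)).natDegree := by
    rw [natDegree_mul (pow_ne_zero _ (ne_zero_of_natDegree_gt hp))
      (pow_ne_zero _ (ne_zero_of_natDegree_gt hq)), natDegree_pow, natDegree_pow]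
    have := Nat.le_mul_of_pos_right (b - a) hp
    have := Nat.le_mul_of_pos_right (c - a) hq
    omega
  have hB' : derivative^[a] B = 0 := by
    refine eq_zero_of_dvd_of_natDegree_lt (hpq.pow.mul_dvd hpB' hqB') (hdeg.trans_le' ?_)
    exact (natDegree_iterate_derivative B a).trans (Nat.sub_le_sub_right hB a)
  have hBa : B.natDegree < a :=
    natDegree_lt_of_iterate_derivative_eq_zero hA.pos hB'
  have hB0 : B = 0 := eq_zero_of_pow_dvd_of_natDegree_lt hp (by omega) hpB
  rw [hB0, sub_zero] at hqAB
  exact eq_zero_of_pow_dvd_of_natDegree_lt hq (by omega) hqAB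

end MasonStothers

end

/-! ### Three mountains are high -/

section

open MvPolynomial

variable {k : Type*} [Field k] {m : ℕ} (hm : 2 ≤ m)

theorem coeff_swapTame_apply (P : Poly k) (i j : ℕ) :
    coeff (Finsupp.single 1 i + Finsupp.single 2 j) ((swapTame k).1 P) =
      coeff (Finsupp.single 1 j + Finsupp.single 2 i) P := by
  have := coeff_rename_mapDomain (Equiv.swap 1 2) (Equiv.swap (1 : Fin 3) 2).injective P
    (Finsupp.single 1 j + Finsupp.single 2 i)
  rwa [Finsupp.mapDomain_add, Finsupp.mapDomain_single, Finsupp.mapDomain_single,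
    Equiv.swap_apply_left, Equiv.swap_apply_right, add_comm (Finsupp.single 2 j)] at this

theorem weightM11_mem_openStar : weightM11 m hm ∈ openStar (weightM11 m hm) :=
  ⟨weightM11_mem_nablaPlus hm, fun _ _ _ => rfl⟩

theorem fixes_swapTame_weightM11 : Fixes (swapTame k) (weightM11 m hm) :=
  (fixes_swapTame_iff (weightM11_mem_nablaPlus hm)).2 (by simp [height])

namespace Fixes

variable {u v : Tame k} {s : ℕ}

theorem weightM11_of_edgePt (hs : s ≤ m + 2) (hu : Fixes u (edgePt m s)) :
    Fixes u (weightM11 m hm) :=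
  Fixes.of_mem_admissibleHull (by simpa using hu)
    (mem_admissibleHull_of_mem_openStar (edgePt_mem_openStar hm hs))

theorem natDegree_planeSubst_X_one_le (hu : Fixes u (weightM11 m hm)) :
    (planeSubst k (u.1 (MvPolynomial.X 1))).natDegree ≤ 1 :=
  natDegree_planeSubst_le fun n hn _ =>
    (((fixes_iff_of_mem_openStar hm (weightM11_mem_openStar hm)).1 hu).2.1 n hn).2

theorem natDegree_planeSubst_X_two_le (hu : Fixes u (weightM11 m hm)) :
    (planeSubst k (u.1 (MvPolynomial.X 2))).natDegree ≤ 1 :=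
  natDegree_planeSubst_le fun n hn _ =>
    (((fixes_iff_of_mem_openStar hm (weightM11_mem_openStar hm)).1 hu).2.2 n hn).2.1

theorem edgePt_of_coeff_eq_zero (hu : Fixes u (weightM11 m hm))
    (h : coeff (Finsupp.single 1 1) (u.1 (MvPolynomial.X 2)) = 0) :
    Fixes u (edgePt m (m + 1)) := by
  obtain ⟨h0, h1, h2⟩ := (fixes_iff_of_mem_openStar hm (weightM11_mem_openStar hm)).1 hu
  refine (fixes_iff_of_mem_openStar hm (edgePt_mem_openStar hm (by omega))).2
    ⟨fun n hn => ?_, h1, fun n hn => ⟨(h2 n hn).1, (h2 n hn).2.1, .inl ?_⟩⟩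
  · refine (h0 n hn).imp_right (And.imp_right (Or.imp_right fun h => ⟨h.1, ?_⟩))
    rw [fanForm_edgePt_nonneg_iff hm (by omega) (by omega)]
    omega
  · by_contra hne
    rw [eq_single_one_of_add_le_one (h2 n hn).1 (h2 n hn).2.1 hne] at hn
    exact mem_support_iff.1 hn h

theorem edgePt_zero_of_planeForm_eq_zero (hu : Fixes u (weightM11 m hm))
    (h : planeForm m (u.1 (MvPolynomial.X 0)) = 0) : Fixes u (edgePt m 0) := by
  obtain ⟨h0, h1, h2⟩ := (fixes_iff_of_mem_openStar hm (weightM11_mem_openStar hm)).1 hu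
  refine (fixes_iff_of_mem_openStar hm (edgePt_mem_openStar hm (by omega))).2
    ⟨fun n hn => (h0 n hn).imp_right fun ⟨hn0, hn'⟩ => ⟨hn0, .inl ?_⟩, h1, fun n hn =>
      ⟨(h2 n hn).1, (h2 n hn).2.1, .inr (height_edgePt_eq_zero_iff.2 (.inl rfl))⟩⟩
  refine hn'.resolve_right fun ⟨_, _⟩ => ?_
  have hcoeff := congrArg (Polynomial.coeff · (n 1)) h
  simp only [coeff_planeForm, Polynomial.coeff_zero] at hcoeff
  rw [if_pos (by omega), ← eq_single_add_single_iff.2 ⟨hn0, rfl, by omega⟩] at hcoeff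
  exact mem_support_iff.1 hn hcoeff

include hm

theorem coeff_X_zero_eq_zero (hu : Fixes u (edgePt m s)) (hs : s ≤ m + 2) {j : ℕ} (hsj : s ≤ j)
    (hj : j ≤ m) :
    coeff (Finsupp.single 1 j + Finsupp.single 2 (m - j)) (u.1 (MvPolynomial.X 0)) = 0 := by
  by_contra h
  have hmem := ((fixes_iff_of_mem_openStar hm (edgePt_mem_openStar hm hs)).1 hu).1 _
    (mem_support_iff.2 h)
  simp only [Finsupp.coe_add, Pi.add_apply, Finsupp.single_apply] at hmem
  simp [fanForm_edgePt_nonneg_iff hm hs hj, hsj.not_gt, hj] at hmem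

theorem natDegree_planeForm_X_zero_lt (hu : Fixes u (edgePt m s)) (h1 : 1 ≤ s) (hs : s ≤ m + 2) :
    (planeForm m (u.1 (MvPolynomial.X 0))).natDegree < s := by
  refine Nat.lt_of_le_pred h1 (Polynomial.natDegree_le_iff_coeff_eq_zero.2 fun j hj => ?_)
  rw [coeff_planeForm]
  split_ifs with hjm
  · exact hu.coeff_X_zero_eq_zero hm hs (Nat.le_of_pred_lt hj) hjm
  · rfl

theorem X_pow_dvd_planeForm_swapTame_mul_X_zero (hu : Fixes u (edgePt m s)) (h1 : 1 ≤ s)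
    (hs : s ≤ m + 2) :
    Polynomial.X ^ (m + 1 - s) ∣ planeForm m ((swapTame k * u).1 (MvPolynomial.X 0)) := by
  refine Polynomial.X_pow_dvd_iff.2 fun j hj => ?_
  have hjm : j ≤ m := by omega
  rw [coeff_planeForm, if_pos hjm]
  refine (coeff_swapTame_apply _ j (m - j)).trans ?_
  have := hu.coeff_X_zero_eq_zero hm hs (j := m - j) (by omega) (m.sub_le j)
  rwa [Nat.sub_sub_self hjm] at this

theorem dvd_planeForm_mul_sub {D : Polynomial k} (hv : Fixes v (weightM11 m hm))
    (hu : Fixes u (edgePt m s)) (hs : s ≤ m + 2)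
    (hD : ∀ j < s, j ≤ m → D ∣ planeForm 1 (v.1 (MvPolynomial.X 1)) ^ j *
      planeForm 1 (v.1 (MvPolynomial.X 2)) ^ (m - j)) :
    D ∣ planeForm m ((v * u).1 (MvPolynomial.X 0)) -
      Polynomial.C (coeff (Finsupp.single 0 1) (u.1 (MvPolynomial.X 0))) *
        planeForm m (v.1 (MvPolynomial.X 0)) := by
  have hmul : (v * u).1 (MvPolynomial.X 0) = v.1 (u.1 (MvPolynomial.X 0)) := rfl
  rw [hmul]
  refine dvd_planeForm_map_sub (hv.natDegree_planeSubst_X_one_le hm)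
    (hv.natDegree_planeSubst_X_two_le hm) fun n hn => ?_
  refine (((fixes_iff_of_mem_openStar hm (edgePt_mem_openStar hm hs)).1 hu).1 n hn).imp_right
    (And.imp_right ?_)
  rintro (hlt | ⟨hsum, hfan⟩)
  · exact ⟨hlt.le, fun h => absurd h hlt.ne⟩
  · rw [fanForm_edgePt_nonneg_iff hm hs (by omega)] at hfan
    refine ⟨hsum.le, fun _ => ?_⟩
    rw [show n 2 = m - n 1 by omega]
    exact hD _ hfan (by omega)

theorem pow_planeForm_dvd_planeForm_mul_sub (hv : Fixes v (weightM11 m hm))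
    (hu : Fixes u (edgePt m s)) (hs : s ≤ m + 2) :
    ∃ c : k, planeForm 1 (v.1 (MvPolynomial.X 2)) ^ (m + 1 - s) ∣
      planeForm m ((v * u).1 (MvPolynomial.X 0)) -
        Polynomial.C c * planeForm m (v.1 (MvPolynomial.X 0)) :=
  ⟨_, dvd_planeForm_mul_sub hm hv hu hs fun _ _ _ =>
    Dvd.dvd.mul_left (pow_dvd_pow _ (by omega)) _⟩

theorem planeForm_mul_X_zero_eq (hv : Fixes v (weightM11 m hm)) (hu : Fixes u (edgePt m 0)) :
    ∃ c : k, planeForm m ((v * u).1 (MvPolynomial.X 0)) =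
      Polynomial.C c * planeForm m (v.1 (MvPolynomial.X 0)) :=
  ⟨_, sub_eq_zero.1 <| zero_dvd_iff.1 <| dvd_planeForm_mul_sub hm hv hu (by omega)
    fun j hj => absurd hj j.not_lt_zero⟩

end Fixes

include hm

/-- The form of `x` is, up to scalars and modulo a power of a linear form in `z`, that of
`swapTame * y`; the former has low degree and the latter vanishes to a high order at `0`. -/
theorem fixes_edgePt_zero_of_sum_lt [CharZero k] {x y z b c c' : Tame k} {s₁ s₂ s₃ : ℕ}
    (hx : Fixes x (edgePt m s₁)) (hy : Fixes y (edgePt m s₂)) (hb : Fixes b (edgePt m s₃))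
    (hc : Fixes c (edgePt m 0)) (hc' : Fixes c' (edgePt m 0))
    (hz : z = swapTame k * y * c) (hxz : x = z * b * c')
    (h0 : (planeForm 1 (z.1 (MvPolynomial.X 2))).coeff 0 ≠ 0)
    (h1 : (planeForm 1 (z.1 (MvPolynomial.X 2))).coeff 1 ≠ 0)
    (hs₁ : 1 ≤ s₁) (hs₂ : 1 ≤ s₂) (hs₃ : 1 ≤ s₃) (hsum : s₁ + s₂ + s₃ < m + 2) :
    Fixes x (edgePt m 0) := by
  have hwy : Fixes (swapTame k * y) (weightM11 m hm) :=
    (fixes_swapTame_weightM11 hm).mul (hy.weightM11_of_edgePt hm (by omega))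
  have hwz : Fixes z (weightM11 m hm) := hz ▸ hwy.mul (hc.weightM11_of_edgePt hm (by omega))
  obtain ⟨α, hα⟩ := hwy.planeForm_mul_X_zero_eq hm hc
  obtain ⟨β, hβ⟩ := (hwz.mul (hb.weightM11_of_edgePt hm (by omega))).planeForm_mul_X_zero_eq hm hc'
  obtain ⟨δ, hδ⟩ := hwz.pow_planeForm_dvd_planeForm_mul_sub hm hb (by omega)
  rw [← hz] at hα
  rw [← hxz] at hβ
  have hdvd := hδ.mul_left (Polynomial.C β)
  rw [mul_sub, ← hβ, hα, ← mul_assoc, ← mul_assoc, ← Polynomial.C_mul, ← Polynomial.C_mul] at hdvd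
  have hcop : IsCoprime Polynomial.X (planeForm 1 (z.1 (MvPolynomial.X 2))) :=
    Polynomial.irreducible_X.coprime_iff_not_dvd.2 fun h => h0 (Polynomial.X_dvd_iff.1 h)
  refine (hx.weightM11_of_edgePt hm (by omega)).edgePt_zero_of_planeForm_eq_zero hm ?_
  exact eq_zero_of_pow_dvd_of_pow_dvd_sub hcop (Polynomial.natDegree_X.ge)
    (Polynomial.le_natDegree_of_ne_zero h1) (hx.natDegree_planeForm_X_zero_lt hm hs₁ (by omega))
    ((Polynomial.natDegree_C_mul_le _ _).trans (natDegree_planeForm_le m _))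
    (by omega) (by omega) (by omega)
    ((hy.X_pow_dvd_planeForm_swapTame_mul_X_zero hm hs₂ (by omega)).mul_left _) hdvd

theorem linkVert_eq_of_coeff_eq_zero {f g : Tame k} (hw : Fixes (g * f⁻¹) (weightM11 m hm))
    (h : coeff (Finsupp.single 1 1) ((g * f⁻¹).1 (MvPolynomial.X 2)) = 0) :
    linkVert m f (m + 1) = linkVert m g (m + 1) :=
  (linkVert_eq_iff_fixes hm (by omega)).2 (hw.edgePt_of_coeff_eq_zero hm h)

theorem coeff_one_planeForm_ne_zero {f g : Tame k} (hw : Fixes (g * f⁻¹) (weightM11 m hm))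
    (h : linkVert m f (m + 1) ≠ linkVert m g (m + 1)) :
    (planeForm 1 ((g * f⁻¹).1 (MvPolynomial.X 2))).coeff 1 ≠ 0 := by
  refine mt (fun h0 => linkVert_eq_of_coeff_eq_zero hm hw ?_) h
  simpa [coeff_planeForm] using h0

theorem coeff_zero_planeForm_ne_zero {f g : Tame k} (hw : Fixes (g * f⁻¹) (weightM11 m hm))
    (h : linkVert m f (m + 1) ≠ linkVert m (swapTame k * g) (m + 1)) :
    (planeForm 1 ((g * f⁻¹).1 (MvPolynomial.X 2))).coeff 0 ≠ 0 := by
  have hw' := (fixes_swapTame_weightM11 hm).mul hw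
  rw [← mul_assoc] at hw'
  refine mt (fun h0 => linkVert_eq_of_coeff_eq_zero hm hw' ?_) h
  have := coeff_swapTame_apply ((g * f⁻¹).1 (MvPolynomial.X 2)) 1 0
  rw [Finsupp.single_zero, add_zero] at this
  rw [mul_assoc]
  refine this.trans ?_
  simpa [coeff_planeForm] using h0

theorem add_two_le_sum_heights [CharZero k] {f₁ g₁ f₂ g₂ f₃ g₃ : Tame k} {s₁ s₂ s₃ : ℕ}
    (hs₁ : s₁ ∈ Set.Icc 1 (m + 1)) (hs₂ : s₂ ∈ Set.Icc 1 (m + 1)) (hs₃ : s₃ ∈ Set.Icc 1 (m + 1))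
    (top₁ : linkVert m f₁ s₁ = linkVert m g₁ s₁) (top₂ : linkVert m f₂ s₂ = linkVert m g₂ s₂)
    (top₃ : linkVert m f₃ s₃ = linkVert m g₃ s₃)
    (low₁ : linkVert m g₁ 0 = linkVert m f₂ 0) (low₂ : linkVert m g₂ 0 = linkVert m f₃ 0)
    (low₃ : linkVert m g₃ 0 = linkVert m f₁ 0) (turn₁ : linkEdge m g₁ 0 ≠ linkEdge m f₂ 0)
    (turn₂ : linkEdge m g₂ 0 ≠ linkEdge m f₃ 0) (turn₃ : linkEdge m g₃ 0 ≠ linkEdge m f₁ 0)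
    (hne : linkVert m f₁ 0 ≠ linkVert m g₁ 0) : m + 2 ≤ s₁ + s₂ + s₃ := by
  by_contra! hlt
  obtain ⟨h1₁, -⟩ := hs₁
  obtain ⟨h1₂, -⟩ := hs₂
  obtain ⟨h1₃, -⟩ := hs₃
  obtain ⟨f, hg₁, hf₂⟩ := exists_linkEdge_eq_and_linkEdge_eq_swapTame hm low₁ turn₁
  have hx : Fixes (f * f₁⁻¹) (edgePt m s₁) := (linkVert_eq_iff_fixes hm (by omega)).1
    (top₁.trans (linkVert_eq_of_linkEdge_zero_eq hm (by omega) hg₁))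
  have hy : Fixes (swapTame k * f * g₂⁻¹) (edgePt m s₂) := (linkVert_eq_iff_fixes hm (by omega)).1
    (top₂.symm.trans (linkVert_eq_of_linkEdge_zero_eq hm (by omega) hf₂))
  have hb := (linkVert_eq_iff_fixes hm (by omega)).1 top₃.symm
  have hc := (linkVert_eq_iff_fixes hm (by omega)).1 low₂.symm
  have hc' := (linkVert_eq_iff_fixes hm (by omega)).1 low₃.symm
  have hz : f * f₃⁻¹ = swapTame k * (swapTame k * f * g₂⁻¹) * (g₂ * f₃⁻¹) := by
    calc f * f₃⁻¹ = swapTame k * swapTame k * f * f₃⁻¹ := by rw [swapTame_mul_self, one_mul]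
      _ = _ := by group
  have hwz : Fixes (f * f₃⁻¹) (weightM11 m hm) := hz ▸ ((fixes_swapTame_weightM11 hm).mul
    (hy.weightM11_of_edgePt hm (by omega))).mul (hc.weightM11_of_edgePt hm (by omega))
  have up₁ := (linkVert_eq_of_linkVert_eq hm h1₁ (t := m + 1) (by omega) (by omega) top₁).trans
    (linkVert_eq_of_linkEdge_zero_eq hm (by omega) hg₁)
  have up₂ := (linkVert_eq_of_linkVert_eq hm h1₂ (t := m + 1) (by omega) (by omega) top₂).symm.trans
    (linkVert_eq_of_linkEdge_zero_eq hm (by omega) hf₂)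
  have up₃ := linkVert_eq_of_linkVert_eq hm h1₃ (t := m + 1) (by omega) (by omega) top₃
  have h0 := coeff_zero_planeForm_ne_zero hm hwz fun h =>
    turn₂ (linkEdge_zero_eq_of_linkVert_eq hm low₂ (up₂.trans h.symm))
  have h1 := coeff_one_planeForm_ne_zero hm hwz fun h =>
    turn₃ (linkEdge_zero_eq_of_linkVert_eq hm low₃ (up₃.symm.trans (h.trans up₁.symm)))
  have hfix := fixes_edgePt_zero_of_sum_lt hm hx hy hb hc hc' hz (by group) h0 h1 h1₁ h1₂ h1₃ hlt
  exact hne (((linkVert_eq_iff_fixes hm (by omega)).2 hfix).trans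
    (linkVert_eq_of_linkEdge_zero_eq hm (by omega) hg₁).symm)

end

/-! ### Walks in the link -/

section

open InnerProductGeometry

variable {k : Type*} [Field k] {m : ℕ} {hm : 2 ≤ m} {ν : X k} {h : Tame k}

theorem IsLinkEdge.pt_weightM11_eq (hν : ν = pt h (weightM11 m hm)) {f : Tame k} {s : ℕ}
    (hs : s ≤ m + 1) (hc : IsLinkEdge ν (linkEdge m f s)) : pt f (weightM11 m hm) = ν := by
  obtain ⟨g, hg, t, ht, hfg⟩ := hc.exists_eq_linkEdge hν
  obtain ⟨rfl, -⟩ := (linkEdge_eq_linkEdge_iff hm hs ht).1 hfg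
  exact (pt_weightM11_eq_of_linkEdge_eq hs hfg).trans hg

theorem LinkInc.eq_linkEdge_of_linkInc (hν : ν = pt h (weightM11 m hm)) {f g : Tame k} {s t : ℕ}
    (h1 : 1 ≤ s) (hst : s ≤ t) (ht : t ≤ m + 2) {c : Set (X k)}
    (hf : LinkInc ν c (linkVert m f s)) (hg : LinkInc ν c (linkVert m g t))
    (hne : linkVert m f s ≠ linkVert m g t) : c = linkEdge m f s := by
  obtain ⟨u, -, r, hr, rfl, hfu⟩ := hf.exists_eq_linkEdge hν
  rcases hfu with hfu | hfu
  · obtain ⟨rfl, -⟩ := (linkVert_eq_linkVert_iff hm (by omega) (by omega)).1 hfu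
    exact (linkEdge_eq_of_linkVert_eq hm h1 hr hfu).symm
  · obtain ⟨rfl, -⟩ := (linkVert_eq_linkVert_iff hm (by omega) (by omega)).1 hfu
    rcases hg.eq_linkVert hν hr with hgu | hgu
    · obtain ⟨rfl, -⟩ := (linkVert_eq_linkVert_iff hm ht (by omega)).1 hgu
      omega
    · exact absurd (hfu.trans hgu.symm) hne

theorem angle_fanTangent_le_angleX_linkVert (hf : pt f (weightM11 m hm) = ν) {s t : ℕ}
    (hs : s ≤ m + 2) (ht : t ≤ m + 2) :
    angle (fanTangent m (edgeParam s)) (fanTangent m (edgeParam t)) ≤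
      angleX ν (linkVert m f s) (linkVert m f t) :=
  hf ▸ angle_fanTangent_le_angleX hm (edgeParam_mem_Icc hs) (edgeParam_mem_Icc ht) f

/-- An infinite walk without backtracking in the link of `ν`. -/
structure LinkWalk (ν : X k) where
  /-- the vertices -/
  vert : ℕ → Set (X k)
  /-- the edges -/
  edge : ℕ → Set (X k)
  inc_left : ∀ j, LinkInc ν (edge j) (vert j)
  inc_right : ∀ j, LinkInc ν (edge j) (vert (j + 1))
  vert_ne : ∀ j, vert j ≠ vert (j + 1)
  edge_ne : ∀ j, edge j ≠ edge (j + 1)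

namespace LinkWalk

/-- From time `p` on, the walk climbs the fan of the chamber of `f` from level `0` to level `s`. -/
structure Ascends (W : LinkWalk ν) (m p : ℕ) (f : Tame k) (s : ℕ) : Prop where
  vert : ∀ j ≤ s, W.vert (p + j) = linkVert m f j
  edge : ∀ j < s, W.edge (p + j) = linkEdge m f j

/-- From time `p` on, the walk descends the fan of the chamber of `g` from level `s` to level `0`.
The levels are indexed by sums, which avoids truncated subtraction. -/
structure Descends (W : LinkWalk ν) (m p : ℕ) (g : Tame k) (s : ℕ) : Prop where
  vert : ∀ i j, i + j = s → W.vert (p + i) = linkVert m g j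
  edge : ∀ i j, i + j + 1 = s → W.edge (p + i) = linkEdge m g j

/-- From time `p` on, the walk climbs from level `0` to level `s` in the chamber of `f`, and then
descends to level `0` in the chamber of `g`. -/
structure Mountain (W : LinkWalk ν) (m p : ℕ) (f g : Tame k) (s : ℕ) : Prop where
  one_le : 1 ≤ s
  le_top : s ≤ m + 2
  up : W.Ascends m p f s
  down : W.Descends m (p + s) g s

variable {W : LinkWalk ν} {p s : ℕ} {f g : Tame k}

theorem exists_step (hν : ν = pt h (weightM11 m hm)) (hs : s ≤ m + 2)
    (hp : W.vert p = linkVert m f s) :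
    ∃ g, linkVert m f s = linkVert m g s ∧
      ((s ≤ m + 1 ∧ W.edge p = linkEdge m g s ∧ W.vert (p + 1) = linkVert m g (s + 1)) ∨
        ∃ t, s = t + 1 ∧ W.edge p = linkEdge m g t ∧ W.vert (p + 1) = linkVert m g t) := by
  obtain ⟨g, -, t, ht, hedge, hvert⟩ := (W.inc_left p).exists_eq_linkEdge hν
  have hnext := (hedge ▸ W.inc_right p).eq_linkVert hν ht
  have hne := W.vert_ne p
  refine ⟨g, ?_⟩
  rw [hp] at hvert hne
  rcases hvert with hvert | hvert
  · obtain ⟨rfl, -⟩ := (linkVert_eq_linkVert_iff hm hs (by omega)).1 hvert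
    exact ⟨hvert, .inl ⟨ht, hedge, hnext.resolve_left fun h => hne (hvert.trans h.symm)⟩⟩
  · obtain ⟨rfl, -⟩ := (linkVert_eq_linkVert_iff hm hs (by omega)).1 hvert
    exact ⟨hvert, .inr ⟨t, rfl, hedge, hnext.resolve_right fun h => hne (hvert.trans h.symm)⟩⟩

/-- The face above a vertex of positive level is determined by that vertex, so a walk that goes down
cannot turn up again before it reaches level `0`. -/
theorem exists_descends (hν : ν = pt h (weightM11 m hm)) :
    ∀ {s p : ℕ} {g : Tame k}, s ≤ m + 1 → W.vert p = linkVert m g (s + 1) →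
      W.edge p = linkEdge m g s → W.vert (p + 1) = linkVert m g s →
      ∃ g', W.Descends m p g' (s + 1)
  | 0, p, g, _, hv, he, hv' => by
    refine ⟨g, fun i j hij => ?_, fun i j hij => ?_⟩
    · obtain ⟨rfl, rfl⟩ | ⟨rfl, rfl⟩ : i = 0 ∧ j = 1 ∨ i = 1 ∧ j = 0 := by omega
      exacts [hv, hv']
    · obtain ⟨rfl, rfl⟩ : i = 0 ∧ j = 0 := by omega
      exact he
  | s + 1, p, g, hs, hv, he, hv' => by
    obtain ⟨f, hf, ⟨-, he', -⟩ | ⟨t, ht, he', hv''⟩⟩ := exists_step hν (by omega) hv'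
    · have hfg := linkEdge_eq_of_linkVert_eq hm (by omega) hs hf
      exact absurd (he.trans (hfg.trans he'.symm)) (W.edge_ne p)
    · obtain rfl : s = t := by omega
      obtain ⟨g', D⟩ := exists_descends hν (by omega) (hv'.trans hf) he' hv''
      have hgg' : linkVert m g (s + 1) = linkVert m g' (s + 1) :=
        hv'.symm.trans (D.vert 0 (s + 1) (by omega))
      refine ⟨g', fun i j hij => ?_, fun i j hij => ?_⟩ <;> obtain _ | i := i
      · obtain rfl : j = s + 1 + 1 := by omega
        exact hv.trans (linkVert_eq_of_linkVert_eq hm (by omega) (by omega) (by omega) hgg')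
      · simpa only [add_assoc, add_comm 1] using D.vert i j (by omega)
      · obtain rfl : j = s + 1 := by omega
        exact he.trans (linkEdge_eq_of_linkVert_eq hm (by omega) hs hgg')
      · simpa only [add_assoc, add_comm 1] using D.edge i j (by omega)

theorem Ascends.succ (A : W.Ascends m p f s) (he : W.edge (p + s) = linkEdge m f s)
    (hv : W.vert (p + s + 1) = linkVert m f (s + 1)) : W.Ascends m p f (s + 1) where
  vert j hj := by
    obtain rfl | hj := hj.eq_or_lt
    exacts [hv, A.vert j (by omega)]
  edge j hj := by
    obtain rfl | hj := (Nat.le_of_lt_succ hj).eq_or_lt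
    exacts [he, A.edge j hj]

theorem Ascends.exists_mountain (hν : ν = pt h (weightM11 m hm)) {s : ℕ} (h1 : 1 ≤ s)
    (hs : s ≤ m + 2) (A : W.Ascends m p f s) : ∃ g t, W.Mountain m p f g t := by
  obtain ⟨g, hfg, ⟨hs', he, hv⟩ | ⟨t, rfl, he, hv⟩⟩ := exists_step hν hs (A.vert s le_rfl)
  · have he' := he.trans (linkEdge_eq_of_linkVert_eq hm h1 hs' hfg).symm
    have hv' := hv.trans
      (linkVert_eq_of_linkVert_eq hm h1 (Nat.le_succ s) (by omega) hfg).symm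
    exact (A.succ he' hv').exists_mountain hν (by omega) (by omega)
  · obtain ⟨g', D⟩ := exists_descends hν (by omega) ((A.vert _ le_rfl).trans hfg) he hv
    exact ⟨g', t + 1, h1, hs, A, D⟩
termination_by m + 2 - s

theorem exists_mountain (hν : ν = pt h (weightM11 m hm)) (hp : W.vert p = linkVert m f 0) :
    ∃ f' g s, W.Mountain m p f' g s := by
  obtain ⟨f', hf, ⟨-, he, hv⟩ | ⟨t, ht, -⟩⟩ := exists_step hν (by omega) hp
  · have A : W.Ascends m p f' 0 := by
      refine ⟨fun j hj => ?_, by simp⟩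
      obtain rfl := Nat.le_zero.1 hj
      exact hp.trans hf
    exact ⟨f', (A.succ he hv).exists_mountain hν le_rfl (by omega)⟩
  · omega

namespace Mountain

theorem vert_peak (M : W.Mountain m p f g s) : linkVert m f s = linkVert m g s :=
  (M.up.vert s le_rfl).symm.trans (M.down.vert 0 s (zero_add s))

theorem vert_start (M : W.Mountain m p f g s) : W.vert p = linkVert m f 0 :=
  M.up.vert 0 s.zero_le

theorem edge_start (M : W.Mountain m p f g s) : W.edge p = linkEdge m f 0 :=
  M.up.edge 0 M.one_le

theorem vert_end (M : W.Mountain m p f g s) : W.vert (p + 2 * s) = linkVert m g 0 := by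
  simpa only [two_mul, add_assoc] using M.down.vert s 0 rfl

theorem edge_end_ne (M : W.Mountain m p f g s) : linkEdge m g 0 ≠ W.edge (p + 2 * s) := by
  have h1 := M.one_le
  rw [← M.down.edge (s - 1) 0 (by omega), show p + 2 * s = p + s + (s - 1) + 1 by omega]
  exact W.edge_ne _

include hm in
theorem add_two_mul_le_of_vert_eq (M : W.Mountain m p f g s) {f₀ : Tame k} {N : ℕ} (hp : p < N)
    (hN : W.vert N = linkVert m f₀ 0) : p + 2 * s ≤ N := by
  have := M.le_top
  have hzero {j : ℕ} {f₁ : Tame k} (hj : j ≤ m + 2) (h : W.vert N = linkVert m f₁ j) : j = 0 :=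
    ((linkVert_eq_linkVert_iff hm hj (by omega)).1 (h.symm.trans hN)).1
  by_contra! hlt
  obtain hle | hle := le_or_gt N (p + s)
  · obtain ⟨j, rfl⟩ := Nat.exists_eq_add_of_le hp.le
    have := hzero (by omega) (M.up.vert j (by omega))
    omega
  · obtain ⟨i, rfl⟩ := Nat.exists_eq_add_of_le hle.le
    have := hzero (by omega) (M.down.vert i (s - i) (by omega))
    omega

theorem pt_weightM11_left (hν : ν = pt h (weightM11 m hm)) (M : W.Mountain m p f g s) :
    pt f (weightM11 m hm) = ν :=
  (M.edge_start ▸ (W.inc_left p).isLinkEdge).pt_weightM11_eq hν (Nat.zero_le _)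

theorem pt_weightM11_right (hν : ν = pt h (weightM11 m hm)) (M : W.Mountain m p f g s) :
    pt g (weightM11 m hm) = ν := by
  have h1 := M.one_le
  have he := (W.inc_left (p + s + (s - 1))).isLinkEdge
  rw [M.down.edge (s - 1) 0 (by omega)] at he
  exact he.pt_weightM11_eq hν (Nat.zero_le _)

end Mountain

/-! ### Lengths of walks -/

/-- The length of the part of the walk before time `p`. -/
noncomputable def len (W : LinkWalk ν) (p : ℕ) : ℝ :=
  ∑ j ∈ Finset.range p, angleX ν (W.vert j) (W.vert (j + 1))

theorem len_succ (W : LinkWalk ν) (p : ℕ) :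
    W.len (p + 1) = W.len p + angleX ν (W.vert p) (W.vert (p + 1)) :=
  Finset.sum_range_succ _ _

theorem angleX_nonneg (hν : ν = pt h (weightM11 m hm)) (W : LinkWalk ν) (j : ℕ) :
    0 ≤ angleX ν (W.vert j) (W.vert (j + 1)) := by
  obtain ⟨f, -, s, hs, hj⟩ := (W.inc_left j).isLinkVertex.exists_eq_linkVert hν
  obtain ⟨g, hg, ⟨hs', he, hv⟩ | ⟨t, rfl, he, hv⟩⟩ := exists_step hν hs hj
  all_goals
    have hpt := (he ▸ (W.inc_left j).isLinkEdge).pt_weightM11_eq hν (by omega)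
    rw [hj, hg, hv]
    exact (angle_nonneg _ _).trans
      (angle_fanTangent_le_angleX_linkVert hpt (by omega) (by omega))

theorem len_mono (hν : ν = pt h (weightM11 m hm)) (W : LinkWalk ν) : Monotone W.len :=
  monotone_nat_of_le_succ fun p => by
    rw [len_succ]
    exact le_add_of_nonneg_right (W.angleX_nonneg hν p)

theorem Ascends.len_add_fanAngle_le (hf : pt f (weightM11 m hm) = ν) {s : ℕ} (hs : s ≤ m + 2)
    (A : W.Ascends m p f s) :
    W.len p + fanAngle m s ≤ W.len (p + s) := by
  induction s with
  | zero => rw [fanAngle_zero hm, add_zero, add_zero]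
  | succ s ih =>
    have hs' := ih (by omega)
      ⟨fun j hj => A.vert j (by omega), fun j hj => A.edge j (by omega)⟩
    have hstep := angle_fanTangent_le_angleX_linkVert hf (show s ≤ m + 2 by omega) hs
    have htri := fanAngle_succ_le m s
    rw [← add_assoc, len_succ, A.vert s (by omega), add_assoc p, A.vert (s + 1) le_rfl]
    linarith

theorem Descends.len_add_fanAngle_le (hg : pt g (weightM11 m hm) = ν) {s p : ℕ} (hs : s ≤ m + 2)
    (D : W.Descends m p g s) :
    W.len p + fanAngle m s ≤ W.len (p + s) := by
  induction s generalizing p with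
  | zero => rw [fanAngle_zero hm, add_zero, add_zero]
  | succ s ih =>
    have D' : W.Descends m (p + 1) g s := by
      refine ⟨fun i j hij => ?_, fun i j hij => ?_⟩ <;> rw [add_assoc, add_comm 1]
      exacts [D.vert (i + 1) j (by omega), D.edge (i + 1) j (by omega)]
    have hs' := ih (by omega) D'
    have hstep := angle_fanTangent_le_angleX_linkVert hg hs (show s ≤ m + 2 by omega)
    have htri := fanAngle_succ_le m s
    rw [angle_comm (fanTangent m (edgeParam s))] at htri
    have hv := D.vert 0 (s + 1) (by omega)
    rw [add_zero] at hv
    rw [len_succ, hv, D.vert 1 s (by omega)] at hs'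
    rw [← add_assoc, add_right_comm]
    linarith

theorem Mountain.len_add_two_mul_fanAngle_le (hν : ν = pt h (weightM11 m hm))
    (M : W.Mountain m p f g s) :
    W.len p + 2 * fanAngle m s ≤ W.len (p + 2 * s) := by
  have hup := M.up.len_add_fanAngle_le (M.pt_weightM11_left hν) M.le_top
  have hdown := M.down.len_add_fanAngle_le (M.pt_weightM11_right hν) M.le_top
  rw [two_mul s, ← add_assoc]
  linarith

end LinkWalk

/-! ### Cycles in the link -/

namespace LinkCycle

open scoped Fin.CommRing

/-- The periodic walk along a cycle, starting at its `i`-th vertex. -/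
def walk (γ : LinkCycle ν) (i : Fin (γ.n + 2)) : LinkWalk ν where
  vert j := γ.vert (i + (j : Fin (γ.n + 2)))
  edge j := γ.edge (i + (j : Fin (γ.n + 2)))
  inc_left _ := γ.inc_left _
  inc_right j := by
    rw [Nat.cast_succ, ← add_assoc]
    exact γ.inc_right _
  vert_ne j h := by simpa using γ.vert_injective h
  edge_ne j h := by simpa using γ.edge_injective h

theorem walk_vert_zero (γ : LinkCycle ν) (i : Fin (γ.n + 2)) : (γ.walk i).vert 0 = γ.vert i := by
  simp [walk]

theorem walk_vert_period (γ : LinkCycle ν) (i : Fin (γ.n + 2)) :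
    (γ.walk i).vert (γ.n + 2) = (γ.walk i).vert 0 := by
  simp only [walk, Fin.natCast_self, Nat.cast_zero]

theorem walk_edge_period (γ : LinkCycle ν) (i : Fin (γ.n + 2)) :
    (γ.walk i).edge (γ.n + 2) = (γ.walk i).edge 0 := by
  simp only [walk, Fin.natCast_self, Nat.cast_zero]

theorem injOn_add_natCast {n : ℕ} (i : Fin (n + 2)) :
    Set.InjOn (fun a : ℕ => i + (a : Fin (n + 2))) (Set.Iio (n + 2)) := by
  intro a ha b hb hab
  have := congrArg Fin.val (add_left_cancel hab)
  rwa [Fin.val_natCast, Fin.val_natCast, Nat.mod_eq_of_lt ha, Nat.mod_eq_of_lt hb] at this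

theorem walk_vert_injOn (γ : LinkCycle ν) (i : Fin (γ.n + 2)) :
    Set.InjOn (γ.walk i).vert (Set.Iio (γ.n + 2)) :=
  γ.vert_injective.comp_injOn (injOn_add_natCast i)

theorem walk_edge_injOn (γ : LinkCycle ν) (i : Fin (γ.n + 2)) :
    Set.InjOn (γ.walk i).edge (Set.Iio (γ.n + 2)) :=
  γ.edge_injective.comp_injOn (injOn_add_natCast i)

theorem range_vert_eq_image_walk (γ : LinkCycle ν) (i : Fin (γ.n + 2)) :
    Set.range γ.vert = (γ.walk i).vert '' Set.Icc 0 (γ.n + 2) := by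
  refine Set.Subset.antisymm ?_ (Set.image_subset_iff.2 fun _ _ => Set.mem_range_self _)
  rintro _ ⟨j, rfl⟩
  exact ⟨(j - i).val, ⟨Nat.zero_le _, (j - i).isLt.le⟩, by simp [walk]⟩

theorem range_edge_eq_image_walk (γ : LinkCycle ν) (i : Fin (γ.n + 2)) :
    Set.range γ.edge = (γ.walk i).edge '' Set.Ico 0 (γ.n + 2) := by
  refine Set.Subset.antisymm ?_ (Set.image_subset_iff.2 fun _ _ => Set.mem_range_self _)
  rintro _ ⟨j, rfl⟩
  exact ⟨(j - i).val, ⟨Nat.zero_le _, (j - i).isLt⟩, by simp [walk]⟩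

theorem length_eq_len_walk (γ : LinkCycle ν) (i : Fin (γ.n + 2)) :
    γ.length = (γ.walk i).len (γ.n + 2) := by
  rw [length, ← Equiv.sum_comp (Equiv.addLeft i), LinkWalk.len, Finset.sum_range]
  refine Finset.sum_congr rfl fun j _ => ?_
  simp only [walk, Equiv.coe_addLeft, Nat.cast_succ, Fin.cast_val_eq_self, add_assoc]

/-- At a vertex of minimal level of a cycle, the two edges of the cycle go up; if the level were
positive, they would both be the unique edge above that vertex. -/
theorem exists_vert_eq_linkVert_zero (hν : ν = pt h (weightM11 m hm)) (γ : LinkCycle ν) :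
    ∃ i f, γ.vert i = linkVert m f 0 := by
  choose f _ s hs hv using fun i => (γ.inc_left i).isLinkVertex.exists_eq_linkVert hν
  obtain ⟨i, hi⟩ := Finite.exists_min s
  obtain h0 | h1 := Nat.eq_zero_or_pos (s i)
  · exact ⟨i, f i, h0 ▸ hv i⟩
  have key (c : Set (X k)) (j : Fin (γ.n + 2)) (hci : LinkInc ν c (γ.vert i))
      (hcj : LinkInc ν c (γ.vert j)) (hij : i ≠ j) : c = linkEdge m (f i) (s i) := by
    refine (hv i ▸ hci).eq_linkEdge_of_linkInc hν h1 (hi j) (hs j) (hv j ▸ hcj) ?_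
    rw [← hv i, ← hv j]
    exact γ.vert_injective.ne hij
  have hnext := key (γ.edge i) (i + 1) (γ.inc_left i) (γ.inc_right i) (by simp)
  have hprev := key (γ.edge (i - 1)) (i - 1) (by simpa using γ.inc_right (i - 1))
    (γ.inc_left (i - 1)) (by simp [eq_sub_iff_add_eq])
  have := γ.edge_injective (hnext.trans hprev.symm)
  simp [eq_sub_iff_add_eq] at this

end LinkCycle

end

/-! ### Cycles with one or two peaks -/

section

variable {k : Type*} [Field k] {m : ℕ} {hm : 2 ≤ m} {ν : X k} {h f g f' g' : Tame k} {s t p : ℕ}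

namespace LinkWalk.Mountain

include hm in
theorem congr {W : LinkWalk ν} (M : W.Mountain m p f g s)
    (hf : linkEdge m f 0 = linkEdge m f' 0) (hg : linkEdge m g 0 = linkEdge m g' 0) :
    W.Mountain m p f' g' s := by
  have hs := M.le_top
  have vert {u u' : Tame k} {j : ℕ} (hu : linkEdge m u 0 = linkEdge m u' 0) (hj : j ≤ s) :=
    linkVert_eq_of_linkEdge_zero_eq hm (by omega : j ≤ m + 2) hu
  have edge {u u' : Tame k} {j : ℕ} (hu : linkEdge m u 0 = linkEdge m u' 0) (hj : j < s) :=
    linkEdge_eq_of_linkEdge_eq hm j.zero_le (by omega : j ≤ m + 1) hu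
  exact ⟨M.one_le, hs,
    ⟨fun j hj => (M.up.vert j hj).trans (vert hf hj),
      fun j hj => (M.up.edge j hj).trans (edge hf hj)⟩,
    ⟨fun i j hij => (M.down.vert i j hij).trans (vert hg (by omega)),
      fun i j hij => (M.down.edge i j hij).trans (edge hg (by omega))⟩⟩

theorem image_vert {W : LinkWalk ν} (M : W.Mountain m p f g s) :
    W.vert '' Set.Icc p (p + 2 * s) =
      {x | ∃ j ≤ s, x = linkVert m f j ∨ x = linkVert m g j} := by
  ext x
  constructor
  · rintro ⟨n, ⟨hn, hn'⟩, rfl⟩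
    obtain ⟨j, rfl⟩ := Nat.exists_eq_add_of_le hn
    obtain hj | hj := le_or_gt j s
    · exact ⟨j, hj, .inl (M.up.vert j hj)⟩
    · obtain ⟨i, rfl⟩ := Nat.exists_eq_add_of_le hj.le
      exact ⟨s - i, by omega, .inr (add_assoc p s i ▸ M.down.vert i _ (by omega))⟩
  · rintro ⟨j, hj, rfl | rfl⟩
    · exact ⟨p + j, ⟨by omega, by omega⟩, M.up.vert j hj⟩
    · exact ⟨p + s + (s - j), ⟨by omega, by omega⟩, M.down.vert _ j (by omega)⟩

theorem image_edge {W : LinkWalk ν} (M : W.Mountain m p f g s) :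
    W.edge '' Set.Ico p (p + 2 * s) =
      {c | ∃ j < s, c = linkEdge m f j ∨ c = linkEdge m g j} := by
  ext c
  constructor
  · rintro ⟨n, ⟨hn, hn'⟩, rfl⟩
    obtain ⟨j, rfl⟩ := Nat.exists_eq_add_of_le hn
    obtain hj | hj := lt_or_ge j s
    · exact ⟨j, hj, .inl (M.up.edge j hj)⟩
    · obtain ⟨i, rfl⟩ := Nat.exists_eq_add_of_le hj
      exact ⟨s - 1 - i, by omega, .inr (add_assoc p s i ▸ M.down.edge i _ (by omega))⟩
  · rintro ⟨j, hj, rfl | rfl⟩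
    · exact ⟨p + j, ⟨by omega, by omega⟩, M.up.edge j hj⟩
    · exact ⟨p + s + (s - 1 - j), ⟨by omega, by omega⟩, M.down.edge _ j (by omega)⟩

include hm in
theorem linkVert_eq_linkVert {W : LinkWalk ν} (M : W.Mountain m p f g s) {j : ℕ} (hsj : s ≤ j)
    (hj : j ≤ m + 2) : linkVert m f j = linkVert m g j :=
  linkVert_eq_of_linkVert_eq hm M.one_le hsj hj M.vert_peak

include hm in
theorem linkEdge_eq_linkEdge_iff {γ : LinkCycle ν} {i : Fin (γ.n + 2)}
    (M : (γ.walk i).Mountain m p f g s) (hp : p + 2 * s ≤ γ.n + 2) {j : ℕ} (hj : j ≤ m + 1) :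
    linkEdge m f j = linkEdge m g j ↔ s ≤ j := by
  refine ⟨fun hfg => ?_, fun hsj => ?_⟩
  · by_contra! hlt
    rw [← M.up.edge j hlt, ← M.down.edge (s - 1 - j) j (by omega)] at hfg
    have := γ.walk_edge_injOn i (Set.mem_Iio.2 (by omega)) (Set.mem_Iio.2 (by omega)) hfg
    omega
  · have hs := M.one_le
    exact linkEdge_eq_of_linkVert_eq hm (by omega) hj
      (M.linkVert_eq_linkVert (hm := hm) hsj (by omega))

end LinkWalk.Mountain

include hm in
theorem linkEdge_ne_linkEdge_swapTame_of_top
    (htop : linkEdge m f (m + 1) = linkEdge m g (m + 1)) {j i : ℕ} (hj : j ≤ m + 1)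
    (hi : i ≤ m + 1) : linkEdge m f j ≠ linkEdge m (swapTame k * g) i := by
  intro h
  obtain ⟨rfl, -⟩ := (linkEdge_eq_linkEdge_iff hm hj hi).1 h
  exact linkEdge_ne_linkEdge_swapTame hm g le_rfl
    (htop.symm.trans (linkEdge_eq_of_linkEdge_eq hm hj le_rfl h))

theorem mem_apartmentLink_edges_sdiff_iff (hf : pt f (weightM11 m hm) = ν)
    (hg : pt g (weightM11 m hm) = ν) (hsm : s ≤ m + 1)
    (hs : ∀ j ≤ m + 1, linkEdge m f j = linkEdge m g j ↔ s ≤ j)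
    (ht : ∀ j ≤ m + 1, linkEdge m (swapTame k * f) j = linkEdge m (swapTame k * g) j ↔ t ≤ j)
    (htm : t ≤ m + 2) {c : Set (X k)} :
    c ∈ (apartmentLink ν f).edges \ (apartmentLink ν g).edges ↔
      IsLinkEdge ν c ∧
        ((∃ j < s, c = linkEdge m f j) ∨ ∃ j < t, c = linkEdge m (swapTame k * f) j) := by
  have htop := (hs (m + 1) le_rfl).2 hsm
  rw [Set.mem_sdiff, mem_apartmentLink_edges_iff hf, mem_apartmentLink_edges_iff hg, not_and,
    and_assoc]
  refine and_congr_right fun hc => ⟨?_, ?_⟩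
  · rintro ⟨⟨j, hj, rfl | rfl⟩, hG⟩
    · exact .inl ⟨j, not_le.1 fun hsj => hG hc ⟨j, hj, .inl ((hs j hj).2 hsj)⟩, rfl⟩
    · exact .inr ⟨j, not_le.1 fun htj => hG hc ⟨j, hj, .inr ((ht j hj).2 htj)⟩, rfl⟩
  · rintro (⟨j, hj, rfl⟩ | ⟨j, hj, rfl⟩)
    · have hjm : j ≤ m + 1 := by omega
      refine ⟨⟨j, hjm, .inl rfl⟩, ?_⟩
      rintro - ⟨i, hi, h | h⟩
      · obtain ⟨rfl, -⟩ := (linkEdge_eq_linkEdge_iff hm hjm hi).1 h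
        exact hj.not_ge ((hs j hi).1 h)
      · exact linkEdge_ne_linkEdge_swapTame_of_top (hm := hm) htop hjm hi h
    · have hjm : j ≤ m + 1 := by omega
      refine ⟨⟨j, hjm, .inr rfl⟩, ?_⟩
      rintro - ⟨i, hi, h | h⟩
      · exact linkEdge_ne_linkEdge_swapTame_of_top (hm := hm) htop.symm hi hjm h.symm
      · obtain ⟨rfl, -⟩ := (linkEdge_eq_linkEdge_iff hm hjm hi).1 h
        exact hj.not_ge ((ht j hi).1 h)

theorem eq_linkVert_of_mem_apartmentLink_verts_sdiff (hf : pt f (weightM11 m hm) = ν)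
    (hg : pt g (weightM11 m hm) = ν)
    (hs : ∀ j, s ≤ j → j ≤ m + 2 → linkVert m f j = linkVert m g j)
    (ht : ∀ j, t ≤ j → j ≤ m + 2 →
      linkVert m (swapTame k * f) j = linkVert m (swapTame k * g) j)
    {x : Set (X k)} (hx : x ∈ (apartmentLink ν f).verts \ (apartmentLink ν g).verts) :
    (∃ j < s, x = linkVert m f j) ∨ ∃ j < t, x = linkVert m (swapTame k * f) j := by
  rw [Set.mem_sdiff, mem_apartmentLink_verts_iff hf, mem_apartmentLink_verts_iff hg] at hx
  obtain ⟨⟨hx, j, hj, rfl | rfl⟩, hG⟩ := hx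
  · exact .inl ⟨j, not_le.1 fun hsj => hG ⟨hx, j, hj, .inl (hs j hsj hj)⟩, rfl⟩
  · exact .inr ⟨j, not_le.1 fun htj => hG ⟨hx, j, hj, .inr (ht j htj hj)⟩, rfl⟩

theorem mem_union_sdiff_inter_iff {α : Type*} {A B : Set α} {x : α} :
    x ∈ (A ∪ B) \ (A ∩ B) ↔ x ∈ A \ B ∨ x ∈ B \ A :=
  (Set.ext_iff.1 (symmDiff_eq_sup_sdiff_inf A B) x).symm

namespace LinkCycle

theorem isLinkVertex_of_mem_range {γ : LinkCycle ν} {x : Set (X k)} (hx : x ∈ Set.range γ.vert) :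
    IsLinkVertex ν x := by
  obtain ⟨i, rfl⟩ := hx
  exact (γ.inc_left i).isLinkVertex

theorem isLinkEdge_of_mem_range {γ : LinkCycle ν} {c : Set (X k)} (hc : c ∈ Set.range γ.edge) :
    IsLinkEdge ν c := by
  obtain ⟨i, rfl⟩ := hc
  exact (γ.inc_left i).isLinkEdge

theorem mem_range_vert_of_linkInc (hν : ν = pt h (weightM11 m hm)) {γ : LinkCycle ν}
    {c x : Set (X k)} (hc : c ∈ Set.range γ.edge) (hcx : LinkInc ν c x) :
    x ∈ Set.range γ.vert := by
  obtain ⟨i, rfl⟩ := hc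
  obtain ⟨f, -, s, hs, hi, -⟩ := hcx.exists_eq_linkEdge hν
  have hne : γ.vert i ≠ γ.vert (i + 1) := fun h => by simpa using γ.vert_injective h
  rw [hi] at hcx
  obtain hx := hcx.eq_linkVert hν hs
  obtain hl := (hi ▸ γ.inc_left i).eq_linkVert hν hs
  obtain hr := (hi ▸ γ.inc_right i).eq_linkVert hν hs
  have hx' : x = γ.vert i ∨ x = γ.vert (i + 1) := by grind
  exact hx'.elim (fun h => ⟨i, h.symm⟩) fun h => ⟨i + 1, h.symm⟩

theorem eq_apartmentLink_of_mountain {γ : LinkCycle ν} {i : Fin (γ.n + 2)}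
    (hf : pt f (weightM11 m hm) = ν) (M : (γ.walk i).Mountain m 0 f (swapTame k * f) (m + 2))
    (hN : 2 * (m + 2) = γ.n + 2) : γ.toSubLink = apartmentLink ν f := by
  refine SubLink.ext (Set.ext fun x => ?_) (Set.ext fun c => ?_)
  · have hx := M.image_vert
    rw [zero_add, hN, ← γ.range_vert_eq_image_walk i] at hx
    rw [mem_apartmentLink_verts_iff hf]
    refine .trans ?_ (and_iff_right_of_imp fun h => isLinkVertex_of_mem_range (γ := γ) ?_).symm
    exacts [Set.ext_iff.1 hx x, hx ▸ h]
  · have hc := M.image_edge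
    rw [zero_add, hN, ← γ.range_edge_eq_image_walk i] at hc
    rw [mem_apartmentLink_edges_iff hf]
    refine .trans ?_ (and_iff_right_of_imp fun h => isLinkEdge_of_mem_range (γ := γ) ?_).symm
    all_goals simp only [← Nat.lt_succ_iff] at *
    exacts [Set.ext_iff.1 hc c, hc ▸ h]

theorem exists_eq_apartmentLink_of_mountain (hν : ν = pt h (weightM11 m hm))
    {γ : LinkCycle ν} {i : Fin (γ.n + 2)} (M : (γ.walk i).Mountain m 0 f g s)
    (hN : 2 * s = γ.n + 2) :
    ∃ f, pt f (weightM11 m hm) = ν ∧ γ.toSubLink = apartmentLink ν f := by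
  have hvert := M.vert_end
  have hedge := M.edge_end_ne
  rw [zero_add, hN, γ.walk_vert_period, M.vert_start] at hvert
  rw [zero_add, hN, γ.walk_edge_period, M.edge_start] at hedge
  obtain ⟨f', h1, h2⟩ := exists_linkEdge_eq_and_linkEdge_eq_swapTame hm hvert hedge.symm
  have M' := M.congr (hm := hm) h1 h2
  obtain rfl : s = m + 2 := by
    have hpeak := (linkVert_eq_linkVert_swapTame_iff hm f' M.le_top).1 M'.vert_peak
    have := M.one_le
    omega
  exact ⟨f', M'.pt_weightM11_left hν, eq_apartmentLink_of_mountain (M'.pt_weightM11_left hν) M' hN⟩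

theorem range_vert_eq_of_mountains {γ : LinkCycle ν} {i : Fin (γ.n + 2)}
    (M₁ : (γ.walk i).Mountain m 0 f g s) (M₂ : (γ.walk i).Mountain m (2 * s) g' f' t)
    (hN : 2 * s + 2 * t = γ.n + 2) :
    Set.range γ.vert = {x | ∃ j ≤ s, x = linkVert m f j ∨ x = linkVert m g j} ∪
      {x | ∃ j ≤ t, x = linkVert m g' j ∨ x = linkVert m f' j} := by
  rw [← M₁.image_vert, ← M₂.image_vert, ← Set.image_union, zero_add,
    Set.Icc_union_Icc_eq_Icc (Nat.zero_le _) (Nat.le_add_right _ _), hN,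
    γ.range_vert_eq_image_walk i]

theorem range_edge_eq_of_mountains {γ : LinkCycle ν} {i : Fin (γ.n + 2)}
    (M₁ : (γ.walk i).Mountain m 0 f g s) (M₂ : (γ.walk i).Mountain m (2 * s) g' f' t)
    (hN : 2 * s + 2 * t = γ.n + 2) :
    Set.range γ.edge = {c | ∃ j < s, c = linkEdge m f j ∨ c = linkEdge m g j} ∪
      {c | ∃ j < t, c = linkEdge m g' j ∨ c = linkEdge m f' j} := by
  rw [← M₁.image_edge, ← M₂.image_edge, ← Set.image_union, zero_add,
    Set.Ico_union_Ico_eq_Ico (Nat.zero_le _) (Nat.le_add_right _ _), hN,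
    γ.range_edge_eq_image_walk i]

theorem range_edge_eq_sdiff_of_mountains {γ : LinkCycle ν} {i : Fin (γ.n + 2)}
    (hν : ν = pt h (weightM11 m hm)) (M₁ : (γ.walk i).Mountain m 0 f g s)
    (M₂ : (γ.walk i).Mountain m (2 * s) (swapTame k * g) (swapTame k * f) t) (hs : s ≤ m + 1)
    (hN : 2 * s + 2 * t = γ.n + 2) :
    Set.range γ.edge = ((apartmentLink ν f).edges ∪ (apartmentLink ν g).edges) \
      ((apartmentLink ν f).edges ∩ (apartmentLink ν g).edges) := by
  have eq₁ (j) (hj : j ≤ m + 1) := M₁.linkEdge_eq_linkEdge_iff (hm := hm) (by omega) hj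
  have eq₂ (j) (hj : j ≤ m + 1) :=
    eq_comm.trans (M₂.linkEdge_eq_linkEdge_iff (hm := hm) (by omega) hj)
  have hf := M₁.pt_weightM11_left hν
  have hg := M₁.pt_weightM11_right hν
  have hrange := range_edge_eq_of_mountains M₁ M₂ hN
  ext c
  rw [mem_union_sdiff_inter_iff, mem_apartmentLink_edges_sdiff_iff hf hg hs eq₁ eq₂ M₂.le_top,
    mem_apartmentLink_edges_sdiff_iff hg hf hs (fun j hj => eq_comm.trans (eq₁ j hj))
      (fun j hj => eq_comm.trans (eq₂ j hj)) M₂.le_top, ← and_or_left]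
  refine .trans ?_ (and_iff_right_of_imp fun h => isLinkEdge_of_mem_range (γ := γ) ?_).symm
  all_goals
    simp only [hrange, Set.mem_union, Set.mem_ofPred_eq]
    grind

theorem eq_closureSymmDiff_of_mountains {γ : LinkCycle ν} {i : Fin (γ.n + 2)}
    (hν : ν = pt h (weightM11 m hm)) (M₁ : (γ.walk i).Mountain m 0 f g s)
    (M₂ : (γ.walk i).Mountain m (2 * s) (swapTame k * g) (swapTame k * f) t) (hs : s ≤ m + 1)
    (hN : 2 * s + 2 * t = γ.n + 2) :
    γ.toSubLink = closureSymmDiff ν (apartmentLink ν f) (apartmentLink ν g) := by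
  have hedge := range_edge_eq_sdiff_of_mountains hν M₁ M₂ hs hN
  refine SubLink.ext (Set.Subset.antisymm ?_ ?_) hedge
  · rintro _ ⟨j, rfl⟩
    exact .inr ⟨γ.edge j, hedge ▸ Set.mem_range_self j, γ.inc_left j⟩
  · have hf := M₁.pt_weightM11_left hν
    have hg := M₁.pt_weightM11_right hν
    have eq₁ (j) (hsj : s ≤ j) (hj : j ≤ m + 2) := M₁.linkVert_eq_linkVert (hm := hm) hsj hj
    have eq₂ (j) (htj : t ≤ j) (hj : j ≤ m + 2) :=
      (M₂.linkVert_eq_linkVert (hm := hm) htj hj).symm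
    rintro x (hx | ⟨c, hc, hcx⟩)
    · change x ∈ Set.range γ.vert
      simp only [range_vert_eq_of_mountains M₁ M₂ hN, Set.mem_union, Set.mem_ofPred_eq]
      obtain hx | hx := mem_union_sdiff_inter_iff.1 hx
      · have := eq_linkVert_of_mem_apartmentLink_verts_sdiff hf hg eq₁ eq₂ hx
        grind
      · have := eq_linkVert_of_mem_apartmentLink_verts_sdiff hg hf
          (fun j hsj hj => (eq₁ j hsj hj).symm) (fun j htj hj => (eq₂ j htj hj).symm) hx
        grind
    · exact mem_range_vert_of_linkInc hν (hedge ▸ hc) hcx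

theorem exists_eq_closureSymmDiff_of_mountains {γ : LinkCycle ν} {i : Fin (γ.n + 2)}
    (hν : ν = pt h (weightM11 m hm)) (M₁ : (γ.walk i).Mountain m 0 f g s)
    (M₂ : (γ.walk i).Mountain m (2 * s) f' g' t) (hs : s ≤ m + 1)
    (hN : 2 * s + 2 * t = γ.n + 2) :
    ∃ f g, pt f (weightM11 m hm) = ν ∧ pt g (weightM11 m hm) = ν ∧
      γ.toSubLink = closureSymmDiff ν (apartmentLink ν f) (apartmentLink ν g) := by
  have hend := M₁.vert_end
  have hend_ne := M₁.edge_end_ne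
  rw [zero_add, M₂.vert_start] at hend
  rw [zero_add, M₂.edge_start] at hend_ne
  have hstart := M₂.vert_end
  have hstart_ne := M₂.edge_end_ne
  rw [hN, γ.walk_vert_period, M₁.vert_start] at hstart
  rw [hN, γ.walk_edge_period, M₁.edge_start] at hstart_ne
  obtain ⟨u, hu, hu'⟩ :=
    exists_linkEdge_eq_and_linkEdge_eq_swapTame hm hstart hstart_ne.symm
  obtain ⟨v, hv, hv'⟩ := exists_linkEdge_eq_and_linkEdge_eq_swapTame hm hend.symm hend_ne
  have M₁' := M₁.congr (hm := hm) hu hv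
  exact ⟨u, v, M₁'.pt_weightM11_left hν, M₁'.pt_weightM11_right hν,
    eq_closureSymmDiff_of_mountains hν M₁' (M₂.congr (hm := hm) hv' hu') hs hN⟩

end LinkCycle

end

/-! ### Short cycles in the link -/

section

open Real

variable {k : Type*} [Field k] {m : ℕ} {hm : 2 ≤ m} {ν : X k} {h : Tame k}

namespace LinkWalk.Mountain

variable {W : LinkWalk ν} {f g : Tame k} {s p : ℕ}

theorem len_add_two_pi_div_three_le (hν : ν = pt h (weightM11 m hm))
    (M : W.Mountain m p f g s) : W.len p + 2 * π / 3 ≤ W.len (p + 2 * s) := by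
  have := M.len_add_two_mul_fanAngle_le hν
  have := pi_div_three_le_fanAngle hm M.one_le M.le_top
  linarith

theorem len_add_two_mul_arccos_le (hν : ν = pt h (weightM11 m hm))
    (M : W.Mountain m p f g s) (hs : m + 6 ≤ 6 * s) :
    W.len p + 2 * arccos (2 / 5) ≤ W.len (p + 2 * s) := by
  have := M.len_add_two_mul_fanAngle_le hν
  have := arccos_two_fifths_le_fanAngle hm hs M.le_top
  linarith

theorem height_le_of_len_lt (hν : ν = pt h (weightM11 m hm)) (M : W.Mountain m p f g s)
    (hlen : W.len (p + 2 * s) < W.len p + 2 * π) : s ≤ m + 1 := by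
  have hle := M.le_top
  by_contra! hlt
  obtain rfl : s = m + 2 := by omega
  have hM := M.len_add_two_mul_fanAngle_le hν
  rw [fanAngle_top hm] at hM
  linarith

end LinkWalk.Mountain

namespace LinkCycle

variable {γ : LinkCycle ν} {i : Fin (γ.n + 2)} {f₁ g₁ f₂ g₂ f₃ g₃ : Tame k} {s₁ s₂ s₃ : ℕ}

include hm in
theorem add_two_le_sum_heights_of_mountains [CharZero k]
    (M₁ : (γ.walk i).Mountain m 0 f₁ g₁ s₁) (M₂ : (γ.walk i).Mountain m (2 * s₁) f₂ g₂ s₂)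
    (M₃ : (γ.walk i).Mountain m (2 * s₁ + 2 * s₂) f₃ g₃ s₃)
    (hN : 2 * s₁ + 2 * s₂ + 2 * s₃ = γ.n + 2) : m + 2 ≤ s₁ + s₂ + s₃ := by
  by_contra! hlt
  have h₁ := M₁.one_le
  have h₂ := M₂.one_le
  have h₃ := M₃.one_le
  have end₁ := zero_add (2 * s₁) ▸ M₁.vert_end
  have ne₁ := zero_add (2 * s₁) ▸ M₁.edge_end_ne
  have end₃ := M₃.vert_end
  have ne₃ := M₃.edge_end_ne
  rw [hN, γ.walk_vert_period, M₁.vert_start] at end₃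
  rw [hN, γ.walk_edge_period, M₁.edge_start] at ne₃
  refine hlt.not_ge (add_two_le_sum_heights hm ⟨h₁, by omega⟩ ⟨h₂, by omega⟩ ⟨h₃, by omega⟩
    M₁.vert_peak M₂.vert_peak M₃.vert_peak (end₁.symm.trans M₂.vert_start)
    (M₂.vert_end.symm.trans M₃.vert_start) end₃.symm (M₂.edge_start ▸ ne₁)
    (M₃.edge_start ▸ M₂.edge_end_ne) ne₃ ?_)
  rw [← M₁.vert_start, ← end₁]
  intro heq
  have := γ.walk_vert_injOn i (Set.mem_Iio.2 (by omega)) (Set.mem_Iio.2 (by omega)) heq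
  omega

theorem le_length_of_three_mountains [CharZero k] (hν : ν = pt h (weightM11 m hm))
    (M₁ : (γ.walk i).Mountain m 0 f₁ g₁ s₁) (M₂ : (γ.walk i).Mountain m (2 * s₁) f₂ g₂ s₂)
    (M₃ : (γ.walk i).Mountain m (2 * s₁ + 2 * s₂) f₃ g₃ s₃)
    (hN : 2 * s₁ + 2 * s₂ + 2 * s₃ = γ.n + 2) :
    2 * π + 2 * (arccos (2 / 5) - π / 3) ≤ γ.length := by
  have hsum := add_two_le_sum_heights_of_mountains (hm := hm) M₁ M₂ M₃ hN
  have hlen₁ := M₁.len_add_two_pi_div_three_le hν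
  have hlen₂ := M₂.len_add_two_pi_div_three_le hν
  have hlen₃ := M₃.len_add_two_pi_div_three_le hν
  have hzero : (γ.walk i).len 0 = 0 := Finset.sum_range_zero _
  rw [length_eq_len_walk γ i, ← hN]
  rw [zero_add, hzero] at hlen₁
  obtain h | h | h : m + 6 ≤ 6 * s₁ ∨ m + 6 ≤ 6 * s₂ ∨ m + 6 ≤ 6 * s₃ := by omega
  · have hlen := M₁.len_add_two_mul_arccos_le hν h
    rw [zero_add, hzero] at hlen
    linarith
  · linarith [M₂.len_add_two_mul_arccos_le hν h]
  · linarith [M₃.len_add_two_mul_arccos_le hν h]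

theorem exists_mountain_of_lt (hν : ν = pt h (weightM11 m hm)) {f f₀ : Tame k} {p : ℕ}
    (h₀ : (γ.walk i).vert 0 = linkVert m f₀ 0) (hv : (γ.walk i).vert p = linkVert m f 0)
    (hp : p < γ.n + 2) :
    ∃ f' g s, (γ.walk i).Mountain m p f' g s ∧ p + 2 * s ≤ γ.n + 2 := by
  obtain ⟨f', g, s, M⟩ := LinkWalk.exists_mountain hν hv
  exact ⟨f', g, s, M,
    M.add_two_mul_le_of_vert_eq (hm := hm) hp ((γ.walk_vert_period i).trans h₀)⟩

theorem le_length_of_lt [CharZero k] (hν : ν = pt h (weightM11 m hm))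
    (M₁ : (γ.walk i).Mountain m 0 f₁ g₁ s₁) (M₂ : (γ.walk i).Mountain m (2 * s₁) f₂ g₂ s₂)
    (hN : 2 * s₁ + 2 * s₂ < γ.n + 2) :
    2 * π + 2 * (arccos (2 / 5) - π / 3) ≤ γ.length := by
  obtain ⟨f₃, g₃, s₃, M₃, h₃⟩ := exists_mountain_of_lt hν M₁.vert_start M₂.vert_end hN
  obtain h₃ | h₃ := h₃.eq_or_lt
  · exact le_length_of_three_mountains hν M₁ M₂ M₃ h₃
  obtain ⟨f₄, g₄, s₄, M₄, h₄⟩ := exists_mountain_of_lt hν M₁.vert_start M₃.vert_end h₃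
  have hlen₁ := M₁.len_add_two_pi_div_three_le hν
  have hlen₂ := M₂.len_add_two_pi_div_three_le hν
  have hlen₃ := M₃.len_add_two_pi_div_three_le hν
  have hlen₄ := M₄.len_add_two_pi_div_three_le hν
  have hmono := (γ.walk i).len_mono hν h₄
  have hzero : (γ.walk i).len 0 = 0 := Finset.sum_range_zero _
  have harccos : arccos (2 / 5) ≤ π / 2 := arccos_le_pi_div_two.2 (by norm_num)
  rw [zero_add, hzero] at hlen₁
  rw [length_eq_len_walk γ i]
  linarith [pi_pos]

theorem eq_of_length_lt [CharZero k] (hν : ν = pt h (weightM11 m hm)) (γ : LinkCycle ν)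
    (hγ : γ.length < 2 * π + 2 * (arccos (2 / 5) - π / 3)) :
    (∃ f, pt f (weightM11 m hm) = ν ∧ γ.toSubLink = apartmentLink ν f) ∨
      ∃ f g, pt f (weightM11 m hm) = ν ∧ pt g (weightM11 m hm) = ν ∧
        γ.toSubLink = closureSymmDiff ν (apartmentLink ν f) (apartmentLink ν g) := by
  obtain ⟨i, f, hi⟩ := exists_vert_eq_linkVert_zero hν γ
  rw [← walk_vert_zero] at hi
  obtain ⟨f₁, g₁, s₁, M₁, h₁⟩ := exists_mountain_of_lt hν hi hi (Nat.succ_pos _)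
  rw [zero_add] at h₁
  obtain h₁ | h₁ := h₁.eq_or_lt
  · exact .inl (exists_eq_apartmentLink_of_mountain hν M₁ h₁)
  have hv₁ := zero_add (2 * s₁) ▸ M₁.vert_end
  obtain ⟨f₂, g₂, s₂, M₂, h₂⟩ := exists_mountain_of_lt hν hi hv₁ h₁
  obtain h₂ | h₂ := h₂.eq_or_lt
  · refine .inr (exists_eq_closureSymmDiff_of_mountains hν M₁ M₂ (M₁.height_le_of_len_lt hν ?_) h₂)
    have hlen₂ := M₂.len_add_two_pi_div_three_le hν
    have hzero : (γ.walk i).len 0 = 0 := Finset.sum_range_zero _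
    have harccos : arccos (2 / 5) ≤ π / 2 := arccos_le_pi_div_two.2 (by norm_num)
    rw [length_eq_len_walk γ i, ← h₂] at hγ
    rw [zero_add, hzero]
    linarith [pi_pos]
  · exact absurd hγ (le_length_of_lt hν M₁ M₂ h₂).not_gt

end LinkCycle

end

end TameX

theorem mainTheorem8 (k : Type*) [Field k] [CharZero k] :
    ∃ ε₀ : ℝ, 0 < ε₀ ∧
      ∀ (m : ℕ) (hm : 2 ≤ m) (ν : TameX.X k),
        (∃ h : TameX.Tame k, ν = TameX.pt h (TameX.weightM11 m hm)) →
        ∀ γ : TameX.LinkCycle ν, γ.length < 2 * Real.pi + ε₀ →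
          (∃ f : TameX.Tame k, TameX.pt f (TameX.weightM11 m hm) = ν ∧
            γ.toSubLink = TameX.apartmentLink ν f) ∨
          (∃ f g : TameX.Tame k, TameX.pt f (TameX.weightM11 m hm) = ν ∧
            TameX.pt g (TameX.weightM11 m hm) = ν ∧
            γ.toSubLink = TameX.closureSymmDiff ν
              (TameX.apartmentLink ν f) (TameX.apartmentLink ν g)) :=
  ⟨2 * (Real.arccos (2 / 5) - Real.pi / 3),
    by linarith [TameX.pi_div_three_lt_arccos_two_fifths],
    fun _ _ _ ⟨_, hν⟩ γ hγ => TameX.LinkCycle.eq_of_length_lt hν γ hγ⟩
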